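/- Let $(M^m,g)$ and $(N^n,h)$ be smooth Riemannian manifolds (Hausdorff, $\sigma$-compact, without boundary), and let $\phi:M\to N$ be a Riemannian submersion: $\phi$ is smooth, every $d\phi_x$ is surjective, and $d\phi_x$ is isometric on the horizontal space $\mathcal H_x=(\ker d\phi_x)^\perp$ (surjectivity of $\phi$ is not required). Let $v^{\mathcal H}$ denote the horizontal part of a tangent vector $v$ of $M$, let $\nabla^M,\nabla^N$ be the Levi-Civita connections, and let $\nabla^\phi$ be the pull-back connection on $\phi^{-1}TN$. Write $R^N(X,Y)Z=[\nabla^N_X,\nabla^N_Y]Z-\nabla^N_{[X,Y]}Z$ and $\mathrm{Ric}^N(v)=\sum_k R^N(v,\varepsilon_k)\varepsilon_k$ for an orthonormal basis $(\varepsilon_k)$. Put $\tau(\phi)=\mathrm{Tr}_g\nabla d\phi$ (the tension field) and $\tau_2(\phi)=\mathrm{Tr}_g(\nabla^\phi)^2\tau(\phi)-\mathrm{Tr}_g R^N(d\phi,\tau(\phi))d\phi$ (the bitension field). The map $\phi$ is biharmonic if, for every compact $\Omega\subset M$, it is a critical point of $E_2(\cdot,\Omega)=\frac12\int_\Omega|\tau(\cdot)|^2\,dv_g$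 with respect to smooth variations supported in $\Omega$. Let $\mu=\frac1{m-n}\sum_s(\nabla^M_{e_s}e_s)^{\mathcal H}$, with $(e_s)$ a local orthonormal frame of the vertical distribution $\ker d\phi$, be the mean curvature vector field of the fibers ($\mu=0$ if $m=n$). A vector field on $M$ is basic if it is horizontal and $\phi$-related to a smooth vector field on the open set $\phi(M)\subset N$. (0) The field $\mu$ is basic if and only if $\tau(\phi)$ is constant along the fibers, i.e. $\tau(\phi)(p)=\tau(\phi)(q)$ whenever $\phi(p)=\phi(q)$. Suppose from now on that $\mu$ is basic. (1) For any family of smooth local orthonormal frames $\{e_i,e_s\}$ ($1\le i\le n$, $1\le s\le m-n$), with $e_i$ horizontal and $e_s$ vertical, whose domains cover $M$, one has $\mu=\frac1{m-n}\sum_s(\nabla^M_{e_s}e_s)^{\mathcal H}$ on these domains, and $\phi$ is biharmonic if and only if, on all these domains, $$d\phi\Big(\sum_{i=1}^n\big\{\nabla^M_{e_i}(\nabla^M_{e_i}\mu)^{\mathcal H}-\nabla^M_{(\nabla^M_{e_i}e_i)^{\mathcal H}}\mu\big\}-(m-n)\nabla^M_\mu\mu\Big)+\mathrm{Ric}^N(d\phi(\mu))=0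 .$$ (2) There is a vector field $T$ on $N$, smooth on $\phi(M)$, with $\tau(\phi)=T\circ\phi$; for any vector field $T$ on $N$ with $\tau(\phi)=T\circ\phi$ (so that $T=\tau(\phi)$ as a vector field on $\phi(M)$), $$\tau_2(\phi)=\big(\mathrm{Tr}_h(\nabla^N)^2T+\nabla^N_TT+\mathrm{Ric}^N(T)\big)\circ\phi ,$$ and $\phi$ is biharmonic if and only if $\mathrm{Tr}_h(\nabla^N)^2T+\nabla^N_TT+\mathrm{Ric}^N(T)=0$ on $\phi(M)$. -/

import Mathlib

open scoped Manifold ContDiff Bundle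
open Bundle MeasureTheory

noncomputable section

namespace BiharmonicSubmersion

/-- Vector fields (with no regularity) on a manifold of dimension `m`. -/
abbrev VField (m : ℕ) (M : Type*) [TopologicalSpace M] [ChartedSpace (EuclideanSpace ℝ (Fin m)) M] :
    Type _ :=
  (x : M) → TangentSpace (𝓡 m) x

instance instFiniteDimensionalTangentSpace {m : ℕ} {M : Type*} [TopologicalSpace M]
    [ChartedSpace (EuclideanSpace ℝ (Fin m)) M] (x : M) :
    FiniteDimensional ℝ (TangentSpace (𝓡 m) x) :=
  inferInstanceAs (FiniteDimensional ℝ (EuclideanSpace ℝ (Fin m)))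

/-! ### Intrinsic geometry of one Riemannian manifold -/

section Intrinsic

variable {m : ℕ} {M : Type*} [TopologicalSpace M] [ChartedSpace (EuclideanSpace ℝ (Fin m)) M]
  [IsManifold (𝓡 m) ∞ M]

/-- The vector field `X` is smooth on the set `s`. -/
def SmoothOn (X : VField m M) (s : Set M) : Prop :=
  ContMDiffOn (𝓡 m) (𝓡 m).tangent ∞ (fun x ↦ (⟨x, X x⟩ : TangentBundle (𝓡 m) M)) s

/-- An extension of the tangent vector `v` at `x` to a vector field which is smooth near `x` (it has
constant components in the preferred chart at `x`). -/
def ext {x : M} (v : TangentSpace (𝓡 m) x) : VField m M :=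
  FiberBundle.extend (EuclideanSpace ℝ (Fin m)) v

variable [RiemannianBundle (fun x : M ↦ TangentSpace (𝓡 m) x)]

/-- The derivative at `x`, in the direction `v`, of the function `⟨Y, Z⟩`. -/
def derivInner (Y Z : VField m M) (x : M) (v : TangentSpace (𝓡 m) x) : ℝ :=
  mvfderiv (𝓡 m) (fun y ↦ inner ℝ (Y y) (Z y)) x v

/-- The right-hand side of the Koszul formula for `2 ⟨∇_X Y, Z⟩`. -/
def koszul (X Y Z : VField m M) (x : M) : ℝ :=
  derivInner Y Z x (X x) + derivInner X Z x (Y x) - derivInner X Y x (Z x)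
    + inner ℝ (VectorField.mlieBracket (𝓡 m) X Y x) (Z x)
    - inner ℝ (VectorField.mlieBracket (𝓡 m) X Z x) (Y x)
    - inner ℝ (VectorField.mlieBracket (𝓡 m) Y Z x) (X x)

/-- An orthonormal basis of the tangent space at `x`. -/
def onb (x : M) : OrthonormalBasis (Fin (Module.finrank ℝ (TangentSpace (𝓡 m) x))) ℝ
    (TangentSpace (𝓡 m) x) :=
  stdOrthonormalBasis ℝ (TangentSpace (𝓡 m) x)

/-- The Levi-Civita covariant derivative `∇_v Y` at `x`: the vector whose inner product with each
`w` is given by the Koszul formula. -/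
def nabla (Y : VField m M) (x : M) (v : TangentSpace (𝓡 m) x) : TangentSpace (𝓡 m) x :=
  ∑ k, ((1 / 2 : ℝ) * koszul (ext v) Y (ext (onb x k)) x) • onb x k

/-- The vector field `∇_X Y`. -/
def nablaField (X Y : VField m M) : VField m M := fun x ↦ nabla Y x (X x)

/-- The curvature `R(u, v) w = [∇_U, ∇_V] W - ∇_{[U, V]} W` at `x`. -/
def curvature (x : M) (u v w : TangentSpace (𝓡 m) x) : TangentSpace (𝓡 m) x :=
  nabla (nablaField (ext v) (ext w)) x u - nabla (nablaField (ext u) (ext w)) x v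
    - nabla (ext w) x (VectorField.mlieBracket (𝓡 m) (ext u) (ext v) x)

/-- The Ricci operator `Ric(v) = ∑ R(v, e_k) e_k`. -/
def ricci (x : M) (v : TangentSpace (𝓡 m) x) : TangentSpace (𝓡 m) x :=
  ∑ k, curvature x v (onb x k) (onb x k)

/-- The trace `Tr ∇² T = ∑ (∇_{e_k} ∇_{e_k} T - ∇_{∇_{e_k} e_k} T)` of the second covariant
derivative of a vector field. -/
def traceHessian (T : VField m M) (x : M) : TangentSpace (𝓡 m) x :=
  ∑ k, (nabla (nablaField (ext (onb x k)) T) x (onb x k)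
    - nabla T x (nabla (ext (onb x k)) x (onb x k)))

/-- The density `√(det g_{ij})` of the Riemannian volume in the preferred chart at `c`. -/
def volumeDensity (c : M) (u : EuclideanSpace ℝ (Fin m)) : ℝ :=
  let D := mfderiv (𝓡 m) (𝓡 m) (chartAt (EuclideanSpace ℝ (Fin m)) c).symm u
  Real.sqrt (Matrix.det (Matrix.of fun i j : Fin m ↦
    inner ℝ (D (EuclideanSpace.basisFun (Fin m) ℝ i)) (D (EuclideanSpace.basisFun (Fin m) ℝ j))))

variable (M) in
/-- A smooth partition of unity subordinate to the preferred charts. -/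
def chartPartition [T2Space M] [SigmaCompactSpace M] :
    SmoothPartitionOfUnity M (𝓡 m) M Set.univ :=
  Classical.choose (SmoothPartitionOfUnity.exists_isSubordinate_chartAt_source (𝓡 m) M)

variable (m M) in
/-- The Riemannian volume measure: the sum over the charts of the images of `ρ_c √(det g) du`,
where `ρ` is a partition of unity subordinate to the charts. -/
def riemannianVolume [T2Space M] [SigmaCompactSpace M] [MeasurableSpace M] : Measure M :=
  Measure.sum fun c : M ↦
    let ψ := chartAt (EuclideanSpace ℝ (Fin m)) c
    ((volume.restrict ψ.target).withDensity fun u ↦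
      ENNReal.ofReal (chartPartition (m := m) M c (ψ.symm u) * volumeDensity c u)).map ψ.symm

end Intrinsic

/-! ### Maps between Riemannian manifolds -/

section Maps

variable {m n : ℕ}
  {M : Type*} [TopologicalSpace M] [ChartedSpace (EuclideanSpace ℝ (Fin m)) M]
  [IsManifold (𝓡 m) ∞ M] [RiemannianBundle (fun x : M ↦ TangentSpace (𝓡 m) x)]
  {N : Type*} [TopologicalSpace N] [ChartedSpace (EuclideanSpace ℝ (Fin n)) N]
  [IsManifold (𝓡 n) ∞ N] [RiemannianBundle (fun x : N ↦ TangentSpace (𝓡 n) x)]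

/-- Sections (with no regularity) of the pull-back bundle `φ⁻¹ TN`. -/
abbrev Along (n : ℕ) {M N : Type*} [TopologicalSpace N]
    [ChartedSpace (EuclideanSpace ℝ (Fin n)) N] (φ : M → N) : Type _ :=
  (x : M) → TangentSpace (𝓡 n) (φ x)

/-- The differential of `φ` at `x`. -/
abbrev diff (φ : M → N) (x : M) : TangentSpace (𝓡 m) x →L[ℝ] TangentSpace (𝓡 n) (φ x) :=
  mfderiv (𝓡 m) (𝓡 n) φ x

/-- The components of the section `σ` of `φ⁻¹ TN` in the local frame of `TN` given by the
preferred chart at `q`. -/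
def components (φ : M → N) (σ : Along n φ) (q : N) (y : M) : EuclideanSpace ℝ (Fin n) :=
  (trivializationAt (EuclideanSpace ℝ (Fin n)) (TangentSpace (𝓡 n)) q
    (⟨φ y, σ y⟩ : TangentBundle (𝓡 n) N)).2

/-- The pull-back connection `∇^φ_v σ` at `x`. Writing `σ = ∑ σ^a (F_a ∘ φ)` for a local frame
`(F_a)` of `TN` near `φ x`, it is `∑ dσ^a(v) F_a + ∑ σ^a ∇^N_{dφ(v)} F_a`. The frame is the one of
the preferred chart at `φ x`, and `ext (σ x)` is the field `∑ σ^a(x) F_a`. -/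
def nablaAlong (φ : M → N) (σ : Along n φ) (x : M) (v : TangentSpace (𝓡 m) x) :
    TangentSpace (𝓡 n) (φ x) :=
  (trivializationAt (EuclideanSpace ℝ (Fin n)) (TangentSpace (𝓡 n)) (φ x)).symm (φ x)
      (mvfderiv (𝓡 m) (components φ σ (φ x)) x v)
    + nabla (ext (σ x)) (φ x) (diff φ x v)

/-- The section `∇^φ_X σ` of `φ⁻¹ TN`. -/
def nablaAlongField (φ : M → N) (X : VField m M) (σ : Along n φ) : Along n φ :=
  fun x ↦ nablaAlong φ σ x (X x)

/-- The second fundamental form `(∇dφ)(u, v) = ∇^φ_u (dφ(V)) - dφ(∇_u V)` of a map. -/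
def secondFundamentalForm (φ : M → N) (x : M) (u v : TangentSpace (𝓡 m) x) :
    TangentSpace (𝓡 n) (φ x) :=
  nablaAlong φ (fun y ↦ diff φ y (ext v y)) x u - diff φ x (nabla (ext v) x u)

/-- The tension field `τ(φ) = Tr ∇dφ`. -/
def tension (φ : M → N) : Along n φ :=
  fun x ↦ ∑ k, secondFundamentalForm (m := m) φ x (onb x k) (onb x k)

/-- `Tr (∇^φ)² σ = ∑ (∇^φ_{e_k} ∇^φ_{e_k} σ - ∇^φ_{∇_{e_k} e_k} σ)`, i.e. `-Δ^φ σ`. -/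
def traceHessianAlong (φ : M → N) (σ : Along n φ) (x : M) : TangentSpace (𝓡 n) (φ x) :=
  ∑ k, (nablaAlong (m := m) φ (nablaAlongField φ (ext (onb x k)) σ) x (onb x k)
    - nablaAlong φ σ x (nabla (ext (onb x k)) x (onb x k)))

/-- The bitension field `τ₂(φ) = -Δ^φ τ(φ) - Tr R^N(dφ, τ(φ)) dφ`. -/
def bitension (φ : M → N) : Along n φ :=
  fun x ↦ traceHessianAlong (m := m) φ (tension (m := m) φ) x
    - ∑ k, curvature (φ x) (diff (m := m) φ x (onb x k)) (tension (m := m) φ x)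
        (diff (m := m) φ x (onb x k))

/-- The bienergy `E₂(φ, Ω) = ½ ∫_Ω |τ(φ)|² dv_g`. -/
def bienergy (m n : ℕ)
    {M : Type*} [TopologicalSpace M] [ChartedSpace (EuclideanSpace ℝ (Fin m)) M]
    [IsManifold (𝓡 m) ∞ M] [RiemannianBundle (fun x : M ↦ TangentSpace (𝓡 m) x)]
    [T2Space M] [SigmaCompactSpace M] [MeasurableSpace M]
    {N : Type*} [TopologicalSpace N] [ChartedSpace (EuclideanSpace ℝ (Fin n)) N]
    [IsManifold (𝓡 n) ∞ N] [RiemannianBundle (fun x : N ↦ TangentSpace (𝓡 n) x)]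
    (φ : M → N) (Ω : Set M) : ℝ :=
  (1 / 2 : ℝ) * ∫ x in Ω, ‖tension (m := m) (n := n) φ x‖ ^ 2 ∂(riemannianVolume m M)

/-- `φ` is biharmonic: it is smooth, and for every compact `Ω` it is a critical point of the
bienergy `E₂(·, Ω)` with respect to the smooth variations `Φ_t` of `φ` supported in `Ω`. -/
def IsBiharmonic (m n : ℕ)
    {M : Type*} [TopologicalSpace M] [ChartedSpace (EuclideanSpace ℝ (Fin m)) M]
    [IsManifold (𝓡 m) ∞ M] [RiemannianBundle (fun x : M ↦ TangentSpace (𝓡 m) x)]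
    [T2Space M] [SigmaCompactSpace M] [MeasurableSpace M]
    {N : Type*} [TopologicalSpace N] [ChartedSpace (EuclideanSpace ℝ (Fin n)) N]
    [IsManifold (𝓡 n) ∞ N] [RiemannianBundle (fun x : N ↦ TangentSpace (𝓡 n) x)]
    (φ : M → N) : Prop :=
  ContMDiff (𝓡 m) (𝓡 n) ∞ φ ∧
  ∀ Ω : Set M, IsCompact Ω → ∀ Φ : ℝ → M → N,
    ContMDiff (𝓘(ℝ, ℝ).prod (𝓡 m)) (𝓡 n) ∞ (fun p : ℝ × M ↦ Φ p.1 p.2) →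
    Φ 0 = φ → (∀ t, ∀ x ∉ Ω, Φ t x = φ x) →
    HasDerivAt (fun t ↦ bienergy m n (Φ t) Ω) 0 0

/-! ### Riemannian submersions -/

/-- The vertical space `ker dφ_x`. -/
def vertical (φ : M → N) (x : M) : Submodule ℝ (TangentSpace (𝓡 m) x) :=
  LinearMap.ker (diff (m := m) (n := n) φ x).toLinearMap

/-- The vertical part of a tangent vector. -/
def ver (φ : M → N) (x : M) (v : TangentSpace (𝓡 m) x) : TangentSpace (𝓡 m) x :=
  (vertical (m := m) (n := n) φ x).starProjection v

/-- The horizontal part of a tangent vector. -/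
def hor (φ : M → N) (x : M) (v : TangentSpace (𝓡 m) x) : TangentSpace (𝓡 m) x :=
  (vertical (m := m) (n := n) φ x)ᗮ.starProjection v

/-- A Riemannian submersion: a smooth submersion whose differential is isometric on the horizontal
spaces. -/
structure IsRiemannianSubmersion (φ : M → N) : Prop where
  smooth : ContMDiff (𝓡 m) (𝓡 n) ∞ φ
  surjective : ∀ x, Function.Surjective (diff (m := m) (n := n) φ x)
  isometric : ∀ x, ∀ u ∈ (vertical (m := m) (n := n) φ x)ᗮ,
    ∀ v ∈ (vertical (m := m) (n := n) φ x)ᗮ,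
    (inner ℝ (diff (m := m) (n := n) φ x u) (diff (m := m) (n := n) φ x v) : ℝ) = inner ℝ u v

/-- The mean curvature vector field `μ = (m - n)⁻¹ ∑_s (∇_{e_s} e_s)^H` of the fibers, where
`(e_s)` is an orthonormal basis of the vertical space at `x`, extended to vertical fields. -/
def meanCurvature (φ : M → N) : VField m M := fun x ↦
  ((m : ℝ) - n)⁻¹ • ∑ s,
    let e := stdOrthonormalBasis ℝ (vertical (m := m) (n := n) φ x) s
    hor (n := n) φ x
      (nabla (fun y ↦ ver (n := n) φ y (ext (e : TangentSpace (𝓡 m) x) y)) x e)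

/-- `X` is basic: it is horizontal and `φ`-related to a smooth vector field on the open set
`φ(M)`. -/
def IsBasic (φ : M → N) (X : VField m M) : Prop :=
  (∀ x, X x ∈ (vertical (m := m) (n := n) φ x)ᗮ) ∧
  ∃ Xbar : VField n N, SmoothOn Xbar (Set.range φ) ∧ ∀ x, diff φ x (X x) = Xbar (φ x)

/-- The section `σ` of `φ⁻¹ TN` is constant along the fibers: `σ p = σ q` whenever `φ p = φ q`,
i.e. `σ p` is a function of `φ p`. -/
def IsConstantAlongFibers (φ : M → N) (σ : Along n φ) : Prop :=
  ∃ T : VField n N, ∀ x, σ x = T (φ x)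

/-- `(e, f)` is a smooth orthonormal frame on the open set `U` with the `e i` horizontal and the
`f s` vertical. -/
structure IsAdaptedFrame (φ : M → N) (U : Set M) (e : Fin n → VField m M)
    (f : Fin (m - n) → VField m M) : Prop where
  isOpen : IsOpen U
  smooth_hor : ∀ i, SmoothOn (e i) U
  smooth_ver : ∀ s, SmoothOn (f s) U
  orthonormal : ∀ x ∈ U, Orthonormal ℝ (Sum.elim (fun i ↦ e i x) (fun s ↦ f s x))
  mem_hor : ∀ i, ∀ x ∈ U, e i x ∈ (vertical (m := m) (n := n) φ x)ᗮ
  mem_ver : ∀ s, ∀ x ∈ U, f s x ∈ vertical (m := m) (n := n) φ x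

/-- `dφ(∑_i {∇_{e_i} (∇_{e_i} μ)^H - ∇_{(∇_{e_i} e_i)^H} μ} - (m - n) ∇_μ μ) + Ric^N(dφ(μ))`
at `x`. -/
def frameExpression (φ : M → N) (e : Fin n → VField m M) (μ : VField m M) (x : M) :
    TangentSpace (𝓡 n) (φ x) :=
  diff φ x
    (∑ i, (nabla (fun y ↦ hor (n := n) φ y (nabla μ y (e i y))) x (e i x)
        - nabla μ x (hor (n := n) φ x (nabla (e i) x (e i x))))
      - ((m : ℝ) - n) • nabla μ x (μ x))
    + ricci (φ x) (diff φ x (μ x))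

end Maps

end BiharmonicSubmersion

end

noncomputable section

open scoped Manifold ContDiff Bundle Topology
open Bundle MeasureTheory Filter Set

set_option maxSynthPendingDepth 3
set_option linter.unusedSectionVars false

namespace BiharmonicSubmersion

/-! ### Riemannian geometry in a chart -/

section Local

variable {E E' P : Type*} [NormedAddCommGroup E] [NormedSpace ℝ E]
  [NormedAddCommGroup E'] [NormedSpace ℝ E']
  [NormedAddCommGroup P] [NormedSpace ℝ P]

/-! Write B for the second fundamental form ∇dφ. Differentiating ⟨dφ X, dφ Y⟩ = ⟨X, Y⟩ for
horizontal X, Y shows that ⟨B(z, x), dφ y⟩ is skew in horizontal x, y. As B is symmetric, it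
vanishes on pairs of horizontal vectors (`sff_eq_zero`). For a vertical field Y, dφ(Y) = 0 gives
B(v, Y) = -dφ(∇_v Y) (`sff_vertical`). Tracing over a basis adapted to the two distributions gives
τ(φ) = -(m - n) dφ(μ) (`tension_eq`). So μ descends to φ(M) exactly when τ(φ) does; the smoothness
of the descended field comes from local sections of φ (`isBasic_iff`).

If τ(φ) = T ∘ φ, the Hessian of a composite reads ∇²(T ∘ φ)(v, w) = ∇²T(dφ v, dφ w) + ∇_{B(v, w)} T
(`hessAlong_comp`). Since dφ kills vertical vectors and carries horizontal orthonormal bases to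
orthonormal bases, the trace is Tr ∇²T + ∇_T T, and the curvature term becomes Ric(T)
(`bitension_eq`). In an adapted frame, the vanishing of B on horizontal pairs lets dφ pass through
the derivatives of a basic field in horizontal directions. The frame expression is therefore the
same operator applied to dφ(μ), that is -(m - n)⁻¹ τ₂(φ) (`frameExpression_meanCurvature`). If m =
n, everything vanishes.

What remains holds for every smooth map: φ is biharmonic if and only if τ₂(φ) = 0
(`isBiharmonic_iff`). For a variation with field V, the tension field varies by Tr ∇²V + ∑ R(V, dφ
e_k) dφ e_k (`tensionSqDeriv_eq`). This operator is symmetric up to a divergence: the Hessian part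
by Green's identity (`divg_adjField`), the curvature part by the pair symmetry of R. The divergence
theorem then gives ∫ ⟨V, τ₂(φ)⟩ as the derivative of the bienergy, and variations supported in a
small chart ball force τ₂(φ) = 0.

All pointwise identities are proved for Christoffel symbols on an open subset of a vector space and
carried over by the chart formulas for ∇, ∇^φ and R. -/

theorem eventually_differentiableAt {f : E → E'} {x : E} (hf : ContDiffAt ℝ ∞ f x) :
    ∀ᶠ y in 𝓝 x, DifferentiableAt ℝ f y := by
  have h1 : ContDiffAt ℝ 1 f x := hf.of_le (by simp)
  filter_upwards [h1.eventually (by norm_num)] with y hy using hy.differentiableAt (by simp)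

/-- A smooth Riemannian metric on an open subset of a vector space. -/
structure IsMetricOn (g : E → E →L[ℝ] E →L[ℝ] ℝ) (U : Set E) : Prop where
  isOpen : IsOpen U
  smooth : ContDiffOn ℝ ∞ g U
  symm : ∀ u ∈ U, ∀ v w, g u v w = g u w v
  pos : ∀ u ∈ U, ∀ v, v ≠ 0 → 0 < g u v v

/-- The inverse of the musical isomorphism of `g` at `u`. -/
def sharp (g : E → E →L[ℝ] E →L[ℝ] ℝ) (u : E) : (E →L[ℝ] ℝ) →L[ℝ] E := (g u).inverse

/-- The Christoffel symbols of the first kind. -/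
def chrLower (g : E → E →L[ℝ] E →L[ℝ] ℝ) (u : E) : E →L[ℝ] E →L[ℝ] E →L[ℝ] ℝ :=
  fderiv ℝ g u + (fderiv ℝ g u).flip
    - ((ContinuousLinearMap.flipₗᵢ ℝ E E ℝ : (E →L[ℝ] E →L[ℝ] ℝ) →L[ℝ] E →L[ℝ] E →L[ℝ] ℝ)) ∘L
      (fderiv ℝ g u).flip

/-- The Christoffel symbols of the second kind. -/
def christoffel (g : E → E →L[ℝ] E →L[ℝ] ℝ) (u : E) : E →L[ℝ] E →L[ℝ] E :=
  (1 / 2 : ℝ) • (ContinuousLinearMap.compL ℝ E (E →L[ℝ] ℝ) E (sharp g u)) ∘L chrLower g u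

theorem chrLower_apply (g : E → E →L[ℝ] E →L[ℝ] ℝ) (u v w z : E) :
    chrLower g u v w z = fderiv ℝ g u v w z + fderiv ℝ g u w v z - fderiv ℝ g u z v w := rfl

theorem christoffel_apply (g : E → E →L[ℝ] E →L[ℝ] ℝ) (u v w : E) :
    christoffel g u v w = (1 / 2 : ℝ) • sharp g u (chrLower g u v w) := rfl

namespace IsMetricOn

variable {g : E → E →L[ℝ] E →L[ℝ] ℝ} {U : Set E} {u : E}

theorem mem_nhds (hg : IsMetricOn g U) (hu : u ∈ U) : U ∈ 𝓝 u := hg.isOpen.mem_nhds hu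

theorem contDiffAt (hg : IsMetricOn g U) (hu : u ∈ U) : ContDiffAt ℝ ∞ g u :=
  hg.smooth.contDiffAt (hg.mem_nhds hu)

/-- Nondegeneracy of the metric. Vectors given by `sharp` or by orthogonal projection are later
identified by testing against all z. -/
theorem eq_of_forall (hg : IsMetricOn g U) (hu : u ∈ U) {v w : E}
    (h : ∀ z, g u v z = g u w z) : v = w := by
  by_contra hne
  have := hg.pos u hu (v - w) (sub_ne_zero.2 hne)
  simp [h] at this

theorem fderiv_symm (hg : IsMetricOn g U) (hu : u ∈ U) (v w z : E) :
    fderiv ℝ g u v w z = fderiv ℝ g u v z w := by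
  have hd : DifferentiableAt ℝ g u := (hg.contDiffAt hu).differentiableAt (by simp)
  have h1 : ∀ a b, fderiv ℝ (fun q ↦ g q a b) u v = fderiv ℝ g u v a b := by
    intro a b
    rw [fderiv_clm_apply (hd.clm_apply (differentiableAt_const a)) (differentiableAt_const b),
      fderiv_clm_apply hd (differentiableAt_const a)]
    simp
  rw [← h1, ← h1]
  congr 1
  apply Filter.EventuallyEq.fderiv_eq
  filter_upwards [hg.mem_nhds hu] with q hq using hg.symm q hq w z

variable [FiniteDimensional ℝ E]

/-- Positivity makes `g u` injective, and a space and its dual have the same dimension. Hence the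
`inverse` in `sharp` is a genuine inverse and not its default value. -/
theorem isInvertible (hg : IsMetricOn g U) (hu : u ∈ U) : (g u).IsInvertible := by
  have hinj : Function.Injective (g u) := by
    intro v w h
    exact hg.eq_of_forall hu (fun z ↦ by rw [h])
  have hfr : Module.finrank ℝ E = Module.finrank ℝ (E →L[ℝ] ℝ) := by
    rw [← (LinearMap.toContinuousLinearMap (𝕜 := ℝ) (E := E) (F' := ℝ)).finrank_eq]
    exact (Subspace.dual_finrank_eq).symm
  refine ⟨(LinearEquiv.ofInjectiveOfFinrankEq (g u : E →ₗ[ℝ] (E →L[ℝ] ℝ)) hinj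
    hfr).toContinuousLinearEquiv, ?_⟩
  ext v w
  rfl

theorem apply_sharp (hg : IsMetricOn g U) (hu : u ∈ U) (a : E →L[ℝ] ℝ) (w : E) :
    g u (sharp g u a) w = a w := by
  have := (hg.isInvertible hu)
  obtain ⟨e, he⟩ := this
  simp [sharp, ← he]

theorem sharp_apply (hg : IsMetricOn g U) (hu : u ∈ U) (v : E) : sharp g u (g u v) = v :=
  hg.eq_of_forall hu fun z ↦ hg.apply_sharp hu _ z

theorem contDiffAt_sharp (hg : IsMetricOn g U) (hu : u ∈ U) : ContDiffAt ℝ ∞ (sharp g) u :=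
  (hg.isInvertible hu).contDiffAt_map_inverse.comp u (hg.contDiffAt hu)

/-- The Koszul formula for constant fields, whose brackets vanish. -/
theorem apply_christoffel (hg : IsMetricOn g U) (hu : u ∈ U) (v w z : E) :
    g u (christoffel g u v w) z = (1 / 2 : ℝ) *
      (fderiv ℝ g u v w z + fderiv ℝ g u w v z - fderiv ℝ g u z v w) := by
  rw [christoffel_apply, map_smul, smul_apply, hg.apply_sharp hu,
    chrLower_apply, smul_eq_mul]

theorem christoffel_symm (hg : IsMetricOn g U) (hu : u ∈ U) (v w : E) :
    christoffel g u v w = christoffel g u w v := by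
  refine hg.eq_of_forall hu fun z ↦ ?_
  rw [hg.apply_christoffel hu, hg.apply_christoffel hu, hg.fderiv_symm hu z v w]
  ring

/-- The metric is parallel. -/
theorem fderiv_apply (hg : IsMetricOn g U) (hu : u ∈ U) (v w z : E) :
    fderiv ℝ g u v w z = g u (christoffel g u v w) z + g u w (christoffel g u v z) := by
  rw [hg.symm u hu w, hg.apply_christoffel hu, hg.apply_christoffel hu, hg.fderiv_symm hu z v w,
    hg.fderiv_symm hu w v z, hg.fderiv_symm hu v z w]
  ring

theorem contDiffOn_christoffel (hg : IsMetricOn g U) : ContDiffOn ℝ ∞ (christoffel g) U := by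
  have hd : ContDiffOn ℝ ∞ (fderiv ℝ g) U := hg.smooth.fderiv_of_isOpen hg.isOpen (by simp)
  rw [contDiffOn_clm_apply]
  intro v
  rw [contDiffOn_clm_apply]
  intro w
  simp only [christoffel_apply]
  apply ContDiffOn.const_smul
  apply ContDiffOn.clm_apply
  · exact fun u hu ↦ (hg.contDiffAt_sharp hu).contDiffWithinAt
  · rw [contDiffOn_clm_apply]
    intro z
    simp only [chrLower_apply]
    have h (a b c : E) : ContDiffOn ℝ ∞ (fun u ↦ fderiv ℝ g u a b c) U :=
      ((hd.clm_apply contDiffOn_const).clm_apply contDiffOn_const).clm_apply contDiffOn_const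
    exact ((h v w z).add (h w v z)).sub (h z v w)

theorem contDiffAt_christoffel (hg : IsMetricOn g U) (hu : u ∈ U) :
    ContDiffAt ℝ ∞ (christoffel g) u :=
  hg.contDiffOn_christoffel.contDiffAt (hg.mem_nhds hu)

end IsMetricOn

/-! ### Covariant derivatives along maps -/

/-- The covariant derivative at `p` of the section `σ` along `F`. -/
def covD (Γ : E' → E' →L[ℝ] E' →L[ℝ] E') (F σ : P → E') (p : P) : P →L[ℝ] E' :=
  fderiv ℝ σ p + (Γ (F p)).flip (σ p) ∘L fderiv ℝ F p

theorem covD_apply (Γ : E' → E' →L[ℝ] E' →L[ℝ] E') (F σ : P → E') (p a : P) :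
    covD Γ F σ p a = fderiv ℝ σ p a + Γ (F p) (fderiv ℝ F p a) (σ p) := rfl

theorem covD_id_apply (Γ : E → E →L[ℝ] E →L[ℝ] E) (σ : E → E) (p a : E) :
    covD Γ id σ p a = fderiv ℝ σ p a + Γ p a (σ p) := by
  simp [covD_apply]

/-- The covariant derivative at `u` of the section `S` of `Hom(E, F⁻¹ E')`. -/
def covHom (ΓM : E → E →L[ℝ] E →L[ℝ] E) (Γ : E' → E' →L[ℝ] E' →L[ℝ] E') (F : E → E')
    (S : E → E →L[ℝ] E') (u : E) : E →L[ℝ] E →L[ℝ] E' :=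
  fderiv ℝ S u + (ContinuousLinearMap.compL ℝ E E' E').flip (S u) ∘L (Γ (F u) ∘L fderiv ℝ F u)
    - ContinuousLinearMap.compL ℝ E E E' (S u) ∘L ΓM u

theorem covHom_apply (ΓM : E → E →L[ℝ] E →L[ℝ] E) (Γ : E' → E' →L[ℝ] E' →L[ℝ] E') (F : E → E')
    (S : E → E →L[ℝ] E') (u v w : E) :
    covHom ΓM Γ F S u v w =
      fderiv ℝ S u v w + Γ (F u) (fderiv ℝ F u v) (S u w) - S u (ΓM u v w) := rfl

/-- The curvature of the connection with Christoffel symbols `Γ`. -/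
def curvL (Γ : E → E →L[ℝ] E →L[ℝ] E) (u a b c : E) : E :=
  fderiv ℝ Γ u a b c - fderiv ℝ Γ u b a c + Γ u a (Γ u b c) - Γ u b (Γ u a c)

theorem covD_congr {Γ : E' → E' →L[ℝ] E' →L[ℝ] E'} {F F' σ σ' : P → E'} {p : P}
    (hF : F =ᶠ[𝓝 p] F') (hσ : σ =ᶠ[𝓝 p] σ') : covD Γ F σ p = covD Γ F' σ' p := by
  simp only [covD, hF.fderiv_eq, hσ.fderiv_eq, hF.eq_of_nhds, hσ.eq_of_nhds]

variable {ΓM : E → E →L[ℝ] E →L[ℝ] E} {Γ : E' → E' →L[ℝ] E' →L[ℝ] E'} {F : E → E'}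

theorem covHom_congr {F' : E → E'} {S S' : E → E →L[ℝ] E'} {u : E}
    (hF : F =ᶠ[𝓝 u] F') (hS : S =ᶠ[𝓝 u] S') : covHom ΓM Γ F S u = covHom ΓM Γ F' S' u := by
  simp only [covHom, hF.fderiv_eq, hS.fderiv_eq, hF.eq_of_nhds, hS.eq_of_nhds]

/-- The Leibniz rule for S applied to W. The derivatives of W cancel, so the left side depends on W
only through its value at u: this is why second fundamental forms and Hessians do not depend on the
chosen extensions. -/
theorem covD_clm_apply {S : E → E →L[ℝ] E'} {W : E → E} {u : E}
    (hS : DifferentiableAt ℝ S u) (hW : DifferentiableAt ℝ W u) (v : E) :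
    covD Γ F (fun q ↦ S q (W q)) u v - S u (covD ΓM id W u v) = covHom ΓM Γ F S u v (W u) := by
  rw [covD_apply, covD_id_apply, covHom_apply, fderiv_clm_apply hS hW]
  simp only [add_apply, ContinuousLinearMap.comp_apply,
    ContinuousLinearMap.flip_apply, map_add]
  abel

theorem covD_comp {G : P → E} {σ : E → E'} {p : P} (hF : DifferentiableAt ℝ F (G p))
    (hσ : DifferentiableAt ℝ σ (G p)) (hG : DifferentiableAt ℝ G p) (a : P) :
    covD Γ (fun q ↦ F (G q)) (fun q ↦ σ (G q)) p a = covD Γ F σ (G p) (fderiv ℝ G p a) := by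
  rw [covD_apply, covD_apply, fderiv_fun_comp p hF hG, fderiv_fun_comp p hσ hG]
  simp

theorem covD_comp_id {T : E' → E'} {u : E} (hF : DifferentiableAt ℝ F u)
    (hT : DifferentiableAt ℝ T (F u)) (v : E) :
    covD Γ F (fun q ↦ T (F q)) u v = covD Γ id T (F u) (fderiv ℝ F u v) :=
  covD_comp (F := id) (σ := T) (G := F) differentiableAt_id hT hF v

theorem contDiffAt_covD {F σ : P → E'} {p : P}
    (hΓ : ContDiffAt ℝ ∞ Γ (F p)) (hF : ContDiffAt ℝ ∞ F p) (hσ : ContDiffAt ℝ ∞ σ p) :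
    ContDiffAt ℝ ∞ (covD Γ F σ) p := by
  unfold covD
  refine (hσ.fderiv_right (by simp)).add ?_
  refine ContDiffAt.clm_comp (ContDiffAt.clm_apply ?_ hσ) (hF.fderiv_right (by simp))
  exact (ContinuousLinearMap.flipₗᵢ ℝ E' E' E').contDiff.contDiffAt.comp p
    (hΓ.comp p hF)

/-- The connection pulled back by F is again metric, because the metric is parallel and F enters
only through the chain rule. -/
theorem fderiv_metric_apply {h : E' → E' →L[ℝ] E' →L[ℝ] ℝ} {U : Set E'} [FiniteDimensional ℝ E']
    (hh : IsMetricOn h U) {F σ τ : P → E'} {p : P} (hp : F p ∈ U) (hF : DifferentiableAt ℝ F p)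
    (hσ : DifferentiableAt ℝ σ p) (hτ : DifferentiableAt ℝ τ p) (a : P) :
    fderiv ℝ (fun q ↦ h (F q) (σ q) (τ q)) p a =
      h (F p) (covD (christoffel h) F σ p a) (τ p)
        + h (F p) (σ p) (covD (christoffel h) F τ p a) := by
  have hd : DifferentiableAt ℝ h (F p) := (hh.contDiffAt hp).differentiableAt (by simp)
  have hd' : DifferentiableAt ℝ (fun q ↦ h (F q)) p := hd.comp p hF
  rw [fderiv_clm_apply (hd'.clm_apply hσ) hτ, fderiv_clm_apply hd' hσ, fderiv_fun_comp p hd hF]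
  simp only [add_apply, ContinuousLinearMap.comp_apply,
    ContinuousLinearMap.flip_apply, covD_apply, hh.fderiv_apply hp, map_add]
  ring

/-- The Hessian of a composite map. -/
theorem covHom_covD_comp {T : E' → E'} {u : E} (hΓ : ContDiffAt ℝ ∞ Γ (F u))
    (hF : ContDiffAt ℝ ∞ F u) (hT : ContDiffAt ℝ ∞ T (F u)) (v w : E) :
    covHom ΓM Γ F (covD Γ F (fun q ↦ T (F q))) u v w =
      covHom Γ Γ id (covD Γ id T) (F u) (fderiv ℝ F u v) (fderiv ℝ F u w)
        + covD Γ id T (F u) (covHom ΓM Γ F (fderiv ℝ F) u v w) := by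
  have hF1 : DifferentiableAt ℝ F u := hF.differentiableAt (by simp)
  have hS : DifferentiableAt ℝ (covD Γ id T) (F u) :=
    (contDiffAt_covD (F := id) hΓ contDiffAt_id hT).differentiableAt (by simp)
  have hdF : DifferentiableAt ℝ (fderiv ℝ F) u :=
    (hF.fderiv_right (m := ∞) (by simp)).differentiableAt (by simp)
  -- Near u the covariant derivative of T ∘ F is (∇T) ∘ dF. The product rule on this composite of
  -- linear maps produces the two terms: ∇T differentiated along F, and dF differentiated.
  have hev : covD Γ F (fun q ↦ T (F q)) =ᶠ[𝓝 u] fun q ↦ covD Γ id T (F q) ∘L fderiv ℝ F q := by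
    have h1 := eventually_differentiableAt hF
    have h2 := hF1.continuousAt.eventually (eventually_differentiableAt hT)
    filter_upwards [h1, h2] with q hq1 hq2
    ext a
    exact covD_comp_id hq1 hq2 a
  rw [covHom_congr EventuallyEq.rfl hev]
  rw [covHom_apply, covHom_apply, covHom_apply,
    fderiv_clm_comp (c := fun q ↦ covD Γ id T (F q)) (hS.comp u hF1) hdF, fderiv_fun_comp u hS hF1]
  simp only [add_apply, ContinuousLinearMap.comp_apply,
    ContinuousLinearMap.flip_apply, ContinuousLinearMap.compL_apply, map_add, map_sub, fderiv_id,
    id, ContinuousLinearMap.id_apply]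
  abel

end Local

/-! ### Curvature symmetries and the variation of the second fundamental form, in coordinates -/

section LocalCurvature

theorem two_le_infty : (2 : WithTop ℕ∞) ≤ ∞ := WithTop.coe_le_coe.2 le_top

variable {E E' P : Type*} [NormedAddCommGroup E] [NormedSpace ℝ E]
  [NormedAddCommGroup E'] [NormedSpace ℝ E']
  [NormedAddCommGroup P] [NormedSpace ℝ P]

theorem fderiv_symm_of_contDiffAt {f : P → E'} {p : P} (hf : ContDiffAt ℝ 2 f p) (a b : P) :
    fderiv ℝ (fderiv ℝ f) p a b = fderiv ℝ (fderiv ℝ f) p b a :=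
  (hf.isSymmSndFDerivAt (by simp)).eq a b

namespace IsMetricOn

variable [FiniteDimensional ℝ E] {g : E → E →L[ℝ] E →L[ℝ] ℝ} {U : Set E} {u : E}

/-- The metric is parallel, so the second derivatives of g can be expressed by Γ. Their symmetry in
a and b says exactly that g(R(a, b)c, d) + g(R(a, b)d, c) vanishes, the mixed terms in Γ being the
same in both orders. -/
theorem curvL_antisymm (hg : IsMetricOn g U) (hu : u ∈ U) (a b c d : E) :
    g u (curvL (christoffel g) u a b c) d = - g u (curvL (christoffel g) u a b d) c := by
  have hΓ : DifferentiableAt ℝ (christoffel g) u :=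
    (hg.contDiffAt_christoffel hu).differentiableAt (by simp)
  have hgd : DifferentiableAt ℝ g u := (hg.contDiffAt hu).differentiableAt (by simp)
  have hg2 : DifferentiableAt ℝ (fderiv ℝ g) u :=
    ((hg.contDiffAt hu).fderiv_right (m := ∞) (by simp)).differentiableAt (by simp)
  have key (a b : E) : fderiv ℝ (fderiv ℝ g) u a b c d =
      fderiv ℝ (fun q ↦ g q (christoffel g q b c) d + g q (christoffel g q b d) c) u a := by
    have h1 : (fun q ↦ g q (christoffel g q b c) d + g q (christoffel g q b d) c) =ᶠ[𝓝 u]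
        fun q ↦ fderiv ℝ g q b c d := by
      filter_upwards [hg.mem_nhds hu] with q hq
      rw [hg.fderiv_apply hq, hg.symm q hq c]
    rw [h1.fderiv_eq, fderiv_clm_apply (by fun_prop) (by fun_prop),
      fderiv_clm_apply (by fun_prop) (by fun_prop), fderiv_clm_apply (by fun_prop) (by fun_prop)]
    simp
  have comp (a b c d : E) : fderiv ℝ (fun q ↦ g q (christoffel g q b c) d) u a =
      g u (fderiv ℝ (christoffel g) u a b c + christoffel g u a (christoffel g u b c)) d
        + g u (christoffel g u b c) (christoffel g u a d) := by
    rw [fderiv_clm_apply (by fun_prop) (by fun_prop), fderiv_clm_apply (by fun_prop) (by fun_prop),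
      fderiv_clm_apply (by fun_prop) (by fun_prop), fderiv_clm_apply (by fun_prop) (by fun_prop)]
    simp [hg.fderiv_apply hu]
    ring
  have key' (a b : E) : fderiv ℝ (fderiv ℝ g) u a b c d =
      fderiv ℝ (fun q ↦ g q (christoffel g q b c) d) u a
        + fderiv ℝ (fun q ↦ g q (christoffel g q b d) c) u a := by
    rw [key, fderiv_fun_add (by fun_prop) (by fun_prop), add_apply]
  have hs : fderiv ℝ (fderiv ℝ g) u a b c d = fderiv ℝ (fderiv ℝ g) u b a c d := by
    rw [fderiv_symm_of_contDiffAt ((hg.contDiffAt hu).of_le two_le_infty)]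
  rw [key' a b, key' b a, comp, comp, comp, comp, hg.symm u hu (christoffel g u b d),
    hg.symm u hu (christoffel g u a d)] at hs
  simp only [curvL, map_sub, map_add, sub_apply, add_apply] at hs ⊢
  linarith

theorem fderiv_christoffel_symm (hg : IsMetricOn g U) (hu : u ∈ U) (a b c : E) :
    fderiv ℝ (christoffel g) u a b c = fderiv ℝ (christoffel g) u a c b := by
  have hΓ : DifferentiableAt ℝ (christoffel g) u :=
    (hg.contDiffAt_christoffel hu).differentiableAt (by simp)
  have h1 (b c : E) : fderiv ℝ (fun q ↦ christoffel g q b c) u a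
      = fderiv ℝ (christoffel g) u a b c := by
    rw [fderiv_clm_apply (by fun_prop) (by fun_prop), fderiv_clm_apply (by fun_prop) (by fun_prop)]
    simp
  rw [← h1, ← h1]
  congr 1
  apply Filter.EventuallyEq.fderiv_eq
  filter_upwards [hg.mem_nhds hu] with q hq using hg.christoffel_symm hq b c

/-- The symmetry of the Jacobi operator `b ↦ R(b, a) a`. -/
theorem curvL_jacobi_symm (hg : IsMetricOn g U) (hu : u ∈ U) (a b c : E) :
    g u (curvL (christoffel g) u b a a) c = g u (curvL (christoffel g) u c a a) b := by
  -- The first Bianchi identity, a consequence of the symmetry of Γ and of its derivative.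
  have hB (a b c d : E) : g u (curvL (christoffel g) u a b c) d
      + g u (curvL (christoffel g) u b c a) d + g u (curvL (christoffel g) u c a b) d = 0 := by
    rw [← add_apply, ← map_add, ← add_apply, ← map_add]
    have : curvL (christoffel g) u a b c + curvL (christoffel g) u b c a
        + curvL (christoffel g) u c a b = 0 := by
      simp only [curvL]
      rw [hg.fderiv_christoffel_symm hu a c b, hg.fderiv_christoffel_symm hu c b a,
        hg.fderiv_christoffel_symm hu b a c, hg.christoffel_symm hu c b,
        hg.christoffel_symm hu a c, hg.christoffel_symm hu b a]
      abel
    rw [this]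
    simp
  have hA (a b c d : E) : g u (curvL (christoffel g) u a b c) d
      = - g u (curvL (christoffel g) u b a c) d := by
    have : curvL (christoffel g) u a b c = - curvL (christoffel g) u b a c := by
      simp only [curvL]; abel
    rw [this]
    simp
  -- The octahedron argument for the pair symmetry, on the arguments that occur here: four Bianchi
  -- identities are added, and skewness in the first pair and in the last pair cancels all but the
  -- two wanted terms.
  have h1 := hB b a a c
  have h2 := hB a a c b
  have h3 := hB a c b a
  have h4 := hB c b a a
  have e := hg.curvL_antisymm hu
  have e1 := e b a a c
  have e2 := e c a a b
  have e3 := e a a b c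
  have e4 := e b c a a
  have e5 := hA a a b c
  have e6 := hA b a c a
  have e7 := hA c a a b
  have e8 := e a c b a
  have e9 := e a c a b
  have e10 := hA c a b a
  have e11 := e b a c a
  have e12 := hA a b a c
  have e13 := hA c b a a
  linarith

end IsMetricOn

theorem fderiv_slice_left {b : ℝ × E → E'} {t : ℝ} {u : E} (hb : DifferentiableAt ℝ b (t, u))
    (s : ℝ) : fderiv ℝ (fun t ↦ b (t, u)) t s = fderiv ℝ b (t, u) (s, 0) := by
  have h := HasFDerivAt.comp (g := b) (f := fun t ↦ (t, u)) t hb.hasFDerivAt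
    (hasFDerivAt_prodMk_left t u)
  rw [show (fun t ↦ b (t, u)) = b ∘ fun t ↦ (t, u) from rfl, h.fderiv]
  simp

theorem fderiv_slice_right {b : ℝ × E → E'} {t : ℝ} {u : E} (hb : DifferentiableAt ℝ b (t, u))
    (v : E) : fderiv ℝ (fun q ↦ b (t, q)) u v = fderiv ℝ b (t, u) (0, v) := by
  have h := HasFDerivAt.comp (g := b) (f := fun q ↦ (t, q)) u hb.hasFDerivAt
    (hasFDerivAt_prodMk_right t u)
  rw [show (fun q ↦ b (t, q)) = b ∘ fun q ↦ (t, q) from rfl, h.fderiv]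
  simp

variable {ΓM : E → E →L[ℝ] E →L[ℝ] E} {Γ : E' → E' →L[ℝ] E' →L[ℝ] E'} {F : ℝ × E → E'}

/-- The second fundamental form of `F (t, ·)`, as a function of `(t, u)`. -/
def sffSlice (ΓM : E → E →L[ℝ] E →L[ℝ] E) (Γ : E' → E' →L[ℝ] E' →L[ℝ] E') (F : ℝ × E → E')
    (v w : E) (p : ℝ × E) : E' :=
  fderiv ℝ (fderiv ℝ F) p (0, v) (0, w)
    + Γ (F p) (fderiv ℝ F p (0, v)) (fderiv ℝ F p (0, w)) - fderiv ℝ F p (0, ΓM p.2 v w)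

/-- Derivatives of a slice are derivatives of F on the product along vectors (0, v). In this form
the second fundamental form is visibly smooth in (t, u) jointly and can be differentiated in t. -/
theorem covHom_slice {t : ℝ} {u : E} (hF : ContDiffAt ℝ 2 F (t, u)) (v w : E) :
    covHom ΓM Γ (fun q ↦ F (t, q)) (fderiv ℝ fun q ↦ F (t, q)) u v w =
      sffSlice ΓM Γ F v w (t, u) := by
  have hd : DifferentiableAt ℝ F (t, u) := hF.differentiableAt (by simp)
  have hd2 : DifferentiableAt ℝ (fderiv ℝ F) (t, u) :=
    (hF.fderiv_right (m := 1) (by norm_num)).differentiableAt (by simp)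
  have hev : ∀ᶠ q in 𝓝 u, DifferentiableAt ℝ F (t, q) := by
    have : ContinuousAt (fun q : E ↦ (t, q)) u := by fun_prop
    refine this.eventually ?_
    filter_upwards [hF.eventually (by norm_num)] with y hy using hy.differentiableAt (by simp)
  have h1 : (fderiv ℝ fun q ↦ F (t, q)) =ᶠ[𝓝 u]
      fun q ↦ fderiv ℝ F (t, q) ∘L ContinuousLinearMap.inr ℝ ℝ E := by
    filter_upwards [hev] with q hq
    ext w
    simp [fderiv_slice_right hq]
  have hd3 : DifferentiableAt ℝ (fun q ↦ fderiv ℝ F (t, q)) u :=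
    hd2.comp u (hasFDerivAt_prodMk_right t u).differentiableAt
  rw [covHom_apply, h1.fderiv_eq, fderiv_slice_right hd, fderiv_slice_right hd,
    fderiv_slice_right hd, sffSlice, fderiv_clm_comp hd3 (by fun_prop)]
  simp [fderiv_slice_right (b := fderiv ℝ F) hd2]

theorem contDiffAt_sffSlice {p : ℝ × E} (hΓM : ContDiffAt ℝ ∞ ΓM p.2)
    (hΓ : ContDiffAt ℝ ∞ Γ (F p)) (hF : ContDiffAt ℝ ∞ F p) {v w : E → E}
    (hv : ContDiffAt ℝ ∞ v p.2) (hw : ContDiffAt ℝ ∞ w p.2) :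
    ContDiffAt ℝ ∞ (fun p ↦ sffSlice ΓM Γ F (v p.2) (w p.2) p) p := by
  have h1 : ContDiffAt ℝ ∞ (fderiv ℝ F) p := hF.fderiv_right (by simp)
  have h2 : ContDiffAt ℝ ∞ (fderiv ℝ (fderiv ℝ F)) p := h1.fderiv_right (by simp)
  have h3 : ContDiffAt ℝ ∞ (fun p ↦ Γ (F p)) p := hΓ.comp p hF
  have h4 : ContDiffAt ℝ ∞ (fun p : ℝ × E ↦ ΓM p.2) p := hΓM.comp p contDiffAt_snd
  have hv' : ContDiffAt ℝ ∞ (fun p : ℝ × E ↦ v p.2) p := hv.comp p contDiffAt_snd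
  have hw' : ContDiffAt ℝ ∞ (fun p : ℝ × E ↦ w p.2) p := hw.comp p contDiffAt_snd
  have hv0 : ContDiffAt ℝ ∞ (fun p : ℝ × E ↦ ((0 : ℝ), v p.2)) p := contDiffAt_const.prodMk hv'
  have hw0 : ContDiffAt ℝ ∞ (fun p : ℝ × E ↦ ((0 : ℝ), w p.2)) p := contDiffAt_const.prodMk hw'
  unfold sffSlice
  refine ((h2.clm_apply hv0).clm_apply hw0).add
    ((h3.clm_apply (h1.clm_apply hv0)).clm_apply (h1.clm_apply hw0)) |>.sub (h1.clm_apply ?_)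
  exact contDiffAt_const.prodMk ((h4.clm_apply hv').clm_apply hw')

theorem fderiv_christoffel_term {p : P} {F : P → E'} (hΓ : DifferentiableAt ℝ Γ (F p))
    (hF : DifferentiableAt ℝ F p) (hF2 : DifferentiableAt ℝ (fderiv ℝ F) p) (a x y : P) :
    fderiv ℝ (fun p ↦ Γ (F p) (fderiv ℝ F p x) (fderiv ℝ F p y)) p a =
      fderiv ℝ Γ (F p) (fderiv ℝ F p a) (fderiv ℝ F p x) (fderiv ℝ F p y)
        + Γ (F p) (fderiv ℝ (fderiv ℝ F) p a x) (fderiv ℝ F p y)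
        + Γ (F p) (fderiv ℝ F p x) (fderiv ℝ (fderiv ℝ F) p a y) := by
  have h3 : DifferentiableAt ℝ (fun p ↦ Γ (F p)) p := hΓ.comp p hF
  rw [fderiv_clm_apply (by fun_prop) (by fun_prop), fderiv_clm_apply (by fun_prop) (by fun_prop),
    fderiv_clm_apply (by fun_prop) (by fun_prop), fderiv_clm_apply (by fun_prop) (by fun_prop),
    fderiv_fun_comp p hΓ hF]
  simp
  abel

/-- The variation of the second fundamental form. -/
theorem covD_sff_variation {t : ℝ} {u : E} (hΓ : ContDiffAt ℝ ∞ Γ (F (t, u)))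
    (hsymm : ∀ᶠ q in 𝓝 (F (t, u)), ∀ v w, Γ q v w = Γ q w v)
    (hF : ContDiffAt ℝ ∞ F (t, u)) (v w : E) :
    covD Γ (fun s ↦ F (s, u))
        (fun s ↦ covHom ΓM Γ (fun q ↦ F (s, q)) (fderiv ℝ fun q ↦ F (s, q)) u v w) t 1 =
      covHom ΓM Γ (fun q ↦ F (t, q))
          (covD Γ (fun q ↦ F (t, q)) fun q ↦ fderiv ℝ F (t, q) (1, 0)) u v w
        + curvL Γ (F (t, u)) (fderiv ℝ F (t, u) (1, 0)) (fderiv ℝ F (t, u) (0, v))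
          (fderiv ℝ F (t, u) (0, w)) := by
  have hd : DifferentiableAt ℝ F (t, u) := hF.differentiableAt (by simp)
  have h1 : ContDiffAt ℝ ∞ (fderiv ℝ F) (t, u) := hF.fderiv_right (by simp)
  have h2 : ContDiffAt ℝ ∞ (fderiv ℝ (fderiv ℝ F)) (t, u) := h1.fderiv_right (by simp)
  have hd1 : DifferentiableAt ℝ (fderiv ℝ F) (t, u) := h1.differentiableAt (by simp)
  have hd2 : DifferentiableAt ℝ (fderiv ℝ (fderiv ℝ F)) (t, u) := h2.differentiableAt (by simp)
  have hdΓ : DifferentiableAt ℝ Γ (F (t, u)) := hΓ.differentiableAt (by simp)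
  have hdΓF : DifferentiableAt ℝ (fun p ↦ Γ (F p)) (t, u) := hdΓ.comp _ hd
  have h2' : ContDiffAt ℝ 2 F (t, u) := hF.of_le two_le_infty
  -- the left-hand side
  have hL : (fun s ↦ covHom ΓM Γ (fun q ↦ F (s, q)) (fderiv ℝ fun q ↦ F (s, q)) u v w) =ᶠ[𝓝 t]
      fun s ↦ (fun p : ℝ × E ↦ fderiv ℝ (fderiv ℝ F) p (0, v) (0, w)
        + Γ (F p) (fderiv ℝ F p (0, v)) (fderiv ℝ F p (0, w))
        - fderiv ℝ F p (0, ΓM u v w)) (s, u) := by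
    have hc : ContinuousAt (fun s : ℝ ↦ (s, u)) t := by fun_prop
    filter_upwards [hc.eventually (h2'.eventually (by norm_num))] with s hs
    exact covHom_slice hs v w
  have hA (x y : ℝ × E) : DifferentiableAt ℝ (fun p ↦ fderiv ℝ (fderiv ℝ F) p x y) (t, u) := by
    fun_prop
  have hA' (a x y : ℝ × E) : fderiv ℝ (fun p ↦ fderiv ℝ (fderiv ℝ F) p x y) (t, u) a
      = fderiv ℝ (fderiv ℝ (fderiv ℝ F)) (t, u) a x y := by
    rw [fderiv_clm_apply (by fun_prop) (by fun_prop), fderiv_clm_apply (by fun_prop) (by fun_prop)]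
    simp
  have hB (x y : ℝ × E) :
      DifferentiableAt ℝ (fun p ↦ Γ (F p) (fderiv ℝ F p x) (fderiv ℝ F p y)) (t, u) := by
    fun_prop
  have hC (x : ℝ × E) : DifferentiableAt ℝ (fun p ↦ fderiv ℝ F p x) (t, u) := by fun_prop
  have hC' (a x : ℝ × E) : fderiv ℝ (fun p ↦ fderiv ℝ F p x) (t, u) a
      = fderiv ℝ (fderiv ℝ F) (t, u) a x := by
    rw [fderiv_clm_apply (by fun_prop) (by fun_prop)]
    simp
  have hBd (a x y : ℝ × E) := fderiv_christoffel_term (Γ := Γ) hdΓ hd hd1 a x y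
  rw [covD_congr EventuallyEq.rfl hL, covD_apply, fderiv_slice_left (((hA _ _).fun_add (hB _ _)).fun_sub
    (hC _)), fderiv_fun_sub ((hA _ _).fun_add (hB _ _)) (hC _), fderiv_fun_add (hA _ _) (hB _ _),
    fderiv_slice_left hd, sub_apply, add_apply, hA', hBd, hC']
  -- the right-hand side
  have hdr : ∀ᶠ q in 𝓝 u, DifferentiableAt ℝ F (t, q) ∧ DifferentiableAt ℝ (fderiv ℝ F) (t, q) := by
    have hc : ContinuousAt (fun q : E ↦ (t, q)) u := by fun_prop
    exact hc.eventually ((eventually_differentiableAt hF).and (eventually_differentiableAt h1))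
  have hS : DifferentiableAt ℝ (covD Γ (fun q ↦ F (t, q)) fun q ↦ fderiv ℝ F (t, q) (1, 0)) u := by
    have hi : ContDiffAt ℝ ∞ (fun q : E ↦ (t, q)) u := by fun_prop
    refine (contDiffAt_covD (F := fun q ↦ F (t, q)) hΓ (hF.comp u hi) ?_).differentiableAt (by simp)
    exact (h1.comp u hi).clm_apply contDiffAt_const
  have hSw : (fun q ↦ covD Γ (fun q ↦ F (t, q)) (fun q ↦ fderiv ℝ F (t, q) (1, 0)) q w) =ᶠ[𝓝 u]
      fun q ↦ (fun p ↦ fderiv ℝ (fderiv ℝ F) p (0, w) (1, 0)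
        + Γ (F p) (fderiv ℝ F p (0, w)) (fderiv ℝ F p (1, 0))) (t, q) := by
    filter_upwards [hdr] with q hq
    rw [covD_apply, fderiv_slice_right hq.1,
      fderiv_slice_right (b := fun p ↦ fderiv ℝ F p (1, 0)) (hq.2.clm_apply (by fun_prop)),
      fderiv_clm_apply hq.2 (by fun_prop)]
    simp
  have hSw' : fderiv ℝ (covD Γ (fun q ↦ F (t, q)) fun q ↦ fderiv ℝ F (t, q) (1, 0)) u v w =
      fderiv ℝ (fun q ↦ covD Γ (fun q ↦ F (t, q)) (fun q ↦ fderiv ℝ F (t, q) (1, 0)) q w) u v := by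
    rw [fderiv_clm_apply hS (by fun_prop)]
    simp
  have hcov (z : E) : covD Γ (fun q ↦ F (t, q)) (fun q ↦ fderiv ℝ F (t, q) (1, 0)) u z =
      fderiv ℝ (fderiv ℝ F) (t, u) (0, z) (1, 0)
        + Γ (F (t, u)) (fderiv ℝ F (t, u) (0, z)) (fderiv ℝ F (t, u) (1, 0)) := by
    rw [covD_apply, fderiv_slice_right hd,
      fderiv_slice_right (b := fun p ↦ fderiv ℝ F p (1, 0)) (hC _), hC']
  rw [covHom_apply, hSw', hSw.fderiv_eq, fderiv_slice_right ((hA _ _).fun_add (hB _ _)),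
    fderiv_fun_add (hA _ _) (hB _ _), add_apply, hA', hBd, hcov, hcov, fderiv_slice_right hd]
  -- symmetries
  have hs0 := hsymm.self_of_nhds
  have hs1 (a b c : E') : fderiv ℝ Γ (F (t, u)) a b c = fderiv ℝ Γ (F (t, u)) a c b := by
    have h1 (b c : E') : fderiv ℝ (fun q ↦ Γ q b c) (F (t, u)) a
        = fderiv ℝ Γ (F (t, u)) a b c := by
      rw [fderiv_clm_apply (by fun_prop) (by fun_prop),
        fderiv_clm_apply (by fun_prop) (by fun_prop)]
      simp
    rw [← h1, ← h1]
    congr 1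
    apply Filter.EventuallyEq.fderiv_eq
    filter_upwards [hsymm] with q hq using hq b c
  have hF2 (a b : ℝ × E) := fderiv_symm_of_contDiffAt h2' a b
  have hF3 (a b : ℝ × E) : fderiv ℝ (fderiv ℝ (fderiv ℝ F)) (t, u) a b
      = fderiv ℝ (fderiv ℝ (fderiv ℝ F)) (t, u) b a :=
    fderiv_symm_of_contDiffAt (h1.of_le two_le_infty) a b
  have hF3' (a b c : ℝ × E) : fderiv ℝ (fderiv ℝ (fderiv ℝ F)) (t, u) a b c
      = fderiv ℝ (fderiv ℝ (fderiv ℝ F)) (t, u) a c b := by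
    rw [← hA', ← hA']
    congr 1
    apply Filter.EventuallyEq.fderiv_eq
    filter_upwards [h2'.eventually (by norm_num)] with q hq using fderiv_symm_of_contDiffAt hq b c
  -- The third derivatives are brought to one order, with (1, 0) last, and cancel. What survives of
  -- the two sides are the derivatives of Γ and the terms quadratic in Γ, which form the curvature.
  rw [hF3 (1, 0) (0, v), hF3' (0, v) (1, 0) (0, w), curvL]
  rw [hF2 (1, 0) (0, v), hF2 (1, 0) (0, w), hF2 (1, 0) (0, ΓM u v w)]
  rw [hs1 (fderiv ℝ F (t, u) (0, v)) (fderiv ℝ F (t, u) (1, 0)) (fderiv ℝ F (t, u) (0, w))]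
  simp only [map_add, map_sub, hs0 (fderiv ℝ F (t, u) (1, 0)) (fderiv ℝ F (t, u) (0, w)),
    hs0 (fderiv ℝ F (t, u) (1, 0)) (fderiv ℝ (fderiv ℝ F) (t, u) (0, v) (0, w)),
    hs0 (fderiv ℝ F (t, u) (1, 0)) (fderiv ℝ F (t, u) (0, ΓM u v w)),
    hs0 (fderiv ℝ (fderiv ℝ F) (t, u) (0, v) (1, 0)) (fderiv ℝ F (t, u) (0, w))]
  abel

end LocalCurvature

/-! ### Horizontal isometries, traces and the Riemannian density, in coordinates -/

section LocalTrace

variable {E E' : Type*} [NormedAddCommGroup E] [NormedSpace ℝ E] [FiniteDimensional ℝ E]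
  [NormedAddCommGroup E'] [NormedSpace ℝ E']

/-- An isometry on the horizontal spaces has vanishing second fundamental form there. -/
theorem sff_horizontal_eq_zero [FiniteDimensional ℝ E'] {g : E → E →L[ℝ] E →L[ℝ] ℝ} {U : Set E}
    {h : E' → E' →L[ℝ] E' →L[ℝ] ℝ} {U' : Set E'} (hg : IsMetricOn g U) (hh : IsMetricOn h U')
    {F : E → E'} {u : E} (hu : u ∈ U) (hFu : F u ∈ U') (hF : ContDiffAt ℝ ∞ F u)
    {Pr : E → E →L[ℝ] E} (hP : DifferentiableAt ℝ Pr u)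
    (hiso : ∀ᶠ q in 𝓝 u, ∀ v y,
      h (F q) (fderiv ℝ F q v) (fderiv ℝ F q (Pr q y)) = g q v (Pr q y))
    {x y z : E} (hx : Pr u x = x) (hy : Pr u y = y) (hz : Pr u z = z) :
    h (F u) (covHom (christoffel g) (christoffel h) F (fderiv ℝ F) u z x) (fderiv ℝ F u y) = 0 := by
  have hF1 : DifferentiableAt ℝ F u := hF.differentiableAt (by simp)
  have hdF : DifferentiableAt ℝ (fderiv ℝ F) u :=
    (hF.fderiv_right (m := ∞) (by simp)).differentiableAt (by simp)
  set B := covHom (christoffel g) (christoffel h) F (fderiv ℝ F) u with hB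
  have hBs (v w : E) : B v w = B w v := by
    rw [hB, covHom_apply, covHom_apply, fderiv_symm_of_contDiffAt (hF.of_le two_le_infty),
      hh.christoffel_symm hFu, hg.christoffel_symm hu]
  -- The identity ⟨dF X, dF Y⟩ = ⟨X, Y⟩ for the fields X = Pr x and Y = Pr y is differentiated along
  -- z. The terms with ∇X and ∇Y cancel by the isometry property, as the other factor is horizontal.
  have anti {x y : E} (z : E) (hx : Pr u x = x) (hy : Pr u y = y) :
      h (F u) (B z x) (fderiv ℝ F u y) + h (F u) (B z y) (fderiv ℝ F u x) = 0 := by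
    have hX (x : E) : DifferentiableAt ℝ (fun q ↦ Pr q x) u := hP.clm_apply (by fun_prop)
    have hdX (x : E) : DifferentiableAt ℝ (fun q ↦ fderiv ℝ F q (Pr q x)) u :=
      hdF.clm_apply (hX x)
    have e1 := fderiv_metric_apply hh hFu hF1 (hdX x) (hdX y) z
    have e2 := fderiv_metric_apply hg (F := id) hu differentiableAt_id (hX x) (hX y) z
    have e3 : (fun q ↦ h (F q) (fderiv ℝ F q (Pr q x)) (fderiv ℝ F q (Pr q y))) =ᶠ[𝓝 u]
        fun q ↦ g (id q) (Pr q x) (Pr q y) := by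
      filter_upwards [hiso] with q hq using hq _ _
    have e4 (x : E) := covD_clm_apply (ΓM := christoffel g) (Γ := christoffel h) (F := F)
      hdF (hX x) z
    rw [e3.fderiv_eq, e2] at e1
    have e5 := hiso.self_of_nhds
    have e6 := e4 x
    have e7 := e4 y
    have e8 := e5 (covD (christoffel g) id (fun q ↦ Pr q x) u z) y
    have e9 := e5 (covD (christoffel g) id (fun q ↦ Pr q y) u z) x
    rw [sub_eq_iff_eq_add] at e6 e7
    rw [e6, e7] at e1
    simp only [hx, hy, map_add, add_apply, id] at e1 e8 e9
    rw [← hB] at e1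
    rw [hh.symm _ hFu (fderiv ℝ F u x), hh.symm _ hFu (fderiv ℝ F u x),
      hg.symm _ hu x, ← e8, ← e9] at e1
    linarith
  -- A trilinear form symmetric in two slots and skew in another two vanishes; three cyclic
  -- instances suffice, as in the uniqueness of the Levi-Civita connection.
  have a1 := anti z hx hy
  have a2 := anti x hy hz
  have a3 := anti y hx hz
  rw [hBs x z, hBs x y] at a2
  rw [hBs y z] at a3
  linarith

variable {ι κ : Type*} [Fintype ι] [Fintype κ]

/-- The trace of a bilinear map with respect to `g` at `u`. -/
def trL (b : Module.Basis ι ℝ E) (g : E → E →L[ℝ] E →L[ℝ] ℝ) (u : E) (B : E → E → E') : E' :=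
  ∑ j, B (sharp g u (LinearMap.toContinuousLinearMap (b.coord j))) (b j)

/-- The trace may be computed in the fixed basis b with indices raised by g, an expression smooth in
u, or in a g-orthonormal basis, which need not depend smoothly on u. -/
theorem trL_eq_sum (b : Module.Basis ι ℝ E) {g : E → E →L[ℝ] E →L[ℝ] ℝ} {U : Set E} (hg : IsMetricOn g U) {u : E}
    (hu : u ∈ U) {e : κ → E} (he : ∀ w, ∑ k, g u (e k) w • e k = w) (B : E →L[ℝ] E →L[ℝ] E') :
    trL b g u (fun v w ↦ B v w) = ∑ k, B (e k) (e k) := by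
  have h1 (k : κ) : ∑ j, g u (e k) (b j) •
      sharp g u (LinearMap.toContinuousLinearMap (b.coord j)) = e k := by
    simp_rw [← map_smul]
    rw [← map_sum]
    conv_rhs => rw [← hg.sharp_apply hu (e k)]
    congr 1
    ext w
    conv_rhs => rw [← b.sum_repr w, map_sum]
    simp [mul_comm]
  calc trL b g u (fun v w ↦ B v w)
      = ∑ j, ∑ k, B (sharp g u (LinearMap.toContinuousLinearMap (b.coord j)))
          (g u (e k) (b j) • e k) := by
        refine Finset.sum_congr rfl fun j _ ↦ ?_
        rw [← map_sum, he]
    _ = ∑ k, B (∑ j, g u (e k) (b j) •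
          sharp g u (LinearMap.toContinuousLinearMap (b.coord j))) (e k) := by
        rw [Finset.sum_comm]
        refine Finset.sum_congr rfl fun k _ ↦ ?_
        simp [map_sum]
    _ = _ := by simp_rw [h1]

theorem trace_eq_sum {g : E → E →L[ℝ] E →L[ℝ] ℝ} {u : E} {e : κ → E}
    (he : ∀ w, ∑ k, g u (e k) w • e k = w) (A : E →L[ℝ] E) :
    LinearMap.trace ℝ E (A : E →ₗ[ℝ] E) = ∑ k, g u (e k) (A (e k)) := by
  have hA : (A : E →ₗ[ℝ] E) = ∑ k, (LinearMap.smulRight ((g u (e k) : E →L[ℝ] ℝ) : E →ₗ[ℝ] ℝ) (A (e k))) := by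
    ext w
    conv_lhs => rw [← he w]
    simp [LinearMap.sum_apply]
  rw [hA, map_sum]
  simp

/-- The Gram matrix of the metric. -/
def gram (b : Module.Basis ι ℝ E) (g : E → E →L[ℝ] E →L[ℝ] ℝ) (u : E) : Matrix ι ι ℝ :=
  Matrix.of fun i j ↦ g u (b i) (b j)

variable [DecidableEq ι]

/-- The quadratic form of the Gram matrix at x is g(v, v) for v = ∑ x_i b_i. -/
theorem det_gram_pos (b : Module.Basis ι ℝ E) {g : E → E →L[ℝ] E →L[ℝ] ℝ} {U : Set E} (hg : IsMetricOn g U) {u : E}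
    (hu : u ∈ U) : 0 < (gram b g u).det := by
  apply Matrix.PosDef.det_pos
  refine Matrix.PosDef.of_dotProduct_mulVec_pos ?_ ?_
  · ext i j
    simp [gram, hg.symm u hu (b i)]
  · intro x hx
    have h1 : star x ⬝ᵥ (gram b g u).mulVec x = g u (∑ i, x i • b i) (∑ i, x i • b i) := by
      simp only [gram, dotProduct, Matrix.mulVec, Matrix.of_apply, map_sum, map_smul, sum_apply,
        smul_apply, smul_eq_mul, star_trivial]
      refine Finset.sum_congr rfl fun i _ ↦ ?_
      rw [Finset.mul_sum, Finset.mul_sum]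
      refine Finset.sum_congr rfl fun j _ ↦ ?_
      rw [hg.symm u hu (b j)]
      ring
    rw [h1]
    apply hg.pos u hu
    intro h0
    apply hx
    ext i
    have := Fintype.linearIndependent_iff.1 b.linearIndependent x h0 i
    simpa using this

/-- Jacobi's formula: the determinant is multilinear in the rows, and replacing one row by its
derivative is expanded along that row by the adjugate. -/
theorem hasFDerivAt_det {G : E → Matrix ι ι ℝ} {u : E}
    (hG : ∀ i j, DifferentiableAt ℝ (fun q ↦ G q i j) u) (v : E) :
    DifferentiableAt ℝ (fun q ↦ (G q).det) u ∧
    fderiv ℝ (fun q ↦ (G q).det) u v =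
      (Matrix.of (fun i j ↦ fderiv ℝ (fun q ↦ G q i j) u v) * (G u).adjugate).trace := by
  let D : ContinuousMultilinearMap ℝ (fun _ : ι ↦ ι → ℝ) ℝ :=
    ⟨(Matrix.detRowAlternating (n := ι) (R := ℝ)).toMultilinearMap,
      (continuous_id.matrix_det : Continuous fun A : Matrix ι ι ℝ ↦ A.det)⟩
  let G' : E → ι → ι → ℝ := fun q i j ↦ G q i j
  have hG' : DifferentiableAt ℝ G' u :=
    differentiableAt_pi.2 fun i ↦ differentiableAt_pi.2 fun j ↦ hG i j
  have h1 : HasFDerivAt (fun q ↦ (G q).det) (D.linearDeriv (G' u) ∘L fderiv ℝ G' u) u :=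
    (D.hasFDerivAt (G' u)).comp u hG'.hasFDerivAt
  refine ⟨h1.differentiableAt, ?_⟩
  rw [h1.fderiv, ContinuousLinearMap.comp_apply, ContinuousMultilinearMap.linearDeriv_apply,
    Matrix.trace]
  refine Finset.sum_congr rfl fun i _ ↦ ?_
  have h2 : (fderiv ℝ G' u v) i = fun j ↦ fderiv ℝ (fun q ↦ G q i j) u v := by
    have e1 := (hasFDerivAt_pi'.1 hG'.hasFDerivAt i)
    ext j
    have e2 := (hasFDerivAt_pi'.1 e1 j)
    have : (fun q ↦ G q i j) = fun q ↦ G' q i j := rfl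
    rw [this, e2.fderiv]
    simp
  rw [h2]
  change ((G u).updateRow i fun j ↦ fderiv ℝ (fun q ↦ G q i j) u v).det = _
  rw [← Matrix.cramer_transpose_apply, Matrix.cramer_eq_adjugate_mulVec, ← Matrix.adjugate_transpose (G u)]
  simp [Matrix.mulVec, dotProduct, Matrix.mul_apply, mul_comm]

/-- The Riemannian density in the basis `b`. -/
def dens (b : Module.Basis ι ℝ E) (g : E → E →L[ℝ] E →L[ℝ] ℝ) (u : E) : ℝ :=
  Real.sqrt (gram b g u).det

theorem contDiffAt_dens (b : Module.Basis ι ℝ E) {g : E → E →L[ℝ] E →L[ℝ] ℝ} {U : Set E}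
    (hg : IsMetricOn g U) {u : E} (hu : u ∈ U) : ContDiffAt ℝ ∞ (dens b g) u := by
  refine ContDiffAt.sqrt ?_ (det_gram_pos b hg hu).ne'
  simp only [Matrix.det_apply]
  refine ContDiffAt.sum fun σ _ ↦ ContDiffAt.const_smul _ (contDiffAt_prod fun i _ ↦ ?_)
  exact ((hg.contDiffAt hu).clm_apply contDiffAt_const).clm_apply contDiffAt_const

/-- As the metric is parallel, the derivative of the Gram matrix G is AᵀG + GA, with A the matrix of
Γ(v, ·). Jacobi's formula gives 2 det(G) tr(A), and the square root removes the factor 2. -/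
theorem fderiv_dens (b : Module.Basis ι ℝ E) {g : E → E →L[ℝ] E →L[ℝ] ℝ} {U : Set E}
    (hg : IsMetricOn g U) {u : E} (hu : u ∈ U) (v : E) :
    fderiv ℝ (dens b g) u v =
      dens b g u * LinearMap.trace ℝ E (christoffel g u v : E →ₗ[ℝ] E) := by
  have hd : DifferentiableAt ℝ g u := (hg.contDiffAt hu).differentiableAt (by simp)
  have hG (i j : ι) : DifferentiableAt ℝ (fun q ↦ gram b g q i j) u :=
    (hd.clm_apply (differentiableAt_const _)).clm_apply (differentiableAt_const _)
  obtain ⟨h1, h2⟩ := hasFDerivAt_det hG v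
  set A := LinearMap.toMatrix b b (christoffel g u v : E →ₗ[ℝ] E) with hA
  have hb (i : ι) : christoffel g u v (b i) = ∑ k, A k i • b k := by
    conv_lhs => rw [← b.sum_repr (christoffel g u v (b i))]
    simp [hA, LinearMap.toMatrix_apply]
  have hH : Matrix.of (fun i j ↦ fderiv ℝ (fun q ↦ gram b g q i j) u v) =
      A.transpose * gram b g u + gram b g u * A := by
    ext i j
    have e1 : fderiv ℝ (fun q ↦ gram b g q i j) u v = fderiv ℝ g u v (b i) (b j) := by
      simp only [gram, Matrix.of_apply]
      rw [fderiv_clm_apply (by fun_prop) (by fun_prop),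
        fderiv_clm_apply (by fun_prop) (by fun_prop)]
      simp
    rw [Matrix.of_apply, e1, hg.fderiv_apply hu, hb, hb]
    simp [Matrix.mul_apply, gram, mul_comm]
  have htr : LinearMap.trace ℝ E (christoffel g u v : E →ₗ[ℝ] E) = A.trace :=
    LinearMap.trace_eq_matrix_trace ℝ b _
  have hdet : fderiv ℝ (fun q ↦ (gram b g q).det) u v = 2 * (gram b g u).det * A.trace := by
    rw [h2, hH, add_mul, Matrix.trace_add, mul_assoc, Matrix.mul_adjugate,
      Matrix.trace_mul_cycle, Matrix.adjugate_mul]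
    simp [Matrix.trace_smul]
    ring
  have hpos := det_gram_pos b hg hu
  have h3 := (h1.hasFDerivAt.sqrt hpos.ne').fderiv
  change fderiv ℝ (fun q ↦ Real.sqrt (gram b g q).det) u v = _
  rw [h3, smul_apply, hdet, htr, dens, smul_eq_mul]
  have h4 : Real.sqrt (gram b g u).det ≠ 0 := (Real.sqrt_pos.2 hpos).ne'
  have h5 : (gram b g u).det = Real.sqrt (gram b g u).det * Real.sqrt (gram b g u).det :=
    (Real.mul_self_sqrt hpos.le).symm
  field_simp
  rw [sq, ← h5]

/-- The coordinate formula √g div X = ∑ ∂_i(√g X^i). The symmetry of Γ identifies the trace of Γ(·,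
X) with the logarithmic derivative of √g along X. -/
theorem dens_mul_trace_covD (b : Module.Basis ι ℝ E) {g : E → E →L[ℝ] E →L[ℝ] ℝ} {U : Set E}
    (hg : IsMetricOn g U) {u : E} (hu : u ∈ U) {X : E → E} (hX : DifferentiableAt ℝ X u) :
    dens b g u * LinearMap.trace ℝ E (covD (christoffel g) id X u : E →ₗ[ℝ] E) =
      LinearMap.trace ℝ E (fderiv ℝ (fun q ↦ dens b g q • X q) u : E →ₗ[ℝ] E) := by
  have h1 : DifferentiableAt ℝ (dens b g) u := (contDiffAt_dens b hg hu).differentiableAt (by simp)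
  have h2 : ((fderiv ℝ (fun q ↦ dens b g q • X q) u : E →L[ℝ] E) : E →ₗ[ℝ] E) =
      dens b g u • (fderiv ℝ X u : E →ₗ[ℝ] E) +
        LinearMap.smulRight ((fderiv ℝ (dens b g) u : E →L[ℝ] ℝ) : E →ₗ[ℝ] ℝ) (X u) := by
    rw [fderiv_fun_smul h1 hX]
    rfl
  have h3 : (covD (christoffel g) id X u : E →ₗ[ℝ] E) =
      (fderiv ℝ X u : E →ₗ[ℝ] E) + (christoffel g u (X u) : E →ₗ[ℝ] E) := by
    ext a
    simp [covD_id_apply, hg.christoffel_symm hu a]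
  rw [h2, h3, map_add, map_add, map_smul, LinearMap.trace_smulRight, mul_add]
  simp [fderiv_dens b hg hu]

/-- The divergence theorem in a vector space: each coordinate derivative is integrated by parts
against the constant function 1. -/
theorem integral_trace_fderiv_eq_zero [MeasurableSpace E] [BorelSpace E] (ν : Measure E)
    [ν.IsAddHaarMeasure] {Y : E → E} (hY : ContDiff ℝ 1 Y) (hc : HasCompactSupport Y) :
    ∫ u, LinearMap.trace ℝ E (fderiv ℝ Y u : E →ₗ[ℝ] E) ∂ν = 0 := by
  let b := Module.finBasis ℝ E
  have hYd : Differentiable ℝ Y := hY.differentiable (by simp)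
  let c (j) : E →L[ℝ] ℝ := LinearMap.toContinuousLinearMap (b.coord j)
  have h1 (u : E) : LinearMap.trace ℝ E (fderiv ℝ Y u : E →ₗ[ℝ] E) =
      ∑ j, fderiv ℝ (fun q ↦ c j (Y q)) u (b j) := by
    rw [LinearMap.trace_eq_matrix_trace ℝ b, Matrix.trace]
    refine Finset.sum_congr rfl fun j _ ↦ ?_
    rw [show (fun q ↦ c j (Y q)) = c j ∘ Y from rfl,
      ((c j).hasFDerivAt.comp u (hYd u).hasFDerivAt).fderiv]
    simp [LinearMap.toMatrix_apply, c]
  simp_rw [h1]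
  have hcd (j) : ContDiff ℝ 1 (fun q ↦ c j (Y q)) := (c j).contDiff.comp hY
  have hcs (j) : HasCompactSupport (fun q ↦ c j (Y q)) := hc.comp_left (map_zero _)
  have hi (j) : Integrable (fun u ↦ fderiv ℝ (fun q ↦ c j (Y q)) u (b j)) ν := by
    refine Continuous.integrable_of_hasCompactSupport ?_ ?_
    · exact ((hcd j).continuous_fderiv (by simp)).clm_apply continuous_const
    · exact (hcs j).fderiv_apply ℝ (b j)
  rw [integral_finsetSum _ fun j _ ↦ hi j]
  refine Finset.sum_eq_zero fun j _ ↦ ?_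
  have := integral_mul_fderiv_eq_neg_fderiv_mul_of_integrable (μ := ν) (f := fun _ ↦ (1 : ℝ))
    (g := fun q ↦ c j (Y q)) (v := b j) (by simp) (by simpa using hi j)
    (by simpa using (hcd j).continuous.integrable_of_hasCompactSupport (hcs j))
    (fun _ _ ↦ by fun_prop) (fun x _ ↦ (hcd j).differentiable (by simp) x)
  simpa using this

end LocalTrace

/-! ### Vector fields, maps and sections in charts -/

section Charts


variable {m n : ℕ}
  {M : Type*} [TopologicalSpace M] [ChartedSpace (EuclideanSpace ℝ (Fin m)) M]
  [IsManifold (𝓡 m) ∞ M]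
  {N : Type*} [TopologicalSpace N] [ChartedSpace (EuclideanSpace ℝ (Fin n)) N]
  [IsManifold (𝓡 n) ∞ N]

/-- The preferred chart at `c`. -/
abbrev ch (m : ℕ) {M : Type*} [TopologicalSpace M]
    [ChartedSpace (EuclideanSpace ℝ (Fin m)) M] (c : M) : OpenPartialHomeomorph M (EuclideanSpace ℝ (Fin m)) :=
  chartAt (EuclideanSpace ℝ (Fin m)) c

/-- The components of tangent vectors at `x` in the chart at `c`. -/
def toE (c x : M) : TangentSpace (𝓡 m) x →L[ℝ] EuclideanSpace ℝ (Fin m) :=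
  (trivializationAt (EuclideanSpace ℝ (Fin m)) (TangentSpace (𝓡 m)) c).continuousLinearMapAt ℝ x

/-- The tangent vector at `x` with given components in the chart at `c`. -/
def ofE (c x : M) : EuclideanSpace ℝ (Fin m) →L[ℝ] TangentSpace (𝓡 m) x :=
  (trivializationAt (EuclideanSpace ℝ (Fin m)) (TangentSpace (𝓡 m)) c).symmL ℝ x

variable {c x : M}

theorem toE_ofE (hx : x ∈ (ch m c).source) (v : EuclideanSpace ℝ (Fin m)) :
    toE c x (ofE c x v) = v :=
  (trivializationAt (EuclideanSpace ℝ (Fin m)) (TangentSpace (𝓡 m)) c).continuousLinearMapAt_symmL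
    (by simpa using hx) v

theorem ofE_toE (hx : x ∈ (ch m c).source) (v : TangentSpace (𝓡 m) x) : ofE c x (toE c x v) = v :=
  (trivializationAt (EuclideanSpace ℝ (Fin m)) (TangentSpace (𝓡 m)) c).symmL_continuousLinearMapAt
    (by simpa using hx) v

theorem toE_injective (hx : x ∈ (ch m c).source) {v w : TangentSpace (𝓡 m) x}
    (h : toE c x v = toE c x w) : v = w := by
  rw [← ofE_toE hx v, h, ofE_toE hx]

/-- The expression of a vector field in the chart at `c`. -/
def loc (c : M) (Y : VField m M) (u : EuclideanSpace ℝ (Fin m)) : EuclideanSpace ℝ (Fin m) :=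
  toE c ((ch m c).symm u) (Y ((ch m c).symm u))

/-- The expression of a map in the charts at `c` and `d`. -/
def locMap (m n : ℕ) {M N : Type*} [TopologicalSpace M]
    [ChartedSpace (EuclideanSpace ℝ (Fin m)) M] [TopologicalSpace N]
    [ChartedSpace (EuclideanSpace ℝ (Fin n)) N] (c : M) (d : N) (φ : M → N) (u : EuclideanSpace ℝ (Fin m)) :
    EuclideanSpace ℝ (Fin n) :=
  ch n d (φ ((ch m c).symm u))

/-- The expression of a section along `φ` in the charts at `c` and `d`. -/
def locA (c : M) (d : N) (φ : M → N) (σ : Along n φ) (u : EuclideanSpace ℝ (Fin m)) :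
    EuclideanSpace ℝ (Fin n) :=
  toE d (φ ((ch m c).symm u)) (σ ((ch m c).symm u))

theorem loc_apply (hx : x ∈ (ch m c).source) (Y : VField m M) :
    loc c Y (ch m c x) = toE c x (Y x) := by
  simp only [loc]
  rw [(ch m c).left_inv hx]

theorem locMap_apply (hx : x ∈ (ch m c).source) (d : N) (φ : M → N) :
    locMap m n c d φ (ch m c x) = ch n d (φ x) := by
  simp only [locMap]
  rw [(ch m c).left_inv hx]

theorem locA_apply (hx : x ∈ (ch m c).source) (d : N) (φ : M → N) (σ : Along n φ) :
    locA c d φ σ (ch m c x) = toE d (φ x) (σ x) := by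
  simp only [locA]
  rw [(ch m c).left_inv hx]

theorem trivialization_snd (hx : x ∈ (ch m c).source) (v : TangentSpace (𝓡 m) x) :
    (trivializationAt (EuclideanSpace ℝ (Fin m)) (TangentSpace (𝓡 m)) c
      (⟨x, v⟩ : TangentBundle (𝓡 m) M)).2 = toE c x v := by
  have : x ∈ (trivializationAt (EuclideanSpace ℝ (Fin m)) (TangentSpace (𝓡 m)) c).baseSet := by
    simpa using hx
  rw [toE, Bundle.Trivialization.continuousLinearMapAt_apply,
    Bundle.Trivialization.linearMapAt_apply, if_pos this]

theorem contMDiffAt_ch (hx : x ∈ (ch m c).source) :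
    ContMDiffAt (𝓡 m) 𝓘(ℝ, EuclideanSpace ℝ (Fin m)) ∞ (ch m c) x :=
  contMDiffAt_of_mem_maximalAtlas (IsManifold.chart_mem_maximalAtlas c) hx

theorem contMDiffAt_ch_symm {u : EuclideanSpace ℝ (Fin m)} (hu : u ∈ (ch m c).target) :
    ContMDiffAt 𝓘(ℝ, EuclideanSpace ℝ (Fin m)) (𝓡 m) ∞ (ch m c).symm u :=
  contMDiffAt_symm_of_mem_maximalAtlas (IsManifold.chart_mem_maximalAtlas c) hu

theorem contMDiffAt_iff_comp_symm {F : Type*} [NormedAddCommGroup F] [NormedSpace ℝ F] {f : M → F}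
    {k : WithTop ℕ∞} (hk : k ≤ ∞) (hx : x ∈ (ch m c).source) :
    ContMDiffAt (𝓡 m) 𝓘(ℝ, F) k f x ↔ ContDiffAt ℝ k (fun u ↦ f ((ch m c).symm u)) (ch m c x) := by
  rw [← contMDiffAt_iff_contDiffAt]
  constructor
  · intro h
    refine ContMDiffAt.comp (ch m c x) (g := f) ?_
      ((contMDiffAt_ch_symm ((ch m c).map_source hx)).of_le hk)
    rwa [(ch m c).left_inv hx]
  · intro h
    have h1 : ContMDiffAt (𝓡 m) 𝓘(ℝ, F) k (fun y ↦ f ((ch m c).symm (ch m c y))) x :=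
      ContMDiffAt.comp x (g := fun u ↦ f ((ch m c).symm u)) h ((contMDiffAt_ch hx).of_le hk)
    refine h1.congr_of_eventuallyEq ?_
    filter_upwards [(ch m c).open_source.mem_nhds hx] with y hy
    rw [(ch m c).left_inv hy]

/-- Smoothness at `x` of a section along `φ`. -/
def SmoothAlongAt (m : ℕ) {n : ℕ} {M N : Type*} [TopologicalSpace M]
    [ChartedSpace (EuclideanSpace ℝ (Fin m)) M] [TopologicalSpace N]
    [ChartedSpace (EuclideanSpace ℝ (Fin n)) N] [IsManifold (𝓡 n) ∞ N] (φ : M → N) (σ : Along n φ) (x : M) : Prop :=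
  ContMDiffAt (𝓡 m) (𝓡 n).tangent ∞ (fun y ↦ (⟨φ y, σ y⟩ : TangentBundle (𝓡 n) N)) x

/-- Smoothness at `x` of a vector field. -/
def SmoothFieldAt (Y : VField m M) (x : M) : Prop :=
  ContMDiffAt (𝓡 m) (𝓡 m).tangent ∞ (fun y ↦ (⟨y, Y y⟩ : TangentBundle (𝓡 m) M)) x

theorem symm_tendsto (hx : x ∈ (ch m c).source) : Tendsto (ch m c).symm (𝓝 (ch m c x)) (𝓝 x) := by
  have := (ch m c).continuousAt_symm ((ch m c).map_source hx)
  rwa [ContinuousAt, (ch m c).left_inv hx] at this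

theorem eventually_symm {p : M → Prop} (hx : x ∈ (ch m c).source) (h : ∀ᶠ y in 𝓝 x, p y) :
    ∀ᶠ u in 𝓝 (ch m c x), p ((ch m c).symm u) := (symm_tendsto hx).eventually h

theorem smoothAlongAt_iff {φ : M → N} {σ : Along n φ} {d : N} (hφ : ContMDiffAt (𝓡 m) (𝓡 n) ∞ φ x)
    (hx : x ∈ (ch m c).source) (hd : φ x ∈ (ch n d).source) :
    SmoothAlongAt m φ σ x ↔ ContDiffAt ℝ ∞ (locA c d φ σ) (ch m c x) := by
  have he : (⟨φ x, σ x⟩ : TangentBundle (𝓡 n) N) ∈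
      (trivializationAt (EuclideanSpace ℝ (Fin n)) (TangentSpace (𝓡 n)) d).source := by
    simpa using hd
  have h0 := Bundle.Trivialization.contMDiffAt_iff (IM := 𝓡 m) (IB := 𝓡 n) (n := ∞) (x₀ := x)
    (f := fun y ↦ (⟨φ y, σ y⟩ : TangentBundle (𝓡 n) N))
    (e := trivializationAt (EuclideanSpace ℝ (Fin n)) (TangentSpace (𝓡 n)) d) he
  refine h0.trans ?_
  rw [and_iff_right hφ, contMDiffAt_iff_comp_symm le_rfl hx]
  have h1 : ∀ᶠ y in 𝓝 x, φ y ∈ (ch n d).source :=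
    hφ.continuousAt.eventually ((ch n d).open_source.mem_nhds hd)
  have h2 : (fun u ↦ (trivializationAt (EuclideanSpace ℝ (Fin n)) (TangentSpace (𝓡 n)) d
      (⟨φ ((ch m c).symm u), σ ((ch m c).symm u)⟩ : TangentBundle (𝓡 n) N)).2)
      =ᶠ[𝓝 (ch m c x)] locA c d φ σ := by
    filter_upwards [eventually_symm hx h1] with u hu using trivialization_snd hu _
  exact ⟨fun h ↦ h.congr_of_eventuallyEq h2.symm, fun h ↦ h.congr_of_eventuallyEq h2⟩

theorem smoothFieldAt_iff {Y : VField m M} (hx : x ∈ (ch m c).source) :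
    SmoothFieldAt Y x ↔ ContDiffAt ℝ ∞ (loc c Y) (ch m c x) :=
  smoothAlongAt_iff (φ := id) (σ := Y) contMDiffAt_id hx hx

theorem contDiffAt_locMap {φ : M → N} {d : N} (hφ : ContMDiffAt (𝓡 m) (𝓡 n) ∞ φ x)
    (hx : x ∈ (ch m c).source) (hd : φ x ∈ (ch n d).source) :
    ContDiffAt ℝ ∞ (locMap m n c d φ) (ch m c x) :=
  (contMDiffAt_iff_comp_symm le_rfl hx).1 ((contMDiffAt_ch hd).comp x hφ)

/-- The components of the derivative of the chart. -/
theorem mfderiv_ch (hx : x ∈ (ch m c).source) (v : TangentSpace (𝓡 m) x) :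
    mfderiv (𝓡 m) 𝓘(ℝ, EuclideanSpace ℝ (Fin m)) (ch m c) x v = toE c x v := by
  have h := TangentBundle.continuousLinearMapAt_trivializationAt (𝕜 := ℝ) (I := 𝓡 m) hx
  have h2 : (extChartAt (𝓡 m) c : M → EuclideanSpace ℝ (Fin m)) = ch m c := by
    ext y; simp
  rw [h2] at h
  rw [toE, h]
  rfl

theorem mfderiv_ch_symm {u : EuclideanSpace ℝ (Fin m)} (hu : u ∈ (ch m c).target)
    (v : EuclideanSpace ℝ (Fin m)) :
    mfderiv 𝓘(ℝ, EuclideanSpace ℝ (Fin m)) (𝓡 m) (ch m c).symm u v = ofE c ((ch m c).symm u) v := by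
  have hx' : (ch m c).symm u ∈ (ch m c).source := (ch m c).map_target hu
  apply toE_injective hx'
  rw [toE_ofE hx', ← mfderiv_ch hx']
  have h := (mdifferentiable_chart (I := 𝓡 m) c).comp_symm_deriv hu
  exact congrArg (fun L ↦ L v) h

theorem mvfderiv_eq {F : Type*} [NormedAddCommGroup F] [NormedSpace ℝ F] {f : M → F}
    (hf : MDifferentiableAt (𝓡 m) 𝓘(ℝ, F) f x) (hx : x ∈ (ch m c).source)
    (v : TangentSpace (𝓡 m) x) :
    mvfderiv (𝓡 m) f x v = fderiv ℝ (fun u ↦ f ((ch m c).symm u)) (ch m c x) (toE c x v) := by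
  have h1 : f =ᶠ[𝓝 x] (fun u ↦ f ((ch m c).symm u)) ∘ ch m c := by
    filter_upwards [(ch m c).open_source.mem_nhds hx] with y hy
    simp [(ch m c).left_inv hy]
  have hs : MDifferentiableAt 𝓘(ℝ, EuclideanSpace ℝ (Fin m)) 𝓘(ℝ, F)
      (fun u ↦ f ((ch m c).symm u)) (ch m c x) := by
    refine MDifferentiableAt.comp (ch m c x) (g := f) (I' := 𝓡 m) ?_
      ((contMDiffAt_ch_symm ((ch m c).map_source hx)).mdifferentiableAt (by simp))
    rwa [(ch m c).left_inv hx]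
  have h2 : mfderiv (𝓡 m) 𝓘(ℝ, F) f x v =
      mfderiv 𝓘(ℝ, EuclideanSpace ℝ (Fin m)) 𝓘(ℝ, F) (fun u ↦ f ((ch m c).symm u)) (ch m c x)
        (mfderiv (𝓡 m) 𝓘(ℝ, EuclideanSpace ℝ (Fin m)) (ch m c) x v) := by
    rw [h1.mfderiv_eq, mfderiv_comp x hs ((contMDiffAt_ch hx).mdifferentiableAt (by simp))]
    rfl
  rw [← mfderiv_ch hx, ← mfderiv_eq_fderiv]
  exact h2

theorem toE_diff {φ : M → N} {d : N} (hφ : MDifferentiableAt (𝓡 m) (𝓡 n) φ x)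
    (hx : x ∈ (ch m c).source) (hd : φ x ∈ (ch n d).source) (v : TangentSpace (𝓡 m) x) :
    toE d (φ x) (diff φ x v) = fderiv ℝ (locMap m n c d φ) (ch m c x) (toE c x v) := by
  have hc : MDifferentiableAt (𝓡 n) 𝓘(ℝ, EuclideanSpace ℝ (Fin n)) (ch n d) (φ x) :=
    (contMDiffAt_ch hd).mdifferentiableAt (by simp)
  have h1 := mvfderiv_eq (f := fun y ↦ ch n d (φ y)) (hc.comp x hφ) hx v
  rw [← mfderiv_ch hd]
  refine Eq.trans ?_ h1
  have h2 := mfderiv_comp x hc hφ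
  exact (congrArg (fun L ↦ L v) h2).symm

end Charts

/-! ### The metric and the Levi-Civita connection in a chart -/

section ChartMetric


variable {m : ℕ}
  {M : Type*} [TopologicalSpace M] [ChartedSpace (EuclideanSpace ℝ (Fin m)) M]
  [IsManifold (𝓡 m) ∞ M] [RiemannianBundle (fun x : M ↦ TangentSpace (𝓡 m) x)]
  [IsContMDiffRiemannianBundle (𝓡 m) ∞ (EuclideanSpace ℝ (Fin m))
      (fun x : M ↦ TangentSpace (𝓡 m) x)]

/-- The metric in the chart at `c`. -/
def gloc (c : M) (u : EuclideanSpace ℝ (Fin m)) :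
    EuclideanSpace ℝ (Fin m) →L[ℝ] EuclideanSpace ℝ (Fin m) →L[ℝ] ℝ :=
  (innerSL ℝ (E := TangentSpace (𝓡 m) ((ch m c).symm u))).bilinearComp
    (ofE c ((ch m c).symm u)) (ofE c ((ch m c).symm u))

variable {c x : M}

theorem gloc_apply (u v w : EuclideanSpace ℝ (Fin m)) :
    gloc c u v w = inner ℝ (ofE c ((ch m c).symm u) v) (ofE c ((ch m c).symm u) w) := rfl

theorem gloc_toE (hx : x ∈ (ch m c).source) (v w : TangentSpace (𝓡 m) x) :
    gloc c (ch m c x) (toE c x v) (toE c x w) = inner ℝ v w := by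
  rw [gloc_apply]
  rw [(ch m c).left_inv hx, ofE_toE hx, ofE_toE hx]

theorem gloc_eq_inner (hx : x ∈ (ch m c).source) (v w : EuclideanSpace ℝ (Fin m)) :
    gloc c (ch m c x) v w = inner ℝ (ofE c x v) (ofE c x w) := by
  rw [← gloc_toE hx, toE_ofE hx, toE_ofE hx]

theorem smoothFieldAt_ofE (hx : x ∈ (ch m c).source) {Y : EuclideanSpace ℝ (Fin m) →
    EuclideanSpace ℝ (Fin m)} (hY : ContDiffAt ℝ ∞ Y (ch m c x)) :
    SmoothFieldAt (fun y ↦ ofE c y (Y (ch m c y))) x := by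
  rw [smoothFieldAt_iff hx]
  refine hY.congr_of_eventuallyEq ?_
  filter_upwards [(ch m c).open_target.mem_nhds ((ch m c).map_source hx)] with u hu
  rw [loc, toE_ofE ((ch m c).map_target hu), (ch m c).right_inv hu]

/-- The link to the coordinate theory. Smoothness may be tested on pairs of coordinate fields, whose
inner products are smooth because the bundle metric is. -/
theorem isMetricOn_gloc (c : M) : IsMetricOn (gloc (m := m) c) (ch m c).target where
  isOpen := (ch m c).open_target
  smooth := by
    intro u hu
    refine ContDiffAt.contDiffWithinAt ?_
    revert u
    suffices h : ∀ v w, ContDiffOn ℝ ∞ (fun u ↦ gloc (m := m) c u v w) (ch m c).target by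
      have : ContDiffOn ℝ ∞ (gloc (m := m) c) (ch m c).target := by
        rw [contDiffOn_clm_apply]
        intro v
        rw [contDiffOn_clm_apply]
        exact h v
      intro u hu
      exact this.contDiffAt ((ch m c).open_target.mem_nhds hu)
    intro v w u hu
    refine ContDiffAt.contDiffWithinAt ?_
    have hx := (ch m c).map_target hu
    have h1 := smoothFieldAt_ofE hx (Y := fun _ ↦ v) contDiffAt_const
    have h2 := smoothFieldAt_ofE hx (Y := fun _ ↦ w) contDiffAt_const
    have h3 := ContMDiffAt.inner_bundle h1 h2
    rw [contMDiffAt_iff_comp_symm le_rfl hx, (ch m c).right_inv hu] at h3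
    exact h3
  symm := fun u _ v w ↦ by rw [gloc_apply, gloc_apply, real_inner_comm]
  pos := by
    intro u hu v hv
    rw [gloc_apply, real_inner_self_eq_norm_sq]
    have hx := (ch m c).map_target hu
    have : ofE c ((ch m c).symm u) v ≠ 0 := by
      intro h
      apply hv
      rw [← toE_ofE hx v, h, map_zero]
    positivity

/-- The Christoffel symbols in the chart at `c`. -/
def chr (m : ℕ) {M : Type*} [TopologicalSpace M] [ChartedSpace (EuclideanSpace ℝ (Fin m)) M]
    [IsManifold (𝓡 m) ∞ M] [RiemannianBundle (fun x : M ↦ TangentSpace (𝓡 m) x)] (c : M) :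
    EuclideanSpace ℝ (Fin m) → EuclideanSpace ℝ (Fin m) →L[ℝ] EuclideanSpace ℝ (Fin m) →L[ℝ]
      EuclideanSpace ℝ (Fin m) :=
  christoffel (gloc c)

theorem derivInner_eq (hx : x ∈ (ch m c).source) {Y Z : VField m M} (hY : SmoothFieldAt Y x)
    (hZ : SmoothFieldAt Z x) (v : TangentSpace (𝓡 m) x) :
    derivInner Y Z x v =
      fderiv ℝ (fun u ↦ gloc c u (loc c Y u) (loc c Z u)) (ch m c x) (toE c x v) := by
  rw [derivInner, mvfderiv_eq ((ContMDiffAt.inner_bundle hY hZ).mdifferentiableAt (by simp)) hx]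
  congr 1
  apply Filter.EventuallyEq.fderiv_eq
  filter_upwards [(ch m c).open_target.mem_nhds ((ch m c).map_source hx)] with u hu
  have hx' := (ch m c).map_target hu
  have := gloc_toE hx' (Y ((ch m c).symm u)) (Z ((ch m c).symm u))
  rw [(ch m c).right_inv hu] at this
  exact this.symm

/-- The bracket commutes with pull-back by the inverse chart, and in the model space it is the usual
commutator of derivatives. -/
theorem toE_mlieBracket (hx : x ∈ (ch m c).source) {Y Z : VField m M} (hY : SmoothFieldAt Y x)
    (hZ : SmoothFieldAt Z x) :
    toE c x (VectorField.mlieBracket (𝓡 m) Y Z x) =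
      fderiv ℝ (loc c Z) (ch m c x) (loc c Y (ch m c x))
        - fderiv ℝ (loc c Y) (ch m c x) (loc c Z (ch m c x)) := by
  have hu := (ch m c).map_source hx
  have hp (Y : VField m M) {u : EuclideanSpace ℝ (Fin m)} (hu : u ∈ (ch m c).target) :
      VectorField.mpullback 𝓘(ℝ, EuclideanSpace ℝ (Fin m)) (𝓡 m) (ch m c).symm Y u = loc c Y u := by
    have hx' := (ch m c).map_target hu
    -- The pull-back involves the inverse of the derivative of the inverse chart; `toE` and `ofE`
    -- exhibit that derivative as an equivalence.
    let e : EuclideanSpace ℝ (Fin m) ≃L[ℝ] TangentSpace (𝓡 m) ((ch m c).symm u) :=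
      ContinuousLinearEquiv.equivOfInverse (ofE c _) (toE c _) (toE_ofE hx') (ofE_toE hx')
    have he : mfderiv 𝓘(ℝ, EuclideanSpace ℝ (Fin m)) (𝓡 m) (ch m c).symm u =
        (e : EuclideanSpace ℝ (Fin m) →L[ℝ] TangentSpace (𝓡 m) ((ch m c).symm u)) :=
      ContinuousLinearMap.ext fun v ↦ mfderiv_ch_symm hu v
    rw [VectorField.mpullback_apply, he]
    exact congrArg (fun L ↦ L (Y ((ch m c).symm u))) (ContinuousLinearMap.inverse_equiv e)
  have : IsManifold (𝓡 m) (minSmoothness ℝ 2) M :=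
    IsManifold.of_le (n := ∞) (by simpa using two_le_infty)
  have h1 := VectorField.mpullback_mlieBracket (I := 𝓘(ℝ, EuclideanSpace ℝ (Fin m))) (I' := 𝓡 m)
    (f := (ch m c).symm) (V := Y) (W := Z) (x₀ := ch m c x) (n := ∞)
    (by rw [(ch m c).left_inv hx]; exact ContMDiffAt.mdifferentiableAt hY (by simp))
    (by rw [(ch m c).left_inv hx]; exact ContMDiffAt.mdifferentiableAt hZ (by simp))
    (contMDiffAt_ch_symm hu) (by simp [two_le_infty])
  have hev (Y : VField m M) : VectorField.mpullback 𝓘(ℝ, EuclideanSpace ℝ (Fin m)) (𝓡 m)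
      (ch m c).symm Y =ᶠ[𝓝 (ch m c x)] loc c Y := by
    filter_upwards [(ch m c).open_target.mem_nhds hu] with u hu using hp Y hu
  have hE (V W : EuclideanSpace ℝ (Fin m) → EuclideanSpace ℝ (Fin m))
      (u : EuclideanSpace ℝ (Fin m)) :
      VectorField.mlieBracket 𝓘(ℝ, EuclideanSpace ℝ (Fin m)) V W u =
        fderiv ℝ W u (V u) - fderiv ℝ V u (W u) := by
    have := congrFun (VectorField.mlieBracketWithin_eq_lieBracketWithin (𝕜 := ℝ) (V := V) (W := W)
      (s := univ)) u
    exact (congrFun (VectorField.mlieBracketWithin_univ (I := 𝓘(ℝ, EuclideanSpace ℝ (Fin m)))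
      (V := V) (W := W)) u).symm.trans (this.trans
        (congrFun (VectorField.lieBracketWithin_univ (𝕜 := ℝ) (V := V) (W := W)) u))
  have h2 := (hp (VectorField.mlieBracket (𝓡 m) Y Z) hu).symm.trans h1
  rw [loc_apply hx] at h2
  exact h2.trans ((Filter.EventuallyEq.mlieBracket_vectorField_eq (hev Y) (hev Z)).trans
    (hE _ _ _))

/-- Metric compatibility splits the three derivatives into six terms, and torsion-freeness rewrites
the brackets as differences of covariant derivatives. All but two equal terms cancel. Only the
values of X and Z at x remain. -/
theorem koszul_eq (hx : x ∈ (ch m c).source) {X Y Z : VField m M} (hX : SmoothFieldAt X x)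
    (hY : SmoothFieldAt Y x) (hZ : SmoothFieldAt Z x) :
    koszul X Y Z x = 2 * gloc c (ch m c x)
      (covD (chr m c) id (loc c Y) (ch m c x) (toE c x (X x))) (toE c x (Z x)) := by
  have hu := (ch m c).map_source hx
  have hg := isMetricOn_gloc (m := m) c
  have d (Y : VField m M) (hY : SmoothFieldAt Y x) : DifferentiableAt ℝ (loc c Y) (ch m c x) :=
    ((smoothFieldAt_iff hx).1 hY).differentiableAt (by simp)
  have e (Y Z : VField m M) (hY : SmoothFieldAt Y x) (hZ : SmoothFieldAt Z x)
      (a : EuclideanSpace ℝ (Fin m)) :=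
    fderiv_metric_apply hg (F := id) (p := ch m c x) hu differentiableAt_id (d Y hY) (d Z hZ) a
  simp only [id] at e
  rw [koszul, derivInner_eq hx hY hZ, derivInner_eq hx hX hZ, derivInner_eq hx hX hY,
    e Y Z hY hZ, e X Z hX hZ, e X Y hX hY, ← gloc_toE hx, ← gloc_toE hx, ← gloc_toE hx,
    toE_mlieBracket hx hX hY, toE_mlieBracket hx hX hZ, toE_mlieBracket hx hY hZ]
  simp only [covD_id_apply, loc_apply hx, chr, map_sub, map_add, sub_apply, add_apply]
  have s := hg.symm _ hu
  have t := hg.christoffel_symm hu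
  rw [t (toE c x (X x)) (toE c x (Y x)), t (toE c x (X x)) (toE c x (Z x)),
    t (toE c x (Y x)) (toE c x (Z x)), s (toE c x (Y x)) (fderiv ℝ (loc c Z) _ _),
    s (toE c x (X x)) (fderiv ℝ (loc c Z) _ _), s (toE c x (X x)) (fderiv ℝ (loc c Y) _ _),
    s (toE c x (Y x)) (christoffel _ _ _ _), s (toE c x (X x)) (christoffel _ _ _ _)]
  ring

theorem smoothFieldAt_ext (hx : x ∈ (ch m c).source) (v : TangentSpace (𝓡 m) c) :
    SmoothFieldAt (ext v) x := by
  have hc : c ∈ (ch m c).source := mem_chart_source _ c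
  refine ContMDiffAt.congr_of_eventuallyEq
    (smoothFieldAt_ofE hx (Y := fun _ ↦ toE c c v) contDiffAt_const) ?_
  filter_upwards [(ch m c).open_source.mem_nhds hx] with y hy
  rw [ext, FiberBundle.extend, trivialization_snd hc, ofE,
    Bundle.Trivialization.symmL_apply _ (by simpa using hy)]

theorem ext_self (v : TangentSpace (𝓡 m) x) : (ext v : VField m M) x = v :=
  FiberBundle.extend_apply_self (EuclideanSpace ℝ (Fin m)) v

theorem loc_ext (hx : x ∈ (ch m c).source) (v : TangentSpace (𝓡 m) x) :
    loc c (ext v) (ch m c x) = toE c x v := by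
  rw [loc_apply hx, ext_self]

/-- The Levi-Civita connection in a chart. -/
theorem toE_nabla (hx : x ∈ (ch m c).source) {Y : VField m M} (hY : SmoothFieldAt Y x)
    (v : TangentSpace (𝓡 m) x) :
    toE c x (nabla Y x v) = covD (chr m c) id (loc c Y) (ch m c x) (toE c x v) := by
  set Z := covD (chr m c) id (loc c Y) (ch m c x) (toE c x v)
  have hs (v : TangentSpace (𝓡 m) x) : SmoothFieldAt (ext v) x :=
    smoothFieldAt_ext (mem_chart_source _ x) v
  have h1 : nabla Y x v = ofE c x Z := by
    rw [nabla, ← (onb x).sum_repr' (ofE c x Z)]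
    refine Finset.sum_congr rfl fun k _ ↦ ?_
    -- The coefficients of the coordinate expression in the orthonormal basis are the Koszul
    -- coefficients; the extensions enter only through their values at x.
    rw [koszul_eq hx (hs v) hY (hs _), ext_self, ext_self]
    congr 1
    rw [← gloc_toE hx, toE_ofE hx, (isMetricOn_gloc c).symm _ ((ch m c).map_source hx)]
    ring
  rw [h1, toE_ofE hx]

end ChartMetric

/-! ### The Ricci identity -/

section LocalBianchi

variable {E : Type*} [NormedAddCommGroup E] [NormedSpace ℝ E]

/-- The Ricci identity. -/
theorem covHom_covD_sub {Γ : E → E →L[ℝ] E →L[ℝ] E} {W : E → E} {p : E}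
    (hΓ : ContDiffAt ℝ ∞ Γ p) (hsymm : ∀ v w, Γ p v w = Γ p w v) (hW : ContDiffAt ℝ ∞ W p)
    (u v : E) :
    covHom Γ Γ id (covD Γ id W) p u v - covHom Γ Γ id (covD Γ id W) p v u =
      curvL Γ p u v (W p) := by
  have hS : DifferentiableAt ℝ (covD Γ id W) p :=
    (contDiffAt_covD (F := id) hΓ contDiffAt_id hW).differentiableAt (by simp)
  have hdΓ : DifferentiableAt ℝ Γ p := hΓ.differentiableAt (by simp)
  have hdW : DifferentiableAt ℝ W p := hW.differentiableAt (by simp)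
  have hdW2 : DifferentiableAt ℝ (fderiv ℝ W) p :=
    (hW.fderiv_right (m := ∞) (by simp)).differentiableAt (by simp)
  have h1 (a b : E) : fderiv ℝ (covD Γ id W) p a b =
      fderiv ℝ (fderiv ℝ W) p a b + fderiv ℝ Γ p a b (W p) + Γ p b (fderiv ℝ W p a) := by
    have e1 : fderiv ℝ (covD Γ id W) p a b = fderiv ℝ (fun q ↦ covD Γ id W q b) p a := by
      rw [fderiv_clm_apply hS (by fun_prop)]
      simp
    have e2 : (fun q ↦ covD Γ id W q b) = fun q ↦ fderiv ℝ W q b + Γ q b (W q) := by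
      ext q
      exact covD_id_apply Γ W q b
    rw [e1, e2, fderiv_fun_add (by fun_prop) (by fun_prop), add_apply,
      fderiv_clm_apply hdW2 (by fun_prop), fderiv_clm_apply (by fun_prop) hdW,
      fderiv_clm_apply hdΓ (by fun_prop)]
    simp
    abel
  -- In the skew part the second derivatives of W cancel by Schwarz, and the terms with Γ(u, v) by
  -- symmetry of Γ.
  rw [covHom_apply, covHom_apply, h1, h1, fderiv_symm_of_contDiffAt (hW.of_le two_le_infty) u v,
    curvL, hsymm v u]
  simp [covD_id_apply]
  abel

end LocalBianchi

/-! ### Pull-back connection, Hessians and curvature in charts -/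

section ChartConnection


variable {m n : ℕ}
  {M : Type*} [TopologicalSpace M] [ChartedSpace (EuclideanSpace ℝ (Fin m)) M]
  [IsManifold (𝓡 m) ∞ M] [RiemannianBundle (fun x : M ↦ TangentSpace (𝓡 m) x)]
  [IsContMDiffRiemannianBundle (𝓡 m) ∞ (EuclideanSpace ℝ (Fin m))
      (fun x : M ↦ TangentSpace (𝓡 m) x)]
  {N : Type*} [TopologicalSpace N] [ChartedSpace (EuclideanSpace ℝ (Fin n)) N]
  [IsManifold (𝓡 n) ∞ N] [RiemannianBundle (fun x : N ↦ TangentSpace (𝓡 n) x)]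
  [IsContMDiffRiemannianBundle (𝓡 n) ∞ (EuclideanSpace ℝ (Fin n))
      (fun x : N ↦ TangentSpace (𝓡 n) x)]
  {c x : M} {d : N} {φ : M → N} {σ : Along n φ} {Y : VField m M}

theorem contDiffAt_chr {u : EuclideanSpace ℝ (Fin m)} (hu : u ∈ (ch m c).target) :
    ContDiffAt ℝ ∞ (chr m c) u := (isMetricOn_gloc c).contDiffAt_christoffel hu

theorem chr_symm {u : EuclideanSpace ℝ (Fin m)} (hu : u ∈ (ch m c).target)
    (v w : EuclideanSpace ℝ (Fin m)) : chr m c u v w = chr m c u w v :=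
  (isMetricOn_gloc c).christoffel_symm hu v w

theorem contDiffAt_loc (hx : x ∈ (ch m c).source) (hY : SmoothFieldAt Y x) :
    ContDiffAt ℝ ∞ (loc c Y) (ch m c x) := (smoothFieldAt_iff hx).1 hY

theorem contDiffAt_locA (hφ : ContMDiffAt (𝓡 m) (𝓡 n) ∞ φ x) (hx : x ∈ (ch m c).source)
    (hd : φ x ∈ (ch n d).source) (hσ : SmoothAlongAt m φ σ x) :
    ContDiffAt ℝ ∞ (locA c d φ σ) (ch m c x) := (smoothAlongAt_iff hφ hx hd).1 hσ

/-- The change of frames from the chart at `e` to the chart at `d`. -/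
def frameChange (e d : N) (w : EuclideanSpace ℝ (Fin n)) :
    EuclideanSpace ℝ (Fin n) →L[ℝ] EuclideanSpace ℝ (Fin n) :=
  toE d ((ch n d).symm w) ∘L ofE e ((ch n d).symm w)

theorem frameChange_apply {e d y : N} (hd : y ∈ (ch n d).source)
    (w : EuclideanSpace ℝ (Fin n)) : frameChange e d (ch n d y) w = toE d y (ofE e y w) := by
  simp only [frameChange, ContinuousLinearMap.comp_apply]
  rw [(ch n d).left_inv hd]

theorem differentiableAt_frameChange {e d y : N} (he : y ∈ (ch n e).source)
    (hd : y ∈ (ch n d).source) : DifferentiableAt ℝ (frameChange e d) (ch n d y) := by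
  set U := (ch n d).target ∩ (ch n d).symm ⁻¹' (ch n e).source
  have hU : IsOpen U := (ch n d).isOpen_inter_preimage_symm (ch n e).open_source
  have hyU : ch n d y ∈ U := ⟨(ch n d).map_source hd, by simpa [(ch n d).left_inv hd] using he⟩
  have h : ContDiffOn ℝ ∞ (frameChange e d) U := by
    rw [contDiffOn_clm_apply]
    intro w u hu
    have h1 := smoothFieldAt_ofE hu.2 (Y := fun _ ↦ w) contDiffAt_const
    have h2 := contDiffAt_loc (c := d) ((ch n d).map_target hu.1) h1
    rw [(ch n d).right_inv hu.1] at h2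
    exact h2.contDiffWithinAt
  exact (h.contDiffAt (hU.mem_nhds hyU)).differentiableAt (by simp)

/-- The pull-back connection in charts. -/
theorem toE_nablaAlong (hφ : ContMDiffAt (𝓡 m) (𝓡 n) ∞ φ x) (hσ : SmoothAlongAt m φ σ x)
    (hx : x ∈ (ch m c).source) (hd : φ x ∈ (ch n d).source) (v : TangentSpace (𝓡 m) x) :
    toE d (φ x) (nablaAlong φ σ x v) =
      covD (chr n d) (locMap m n c d φ) (locA c d φ σ) (ch m c x) (toE c x v) := by
  have he : φ x ∈ (ch n (φ x)).source := mem_chart_source _ _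
  set κ : EuclideanSpace ℝ (Fin m) → EuclideanSpace ℝ (Fin n) := locA c (φ x) φ σ with hκ
  have hφc : ∀ᶠ y in 𝓝 x, φ y ∈ (ch n (φ x)).source ∧ φ y ∈ (ch n d).source :=
    (hφ.continuousAt.eventually ((ch n (φ x)).open_source.mem_nhds he)).and
      (hφ.continuousAt.eventually ((ch n d).open_source.mem_nhds hd))
  have hκd : DifferentiableAt ℝ κ (ch m c x) :=
    (contDiffAt_locA hφ hx he hσ).differentiableAt (by simp)
  have hF : DifferentiableAt ℝ (locMap m n c d φ) (ch m c x) :=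
    (contDiffAt_locMap hφ hx hd).differentiableAt (by simp)
  have hcomp : components φ σ (φ x) =ᶠ[𝓝 x] fun y ↦ toE (φ x) (φ y) (σ y) := by
    filter_upwards [hφc] with y hy using trivialization_snd hy.1 _
  -- the derivative of the components
  have h1 : mvfderiv (𝓡 m) (components φ σ (φ x)) x v = fderiv ℝ κ (ch m c x) (toE c x v) := by
    have hdiff : ContMDiffAt (𝓡 m) 𝓘(ℝ, EuclideanSpace ℝ (Fin n)) ∞ (components φ σ (φ x)) x := by
      refine ContMDiffAt.congr_of_eventuallyEq ?_ hcomp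
      rw [contMDiffAt_iff_comp_symm le_rfl hx]
      exact contDiffAt_locA hφ hx he hσ
    rw [mvfderiv_eq (hdiff.mdifferentiableAt (by simp)) hx]
    congr 1
    apply Filter.EventuallyEq.fderiv_eq
    filter_upwards [eventually_symm hx hcomp] with u hu using hu
  have hfr {w : EuclideanSpace ℝ (Fin n)} : toE d (φ x) (ofE (φ x) (φ x) w) =
      frameChange (φ x) d (ch n d (φ x)) w := (frameChange_apply hd w).symm
  have hfd := differentiableAt_frameChange he hd
  -- The definition uses the frame of the chart at φ x. Seen in the chart at d, both σ and the
  -- extension of σ x are the transition map applied to components. Its derivative appears on the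
  -- left through the extension and on the right through the product rule, so the result does not
  -- depend on the frame.
  have h2 : locA c d φ σ =ᶠ[𝓝 (ch m c x)]
      fun u ↦ frameChange (φ x) d (locMap m n c d φ u) (κ u) := by
    filter_upwards [eventually_symm hx hφc] with u hu
    change _ = frameChange (φ x) d (ch n d (φ ((ch m c).symm u))) (toE (φ x) _ _)
    rw [frameChange_apply hu.2, ofE_toE hu.1]
    rfl
  have h3 : loc d (ext (σ x)) =ᶠ[𝓝 (ch n d (φ x))]
      fun w ↦ frameChange (φ x) d w (toE (φ x) (φ x) (σ x)) := by
    have : ∀ᶠ y in 𝓝 (φ x), (ext (σ x) : VField n N) y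
        = ofE (φ x) y (toE (φ x) (φ x) (σ x)) := by
      filter_upwards [(ch n (φ x)).open_source.mem_nhds he] with y hy
      rw [ext, FiberBundle.extend, trivialization_snd he, ofE,
        Bundle.Trivialization.symmL_apply _ (by simpa using hy)]
    filter_upwards [eventually_symm hd this] with w hw
    rw [loc, hw]
    rfl
  have h4 : (trivializationAt (EuclideanSpace ℝ (Fin n)) (TangentSpace (𝓡 n)) (φ x)).symm (φ x)
      (mvfderiv (𝓡 m) (components φ σ (φ x)) x v) =
      ofE (φ x) (φ x) (fderiv ℝ κ (ch m c x) (toE c x v)) := by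
    rw [h1, ofE, Bundle.Trivialization.symmL_apply _ (by simp)]
  rw [nablaAlong, h4, map_add, hfr, toE_nabla hd (smoothFieldAt_ext he _),
    toE_diff (hφ.mdifferentiableAt (by simp)) hx hd]
  rw [covD_congr EventuallyEq.rfl h3, covD_congr EventuallyEq.rfl h2, covD_id_apply, covD_apply]
  have hl : locMap m n c d φ (ch m c x) = ch n d (φ x) := locMap_apply hx d φ
  have hκx : κ (ch m c x) = toE (φ x) (φ x) (σ x) := locA_apply hx _ _ _
  rw [← hl] at hfd
  rw [fderiv_clm_apply (c := fun u ↦ frameChange (φ x) d (locMap m n c d φ u)) (hfd.comp _ hF) hκd,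
    fderiv_fun_comp _ hfd hF, fderiv_clm_apply (by rw [← hl]; exact hfd)
      (differentiableAt_const _), hl, hκx]
  simp
  abel

theorem eventually_nhds_chart {p : M → Prop} (hx : x ∈ (ch m c).source) (h : ∀ᶠ y in 𝓝 x, p y) :
    ∀ᶠ u in 𝓝 (ch m c x), p ((ch m c).symm u) ∧ (ch m c).symm u ∈ (ch m c).source ∧
      ch m c ((ch m c).symm u) = u := by
  filter_upwards [eventually_symm hx h, (ch m c).open_target.mem_nhds ((ch m c).map_source hx)]
    with u hu hu' using ⟨hu, (ch m c).map_target hu', (ch m c).right_inv hu'⟩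

theorem loc_nablaField {X : VField m M} (hY : ∀ᶠ y in 𝓝 x, SmoothFieldAt Y y)
    (hx : x ∈ (ch m c).source) :
    loc c (nablaField X Y) =ᶠ[𝓝 (ch m c x)]
      fun u ↦ covD (chr m c) id (loc c Y) u (loc c X u) := by
  filter_upwards [eventually_nhds_chart hx hY] with u ⟨h1, h2, h3⟩
  rw [loc, nablaField, toE_nabla h2 h1, h3]
  rfl

theorem locA_nablaAlongField {X : VField m M} (hφ : ContMDiff (𝓡 m) (𝓡 n) ∞ φ)
    (hσ : ∀ᶠ y in 𝓝 x, SmoothAlongAt m φ σ y) (hx : x ∈ (ch m c).source)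
    (hd : φ x ∈ (ch n d).source) :
    locA c d φ (nablaAlongField φ X σ) =ᶠ[𝓝 (ch m c x)]
      fun u ↦ covD (chr n d) (locMap m n c d φ) (locA c d φ σ) u (loc c X u) := by
  have h0 : ∀ᶠ y in 𝓝 x, φ y ∈ (ch n d).source :=
    hφ.continuous.continuousAt.eventually ((ch n d).open_source.mem_nhds hd)
  filter_upwards [eventually_nhds_chart hx (hσ.and h0)] with u ⟨h1, h2, h3⟩
  rw [locA, nablaAlongField, toE_nablaAlong hφ.contMDiffAt h1.1 h2 h1.2, h3]
  rfl

theorem locA_diff (hφ : ContMDiff (𝓡 m) (𝓡 n) ∞ φ) (hx : x ∈ (ch m c).source)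
    (hd : φ x ∈ (ch n d).source) (Y : VField m M) :
    locA c d φ (fun y ↦ diff φ y (Y y)) =ᶠ[𝓝 (ch m c x)]
      fun u ↦ fderiv ℝ (locMap m n c d φ) u (loc c Y u) := by
  have h0 : ∀ᶠ y in 𝓝 x, φ y ∈ (ch n d).source :=
    hφ.continuous.continuousAt.eventually ((ch n d).open_source.mem_nhds hd)
  filter_upwards [eventually_nhds_chart hx h0] with u ⟨h1, h2, h3⟩
  rw [locA, toE_diff (hφ.contMDiffAt.mdifferentiableAt (by simp)) h2 h1, h3]
  rfl

theorem locA_comp (c : M) (φ : M → N) (hx : x ∈ (ch m c).source) (hφ : ContinuousAt φ x)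
    (hd : φ x ∈ (ch n d).source) (T : VField n N) :
    locA c d φ (fun y ↦ T (φ y)) =ᶠ[𝓝 (ch m c x)] fun u ↦ loc d T (locMap m n c d φ u) := by
  have h0 : ∀ᶠ y in 𝓝 x, φ y ∈ (ch n d).source :=
    hφ.eventually ((ch n d).open_source.mem_nhds hd)
  filter_upwards [eventually_symm hx h0] with u hu
  simp only [locA, loc, locMap]
  rw [(ch n d).left_inv hu]
  rfl

theorem SmoothFieldAt.nablaField {X : VField m M} (hX : SmoothFieldAt X x)
    (hY : ∀ᶠ y in 𝓝 x, SmoothFieldAt Y y) : SmoothFieldAt (nablaField X Y) x := by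
  have hx : x ∈ (ch m x).source := mem_chart_source _ _
  rw [smoothFieldAt_iff hx]
  refine ContDiffAt.congr_of_eventuallyEq ?_ (loc_nablaField hY hx)
  exact (contDiffAt_covD (F := id) (contDiffAt_chr ((ch m x).map_source hx)) contDiffAt_id
    (contDiffAt_loc hx hY.self_of_nhds)).clm_apply (contDiffAt_loc hx hX)

theorem SmoothAlongAt.nablaAlongField {X : VField m M} (hφ : ContMDiff (𝓡 m) (𝓡 n) ∞ φ)
    (hX : SmoothFieldAt X x) (hσ : ∀ᶠ y in 𝓝 x, SmoothAlongAt m φ σ y) :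
    SmoothAlongAt m φ (nablaAlongField φ X σ) x := by
  have hx : x ∈ (ch m x).source := mem_chart_source _ _
  have hd : φ x ∈ (ch n (φ x)).source := mem_chart_source _ _
  rw [smoothAlongAt_iff hφ.contMDiffAt hx hd]
  refine ContDiffAt.congr_of_eventuallyEq ?_ (locA_nablaAlongField hφ hσ hx hd)
  refine (contDiffAt_covD ?_ (contDiffAt_locMap hφ.contMDiffAt hx hd)
    (contDiffAt_locA hφ.contMDiffAt hx hd hσ.self_of_nhds)).clm_apply (contDiffAt_loc hx hX)
  rw [locMap_apply hx]
  exact contDiffAt_chr ((ch n _).map_source hd)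

theorem smoothAlongAt_diff (hφ : ContMDiff (𝓡 m) (𝓡 n) ∞ φ) (hY : SmoothFieldAt Y x) :
    SmoothAlongAt m φ (fun y ↦ diff (m := m) (n := n) φ y (Y y)) x := by
  have hx : x ∈ (ch m x).source := mem_chart_source _ _
  have hd : φ x ∈ (ch n (φ x)).source := mem_chart_source _ _
  rw [smoothAlongAt_iff hφ.contMDiffAt hx hd]
  refine ContDiffAt.congr_of_eventuallyEq ?_ (locA_diff hφ hx hd Y)
  exact ((contDiffAt_locMap hφ.contMDiffAt hx hd).fderiv_right (by simp)).clm_apply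
    (contDiffAt_loc hx hY)

theorem SmoothFieldAt.comp {T : VField n N} (hφ : ContMDiffAt (𝓡 m) (𝓡 n) ∞ φ x)
    (hT : SmoothFieldAt T (φ x)) : SmoothAlongAt m φ (fun y ↦ T (φ y)) x :=
  ContMDiffAt.comp x hT hφ

/-- The second fundamental form in charts. -/
theorem toE_sff (hφ : ContMDiff (𝓡 m) (𝓡 n) ∞ φ) (hY : SmoothFieldAt Y x)
    (hx : x ∈ (ch m c).source) (hd : φ x ∈ (ch n d).source) (v : TangentSpace (𝓡 m) x) :
    toE d (φ x) (nablaAlong φ (fun y ↦ diff φ y (Y y)) x v - diff φ x (nabla Y x v)) =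
      covHom (chr m c) (chr n d) (locMap m n c d φ) (fderiv ℝ (locMap m n c d φ)) (ch m c x)
        (toE c x v) (toE c x (Y x)) := by
  have hF := contDiffAt_locMap hφ.contMDiffAt hx hd
  rw [map_sub, toE_nablaAlong hφ.contMDiffAt (smoothAlongAt_diff hφ hY) hx hd,
    toE_diff (hφ.contMDiffAt.mdifferentiableAt (by simp)) hx hd, toE_nabla hx hY,
    covD_congr EventuallyEq.rfl (locA_diff hφ hx hd Y), ← loc_apply hx Y]
  exact covD_clm_apply ((hF.fderiv_right (m := ∞) (by simp)).differentiableAt (by simp))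
    ((contDiffAt_loc hx hY).differentiableAt (by simp)) _

/-- The Hessian of a section along a map in charts. -/
theorem toE_hessAlong (hφ : ContMDiff (𝓡 m) (𝓡 n) ∞ φ) (hY : SmoothFieldAt Y x)
    (hσ : ∀ᶠ y in 𝓝 x, SmoothAlongAt m φ σ y)
    (hx : x ∈ (ch m c).source) (hd : φ x ∈ (ch n d).source) (v : TangentSpace (𝓡 m) x) :
    toE d (φ x) (nablaAlong φ (nablaAlongField φ Y σ) x v - nablaAlong φ σ x (nabla Y x v)) =
      covHom (chr m c) (chr n d) (locMap m n c d φ)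
        (covD (chr n d) (locMap m n c d φ) (locA c d φ σ)) (ch m c x)
        (toE c x v) (toE c x (Y x)) := by
  have hF := contDiffAt_locMap hφ.contMDiffAt hx hd
  rw [map_sub, toE_nablaAlong hφ.contMDiffAt (SmoothAlongAt.nablaAlongField hφ hY hσ) hx hd,
    toE_nablaAlong hφ.contMDiffAt hσ.self_of_nhds hx hd, toE_nabla hx hY,
    covD_congr EventuallyEq.rfl (locA_nablaAlongField hφ hσ hx hd), ← loc_apply hx Y]
  refine covD_clm_apply (ContDiffAt.differentiableAt (n := ∞) (contDiffAt_covD ?_ hF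
    (contDiffAt_locA hφ.contMDiffAt hx hd hσ.self_of_nhds)) (by simp))
    ((contDiffAt_loc hx hY).differentiableAt (by simp)) _
  rw [locMap_apply hx]
  exact contDiffAt_chr ((ch n _).map_source hd)

/-- The Hessian of a vector field in a chart. -/
theorem toE_hessField {T : VField m M} (hY : SmoothFieldAt Y x)
    (hT : ∀ᶠ y in 𝓝 x, SmoothFieldAt T y) (hx : x ∈ (ch m c).source)
    (v : TangentSpace (𝓡 m) x) :
    toE c x (nabla (nablaField Y T) x v - nabla T x (nabla Y x v)) =
      covHom (chr m c) (chr m c) id (covD (chr m c) id (loc c T)) (ch m c x)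
        (toE c x v) (toE c x (Y x)) := by
  rw [map_sub, toE_nabla hx (SmoothFieldAt.nablaField hY hT), toE_nabla hx hT.self_of_nhds,
    toE_nabla hx hY, covD_congr EventuallyEq.rfl (loc_nablaField hT hx), ← loc_apply hx Y]
  exact covD_clm_apply (ContDiffAt.differentiableAt (n := ∞) (contDiffAt_covD (F := id)
    (contDiffAt_chr ((ch m c).map_source hx)) contDiffAt_id (contDiffAt_loc hx hT.self_of_nhds))
    (by simp)) ((contDiffAt_loc hx hY).differentiableAt (by simp)) _

theorem eventually_smoothFieldAt_ext (v : TangentSpace (𝓡 m) x) :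
    ∀ᶠ y in 𝓝 x, SmoothFieldAt (ext v) y := by
  filter_upwards [(ch m x).open_source.mem_nhds (mem_chart_source _ x)] with y hy
    using smoothFieldAt_ext hy v

/-- The curvature in a chart. -/
theorem toE_curvature (hx : x ∈ (ch m c).source) (u v w : TangentSpace (𝓡 m) x) :
    toE c x (curvature x u v w) =
      curvL (chr m c) (ch m c x) (toE c x u) (toE c x v) (toE c x w) := by
  have hp := (ch m c).map_source hx
  have hs (v : TangentSpace (𝓡 m) x) : SmoothFieldAt (ext v) x :=
    (eventually_smoothFieldAt_ext v).self_of_nhds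
  have e1 := toE_hessField (hs v) (eventually_smoothFieldAt_ext w) hx u
  have e2 := toE_hessField (hs u) (eventually_smoothFieldAt_ext w) hx v
  have h1 := covHom_covD_sub (contDiffAt_chr hp) (chr_symm hp) (contDiffAt_loc hx (hs w))
    (toE c x u) (toE c x v)
  rw [ext_self] at e1 e2
  rw [loc_ext hx] at h1
  rw [← h1, ← e1, ← e2]
  -- Torsion-freeness, [U, V] = ∇_U V - ∇_V U, turns the definition of the curvature into the skew
  -- part of a second covariant derivative, to which the Ricci identity applies.
  have hb : toE c x (VectorField.mlieBracket (𝓡 m) (ext u) (ext v) x) =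
      toE c x (nabla (ext v) x u) - toE c x (nabla (ext u) x v) := by
    rw [toE_mlieBracket hx (hs u) (hs v), toE_nabla hx (hs v), toE_nabla hx (hs u),
      covD_id_apply, covD_id_apply, loc_ext hx, loc_ext hx, chr_symm hp]
    abel
  have hb' : nabla (ext w) x (VectorField.mlieBracket (𝓡 m) (ext u) (ext v) x) =
      nabla (ext w) x (nabla (ext v) x u) - nabla (ext w) x (nabla (ext u) x v) := by
    apply toE_injective hx
    rw [map_sub, toE_nabla hx (hs w), toE_nabla hx (hs w), toE_nabla hx (hs w), hb, map_sub]
  rw [curvature, hb']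
  simp only [map_sub]
  abel

end ChartConnection

/-! ### Expansion in orthonormal families and invariance of traces -/

section Parseval

variable {V W : Type*} [NormedAddCommGroup V] [InnerProductSpace ℝ V]
  [NormedAddCommGroup W] [InnerProductSpace ℝ W]
  {ι κ : Type*} [Fintype ι] [Fintype κ]

/-- A finite family for which the expansion of an orthonormal basis holds. -/
def IsParseval (e : ι → V) : Prop := ∀ w, ∑ k, (inner ℝ (e k) w : ℝ) • e k = w

theorem _root_.OrthonormalBasis.isParseval (b : OrthonormalBasis ι ℝ V) : IsParseval b :=
  fun w ↦ b.sum_repr' w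

/-- The trace of a bilinear map does not depend on the basis. -/
theorem IsParseval.sum_eq {X : Type*} [AddCommGroup X] [Module ℝ X] {e : ι → V} {f : κ → V}
    (he : IsParseval e) (hf : IsParseval f) (B : V →ₗ[ℝ] V →ₗ[ℝ] X) :
    ∑ k, B (e k) (e k) = ∑ j, B (f j) (f j) := by
  have h1 (k : ι) : B (e k) (e k) = ∑ j, (inner ℝ (f j) (e k) : ℝ) • B (e k) (f j) := by
    have := congrArg (B (e k)) (hf (e k))
    simpa using this.symm
  have h2 (j : κ) : B (f j) (f j) = ∑ k, (inner ℝ (e k) (f j) : ℝ) • B (e k) (f j) := by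
    have := congrArg (fun v ↦ B v (f j)) (he (f j))
    simpa using this.symm
  simp only [h1, h2]
  rw [Finset.sum_comm]
  simp only [real_inner_comm]

end Parseval

/-! ### Tensoriality of the invariants and composition formulas -/

section Invariants

variable {m n : ℕ}
  {M : Type*} [TopologicalSpace M] [ChartedSpace (EuclideanSpace ℝ (Fin m)) M]
  [IsManifold (𝓡 m) ∞ M] [RiemannianBundle (fun x : M ↦ TangentSpace (𝓡 m) x)]
  [IsContMDiffRiemannianBundle (𝓡 m) ∞ (EuclideanSpace ℝ (Fin m))
      (fun x : M ↦ TangentSpace (𝓡 m) x)]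
  {N : Type*} [TopologicalSpace N] [ChartedSpace (EuclideanSpace ℝ (Fin n)) N]
  [IsManifold (𝓡 n) ∞ N] [RiemannianBundle (fun x : N ↦ TangentSpace (𝓡 n) x)]
  [IsContMDiffRiemannianBundle (𝓡 n) ∞ (EuclideanSpace ℝ (Fin n))
      (fun x : N ↦ TangentSpace (𝓡 n) x)]
  {c x : M} {d : N} {φ : M → N} {σ : Along n φ} {Y : VField m M}

theorem isParseval_onb (x : M) : IsParseval (onb (m := m) x) := (onb x).isParseval

/-- A map between tangent spaces which is bilinear in charts is bilinear. -/
theorem exists_bilin {y : N} (hd : y ∈ (ch n d).source)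
    {b : TangentSpace (𝓡 m) x → TangentSpace (𝓡 m) x → TangentSpace (𝓡 n) y}
    {B : EuclideanSpace ℝ (Fin m) →L[ℝ] EuclideanSpace ℝ (Fin m) →L[ℝ] EuclideanSpace ℝ (Fin n)}
    (h : ∀ v w, toE d y (b v w) = B (toE c x v) (toE c x w)) :
    ∃ B' : TangentSpace (𝓡 m) x →ₗ[ℝ] TangentSpace (𝓡 m) x →ₗ[ℝ] TangentSpace (𝓡 n) y,
      ∀ v w, b v w = B' v w := by
  refine ⟨LinearMap.mk₂ ℝ b ?_ ?_ ?_ ?_, fun v w ↦ rfl⟩ <;> intros <;>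
    apply toE_injective hd <;> simp [h]

theorem mem_ch_source (x : M) : x ∈ (ch m x).source := mem_chart_source _ _

theorem toE_secondFundamentalForm (hφ : ContMDiff (𝓡 m) (𝓡 n) ∞ φ)
    (hx : x ∈ (ch m c).source) (hd : φ x ∈ (ch n d).source) (v w : TangentSpace (𝓡 m) x) :
    toE d (φ x) (secondFundamentalForm φ x v w) =
      covHom (chr m c) (chr n d) (locMap m n c d φ) (fderiv ℝ (locMap m n c d φ)) (ch m c x)
        (toE c x v) (toE c x w) := by
  have := toE_sff hφ (eventually_smoothFieldAt_ext w).self_of_nhds hx hd v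
  rwa [ext_self] at this

/-- Tensoriality: the standard extension may be replaced by any smooth field with the same value, in
particular by a vertical or a horizontal one. -/
theorem sff_eq (hφ : ContMDiff (𝓡 m) (𝓡 n) ∞ φ) (hY : SmoothFieldAt Y x)
    (v : TangentSpace (𝓡 m) x) :
    nablaAlong φ (fun y ↦ diff (m := m) (n := n) φ y (Y y)) x v - diff φ x (nabla Y x v) =
      secondFundamentalForm φ x v (Y x) := by
  apply toE_injective (mem_ch_source (φ x))
  rw [toE_sff hφ hY (mem_ch_source x) (mem_ch_source _),
    toE_secondFundamentalForm hφ (mem_ch_source x) (mem_ch_source _)]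

theorem exists_bilin_sff (hφ : ContMDiff (𝓡 m) (𝓡 n) ∞ φ) (x : M) :
    ∃ B : TangentSpace (𝓡 m) x →ₗ[ℝ] TangentSpace (𝓡 m) x →ₗ[ℝ] TangentSpace (𝓡 n) (φ x),
      ∀ v w, secondFundamentalForm φ x v w = B v w :=
  exists_bilin (mem_ch_source _)
    (toE_secondFundamentalForm hφ (mem_ch_source x) (mem_ch_source _))

/-- The second covariant derivative of a section along a map. -/
def hessAlong (φ : M → N) (σ : Along n φ) (x : M) (v w : TangentSpace (𝓡 m) x) :
    TangentSpace (𝓡 n) (φ x) :=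
  nablaAlong φ (nablaAlongField φ (ext w) σ) x v - nablaAlong φ σ x (nabla (ext w) x v)

/-- The second covariant derivative of a vector field. -/
def hessField (T : VField m M) (x : M) (v w : TangentSpace (𝓡 m) x) : TangentSpace (𝓡 m) x :=
  nabla (nablaField (ext w) T) x v - nabla T x (nabla (ext w) x v)

theorem toE_hessAlong_apply (hφ : ContMDiff (𝓡 m) (𝓡 n) ∞ φ)
    (hσ : ∀ᶠ y in 𝓝 x, SmoothAlongAt m φ σ y)
    (hx : x ∈ (ch m c).source) (hd : φ x ∈ (ch n d).source) (v w : TangentSpace (𝓡 m) x) :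
    toE d (φ x) (hessAlong φ σ x v w) =
      covHom (chr m c) (chr n d) (locMap m n c d φ)
        (covD (chr n d) (locMap m n c d φ) (locA c d φ σ)) (ch m c x)
        (toE c x v) (toE c x w) := by
  have := toE_hessAlong hφ (eventually_smoothFieldAt_ext w).self_of_nhds hσ hx hd v
  rwa [ext_self] at this

theorem hessAlong_eq (hφ : ContMDiff (𝓡 m) (𝓡 n) ∞ φ) (hY : SmoothFieldAt Y x)
    (hσ : ∀ᶠ y in 𝓝 x, SmoothAlongAt m φ σ y) (v : TangentSpace (𝓡 m) x) :
    nablaAlong φ (nablaAlongField φ Y σ) x v - nablaAlong φ σ x (nabla Y x v) =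
      hessAlong φ σ x v (Y x) := by
  apply toE_injective (mem_ch_source (φ x))
  rw [toE_hessAlong hφ hY hσ (mem_ch_source x) (mem_ch_source _),
    toE_hessAlong_apply hφ hσ (mem_ch_source x) (mem_ch_source _)]

theorem toE_hessField_apply {T : VField m M} (hT : ∀ᶠ y in 𝓝 x, SmoothFieldAt T y)
    (hx : x ∈ (ch m c).source) (v w : TangentSpace (𝓡 m) x) :
    toE c x (hessField T x v w) =
      covHom (chr m c) (chr m c) id (covD (chr m c) id (loc c T)) (ch m c x)
        (toE c x v) (toE c x w) := by
  have := toE_hessField (eventually_smoothFieldAt_ext w).self_of_nhds hT hx v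
  rwa [ext_self] at this

theorem exists_bilin_hessField {T : VField m M} (hT : ∀ᶠ y in 𝓝 x, SmoothFieldAt T y) :
    ∃ B : TangentSpace (𝓡 m) x →ₗ[ℝ] TangentSpace (𝓡 m) x →ₗ[ℝ] TangentSpace (𝓡 m) x,
      ∀ v w, hessField T x v w = B v w :=
  exists_bilin (mem_ch_source _) (toE_hessField_apply hT (mem_ch_source x))

theorem traceHessian_eq_sum {ι : Type*} [Fintype ι] {T : VField m M}
    (hT : ∀ᶠ y in 𝓝 x, SmoothFieldAt T y) {e : ι → TangentSpace (𝓡 m) x} (he : IsParseval e) :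
    traceHessian T x = ∑ i, hessField T x (e i) (e i) := by
  obtain ⟨B, hB⟩ := exists_bilin_hessField hT
  simp only [hB]
  rw [← (isParseval_onb x).sum_eq he B]
  exact Finset.sum_congr rfl fun k _ ↦ hB _ _

theorem exists_bilin_curvature (v : TangentSpace (𝓡 m) x) :
    ∃ B : TangentSpace (𝓡 m) x →ₗ[ℝ] TangentSpace (𝓡 m) x →ₗ[ℝ] TangentSpace (𝓡 m) x,
      ∀ a b, curvature x v a b = B a b := by
  have hc (a b) := toE_curvature (mem_ch_source x) v a b
  refine ⟨LinearMap.mk₂ ℝ (curvature x v) ?_ ?_ ?_ ?_, fun v w ↦ rfl⟩ <;> intros <;>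
    apply toE_injective (mem_ch_source x) <;> simp [hc, curvL, smul_sub, smul_add] <;> abel

theorem curvature_antisymm (u v w : TangentSpace (𝓡 m) x) :
    curvature x u v w = - curvature x v u w := by
  apply toE_injective (mem_ch_source x)
  rw [map_neg, toE_curvature (mem_ch_source x), toE_curvature (mem_ch_source x)]
  simp only [curvL]
  abel

theorem ricci_eq_sum {ι : Type*} [Fintype ι] {e : ι → TangentSpace (𝓡 m) x} (he : IsParseval e)
    (v : TangentSpace (𝓡 m) x) : ricci x v = ∑ i, curvature x v (e i) (e i) := by
  obtain ⟨B, hB⟩ := exists_bilin_curvature v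
  simp only [hB]
  rw [← (isParseval_onb x).sum_eq he B]
  exact Finset.sum_congr rfl fun k _ ↦ hB _ _

/-- Traces of bilinear maps do not depend on the family, which allows bases adapted to the vertical
and horizontal spaces. -/
theorem tension_eq_sum {ι : Type*} [Fintype ι] (hφ : ContMDiff (𝓡 m) (𝓡 n) ∞ φ)
    {e : ι → TangentSpace (𝓡 m) x} (he : IsParseval e) :
    tension (m := m) (n := n) φ x = ∑ i, secondFundamentalForm (n := n) φ x (e i) (e i) := by
  obtain ⟨B, hB⟩ := exists_bilin_sff hφ x
  simp only [hB]
  rw [← (isParseval_onb x).sum_eq he B]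
  exact Finset.sum_congr rfl fun k _ ↦ hB _ _

theorem nablaAlong_comp {T : VField n N} (hφ : ContMDiff (𝓡 m) (𝓡 n) ∞ φ)
    (hT : SmoothFieldAt T (φ x)) (v : TangentSpace (𝓡 m) x) :
    nablaAlong φ (fun y ↦ T (φ y)) x v = nabla T (φ x) (diff φ x v) := by
  have hx := mem_ch_source (m := m) x
  have hd := mem_ch_source (m := n) (φ x)
  have hT' := contDiffAt_loc hd hT
  rw [← locMap_apply hx] at hT'
  apply toE_injective hd
  rw [toE_nablaAlong hφ.contMDiffAt (SmoothFieldAt.comp hφ.contMDiffAt hT) hx hd,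
    covD_congr EventuallyEq.rfl (locA_comp x φ hx hφ.continuous.continuousAt hd T),
    toE_nabla hd hT, toE_diff (hφ.mdifferentiableAt (by simp)) hx hd,
    covD_comp_id ((contDiffAt_locMap hφ.contMDiffAt hx hd).differentiableAt (by simp))
      (hT'.differentiableAt (by simp)), locMap_apply hx]

/-- The second derivative of a composite. Under the trace, the last term becomes ∇T applied to the
tension field, the source of ∇_T T in the biharmonic equation. -/
theorem hessAlong_comp {T : VField n N} (hφ : ContMDiff (𝓡 m) (𝓡 n) ∞ φ)
    (hT : ∀ᶠ q in 𝓝 (φ x), SmoothFieldAt T q) (v w : TangentSpace (𝓡 m) x) :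
    hessAlong φ (fun y ↦ T (φ y)) x v w = hessField T (φ x) (diff φ x v) (diff φ x w)
      + nabla T (φ x) (secondFundamentalForm φ x v w) := by
  have hx := mem_ch_source (m := m) x
  have hd := mem_ch_source (m := n) (φ x)
  have hT' := contDiffAt_loc hd hT.self_of_nhds
  have hΓ : ContDiffAt ℝ ∞ (chr n (φ x)) (ch n (φ x) (φ x)) :=
    contDiffAt_chr ((ch n (φ x)).map_source hd)
  rw [← locMap_apply hx] at hT' hΓ
  have hm := hφ.mdifferentiableAt (x := x) (by simp)
  have hs : ∀ᶠ y in 𝓝 x, SmoothAlongAt m φ (fun y ↦ T (φ y)) y := by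
    filter_upwards [hφ.continuous.continuousAt.eventually hT] with y hy
      using SmoothFieldAt.comp hφ.contMDiffAt hy
  apply toE_injective hd
  have hloc : covD (chr n (φ x)) (locMap m n x (φ x) φ) (locA x (φ x) φ fun y ↦ T (φ y))
      =ᶠ[𝓝 (ch m x x)] covD (chr n (φ x)) (locMap m n x (φ x) φ)
        (fun u ↦ loc (φ x) T (locMap m n x (φ x) φ u)) := by
    filter_upwards [(locA_comp x φ hx hφ.continuous.continuousAt hd T).eventually_nhds] with u hu
    exact covD_congr EventuallyEq.rfl hu
  rw [toE_hessAlong_apply hφ hs hx hd, map_add, toE_hessField_apply hT hd,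
    toE_diff hm hx hd, toE_diff hm hx hd, toE_nabla hd hT.self_of_nhds,
    toE_secondFundamentalForm hφ hx hd, covHom_congr EventuallyEq.rfl hloc,
    covHom_covD_comp hΓ (contDiffAt_locMap hφ.contMDiffAt hx hd) hT', locMap_apply hx]

theorem nablaAlong_congr {σ' : Along n φ} (h : σ =ᶠ[𝓝 x] σ') (v : TangentSpace (𝓡 m) x) :
    nablaAlong φ σ x v = nablaAlong φ σ' x v := by
  have h1 : components φ σ (φ x) =ᶠ[𝓝 x] components φ σ' (φ x) := by
    filter_upwards [h] with y hy
    rw [components, components, hy]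
  rw [nablaAlong, nablaAlong, h.self_of_nhds, mvfderiv, mvfderiv, h1.mfderiv_eq,
    h1.self_of_nhds]

theorem nabla_add_apply (hY : SmoothFieldAt Y x) (v w : TangentSpace (𝓡 m) x) :
    nabla Y x (v + w) = nabla Y x v + nabla Y x w := by
  apply toE_injective (mem_ch_source x)
  simp [toE_nabla (mem_ch_source x) hY]

theorem nabla_smul_apply (hY : SmoothFieldAt Y x) (a : ℝ) (v : TangentSpace (𝓡 m) x) :
    nabla Y x (a • v) = a • nabla Y x v := by
  apply toE_injective (mem_ch_source x)
  simp [toE_nabla (mem_ch_source x) hY]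

theorem loc_smul (a : ℝ) (Y : VField m M) : loc c (fun y ↦ a • Y y) = fun u ↦ a • loc c Y u := by
  ext1 u
  simp [loc]

theorem SmoothFieldAt.smul (hY : SmoothFieldAt Y x) (a : ℝ) :
    SmoothFieldAt (fun y ↦ a • Y y) x := by
  rw [smoothFieldAt_iff (mem_ch_source x)] at hY ⊢
  rw [loc_smul]
  exact hY.const_smul a

theorem covD_id_smul {E : Type*} [NormedAddCommGroup E] [NormedSpace ℝ E]
    {Γ : E → E →L[ℝ] E →L[ℝ] E} {T : E → E} {u : E} (hT : DifferentiableAt ℝ T u) (a : ℝ) :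
    covD Γ id (fun q ↦ a • T q) u = a • covD Γ id T u := by
  ext1 v
  simp [covD_id_apply, fderiv_fun_const_smul hT]

theorem nabla_smul (hY : SmoothFieldAt Y x) (a : ℝ) (v : TangentSpace (𝓡 m) x) :
    nabla (fun y ↦ a • Y y) x v = a • nabla Y x v := by
  have hx := mem_ch_source (m := m) x
  apply toE_injective hx
  rw [toE_nabla hx (hY.smul a), map_smul, toE_nabla hx hY, loc_smul,
    covD_id_smul ((contDiffAt_loc hx hY).differentiableAt (by simp))]
  rfl

theorem nabla_congr {Y' : VField m M} (hY : SmoothFieldAt Y x) (h : Y =ᶠ[𝓝 x] Y')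
    (v : TangentSpace (𝓡 m) x) : nabla Y x v = nabla Y' x v := by
  have hx := mem_ch_source (m := m) x
  have hl : loc x Y =ᶠ[𝓝 (ch m x x)] loc x Y' := by
    filter_upwards [eventually_symm hx h] with u hu
    rw [loc, loc, hu]
  have hY' : SmoothFieldAt Y' x := by
    rw [smoothFieldAt_iff hx] at hY ⊢
    exact hY.congr_of_eventuallyEq hl.symm
  apply toE_injective hx
  rw [toE_nabla hx hY, toE_nabla hx hY', covD_congr EventuallyEq.rfl hl]

theorem hessField_smul {T : VField m M} (hT : ∀ᶠ y in 𝓝 x, SmoothFieldAt T y) (a : ℝ)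
    (v w : TangentSpace (𝓡 m) x) :
    hessField (fun y ↦ a • T y) x v w = a • hessField T x v w := by
  have hw : SmoothFieldAt (ext w) x := (eventually_smoothFieldAt_ext w).self_of_nhds
  have h1 : nablaField (ext w) (fun y ↦ a • T y) =ᶠ[𝓝 x] fun y ↦ a • nablaField (ext w) T y := by
    filter_upwards [hT] with y hy using nabla_smul hy _ _
  have h2 : ∀ᶠ y in 𝓝 x, SmoothFieldAt (fun y ↦ a • T y) y := by
    filter_upwards [hT] with y hy using hy.smul a
  rw [hessField, hessField, nabla_congr (SmoothFieldAt.nablaField hw h2) h1,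
    nabla_smul (SmoothFieldAt.nablaField hw hT), nabla_smul hT.self_of_nhds, smul_sub]

theorem traceHessian_smul {T : VField m M} (hT : ∀ᶠ y in 𝓝 x, SmoothFieldAt T y) (a : ℝ) :
    traceHessian (fun y ↦ a • T y) x = a • traceHessian T x := by
  have h2 : ∀ᶠ y in 𝓝 x, SmoothFieldAt (fun y ↦ a • T y) y := by
    filter_upwards [hT] with y hy using hy.smul a
  rw [traceHessian_eq_sum h2 (isParseval_onb x), traceHessian_eq_sum hT (isParseval_onb x),
    Finset.smul_sum]
  exact Finset.sum_congr rfl fun k _ ↦ hessField_smul hT _ _ _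

theorem ricci_smul (a : ℝ) (v : TangentSpace (𝓡 m) x) : ricci x (a • v) = a • ricci x v := by
  rw [ricci, ricci, Finset.smul_sum]
  refine Finset.sum_congr rfl fun k _ ↦ ?_
  apply toE_injective (mem_ch_source x)
  simp [toE_curvature (mem_ch_source x), curvL, smul_sub, smul_add]

end Invariants

/-! ### Local sections of a submersion, in coordinates -/

section LocalSection

variable {E E' : Type*} [NormedAddCommGroup E] [NormedSpace ℝ E]
  [NormedAddCommGroup E'] [NormedSpace ℝ E'] [FiniteDimensional ℝ E'] [FiniteDimensional ℝ E]

/-- A submersion has smooth local sections. -/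
theorem exists_local_section {F : E → E'} {u : E} (hF : ContDiffAt ℝ ∞ F u)
    (hs : Function.Surjective (fderiv ℝ F u)) :
    ∃ s : E' → E, s (F u) = u ∧ ContDiffAt ℝ ∞ s (F u) ∧ ∀ᶠ w in 𝓝 (F u), F (s w) = w := by
  have := FiniteDimensional.complete ℝ E'
  obtain ⟨A, hA⟩ := (fderiv ℝ F u).toLinearMap.exists_rightInverse_of_surjective
    (LinearMap.range_eq_top.2 hs)
  set A' : E' →L[ℝ] E := LinearMap.toContinuousLinearMap A
  -- With A' a right inverse of the derivative, G has the identity as derivative at 0. The section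
  -- is u + A' composed with the local inverse of G.
  set G : E' → E' := fun w ↦ F (u + A' w) with hG
  have h0 : u + A' 0 = u := by simp
  have hFu : ContDiffAt ℝ ∞ F (u + A' 0) := by rwa [h0]
  have hG1 : ContDiffAt ℝ ∞ G 0 :=
    hFu.comp (0 : E') (contDiffAt_const.add A'.contDiff.contDiffAt)
  have hG2 : HasFDerivAt G ((ContinuousLinearEquiv.refl ℝ E' : E' ≃L[ℝ] E') : E' →L[ℝ] E') 0 := by
    have h1 : HasFDerivAt (fun w ↦ u + A' w) A' 0 := A'.hasFDerivAt.const_add u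
    have h2 := ((hFu.differentiableAt (by simp)).hasFDerivAt).comp (0 : E') h1
    rw [h0] at h2
    have h3 : (ContinuousLinearEquiv.refl ℝ E' : E' →L[ℝ] E') = fderiv ℝ F u ∘L A' := by
      ext w
      exact (LinearMap.congr_fun hA w).symm
    rw [h3]
    exact h2
  have hst := hG1.hasStrictFDerivAt' hG2 (by simp)
  have hG0 : G 0 = F u := by simp [hG]
  have hinv := hG1.to_localInverse hG2 (by simp)
  have hr := hst.eventually_right_inverse
  have hi := hst.localInverse_apply_image
  rw [hG0] at hinv hr hi
  refine ⟨fun w ↦ u + A' (hst.localInverse G _ 0 w), ?_, ?_, hr⟩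
  · simp [hi]
  · exact contDiffAt_const.add (A'.contDiff.contDiffAt.comp (F u) hinv)

end LocalSection

/-! ### Horizontal and vertical vectors; the tension field of a Riemannian submersion -/

section Submersion

variable {m n : ℕ}
  {M : Type*} [TopologicalSpace M] [ChartedSpace (EuclideanSpace ℝ (Fin m)) M]
  [IsManifold (𝓡 m) ∞ M] [RiemannianBundle (fun x : M ↦ TangentSpace (𝓡 m) x)]
  [IsContMDiffRiemannianBundle (𝓡 m) ∞ (EuclideanSpace ℝ (Fin m))
      (fun x : M ↦ TangentSpace (𝓡 m) x)]
  {N : Type*} [TopologicalSpace N] [ChartedSpace (EuclideanSpace ℝ (Fin n)) N]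
  [IsManifold (𝓡 n) ∞ N] [RiemannianBundle (fun x : N ↦ TangentSpace (𝓡 n) x)]
  [IsContMDiffRiemannianBundle (𝓡 n) ∞ (EuclideanSpace ℝ (Fin n))
      (fun x : N ↦ TangentSpace (𝓡 n) x)]
  {c x : M} {d : N} {φ : M → N} {σ : Along n φ} {Y : VField m M}

theorem diff_eq_zero {v : TangentSpace (𝓡 m) x} (hv : v ∈ vertical (m := m) (n := n) φ x) :
    diff (m := m) (n := n) φ x v = 0 := hv

theorem ver_mem (φ : M → N) (x : M) (v : TangentSpace (𝓡 m) x) :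
    ver (m := m) (n := n) φ x v ∈ vertical (m := m) (n := n) φ x :=
  Submodule.starProjection_apply_mem _ _

theorem hor_mem (φ : M → N) (x : M) (v : TangentSpace (𝓡 m) x) :
    hor (m := m) (n := n) φ x v ∈ (vertical (m := m) (n := n) φ x)ᗮ :=
  Submodule.starProjection_apply_mem _ _

theorem ver_add_hor (φ : M → N) (x : M) (v : TangentSpace (𝓡 m) x) :
    ver (m := m) (n := n) φ x v + hor (m := m) (n := n) φ x v = v :=
  Submodule.starProjection_add_starProjection_orthogonal _

theorem ver_eq_self {v : TangentSpace (𝓡 m) x} (hv : v ∈ vertical (m := m) (n := n) φ x) :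
    ver (m := m) (n := n) φ x v = v := Submodule.starProjection_eq_self_iff.2 hv

theorem hor_eq_self {v : TangentSpace (𝓡 m) x} (hv : v ∈ (vertical (m := m) (n := n) φ x)ᗮ) :
    hor (m := m) (n := n) φ x v = v := Submodule.starProjection_eq_self_iff.2 hv

theorem diff_hor (φ : M → N) (x : M) (v : TangentSpace (𝓡 m) x) :
    diff (m := m) (n := n) φ x (hor (m := m) (n := n) φ x v) = diff (m := m) (n := n) φ x v := by
  conv_rhs => rw [← ver_add_hor (m := m) (n := n) φ x v, map_add, diff_eq_zero (ver_mem (m := m) (n := n) φ x v), zero_add]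

/-- The difference is both vertical and orthogonal to the vertical space, hence zero. -/
theorem eq_of_horizontal {v w : TangentSpace (𝓡 m) x} (hv : v ∈ (vertical (m := m) (n := n) φ x)ᗮ)
    (hw : w ∈ (vertical (m := m) (n := n) φ x)ᗮ) (h : diff (m := m) (n := n) φ x v = diff (m := m) (n := n) φ x w) : v = w := by
  have h1 : v - w ∈ vertical (m := m) (n := n) φ x := by
    change diff (m := m) (n := n) φ x (v - w) = 0
    rw [map_sub, h, sub_self]
  have h2 := Submodule.sub_mem _ hv hw
  have h3 := (Submodule.mem_orthogonal _ _).1 h2 _ h1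
  exact sub_eq_zero.1 (inner_self_eq_zero.1 h3)

namespace IsRiemannianSubmersion

variable (hφ : IsRiemannianSubmersion (m := m) (n := n) φ)
include hφ

theorem mdifferentiableAt (x : M) : MDifferentiableAt (𝓡 m) (𝓡 n) φ x :=
  hφ.smooth.mdifferentiableAt (by simp)

/-- The horizontal projection is dφ*dφ. This expresses it by the metrics and dφ alone, whence its
smoothness. -/
theorem inner_hor (v w : TangentSpace (𝓡 m) x) :
    (inner ℝ (hor (m := m) (n := n) φ x v) w : ℝ) = inner ℝ (diff (m := m) (n := n) φ x v) (diff (m := m) (n := n) φ x w) := by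
  have h := hφ.isometric x _ (hor_mem (m := m) (n := n) φ x v) _ (hor_mem (m := m) (n := n) φ x w)
  rw [diff_hor, diff_hor] at h
  rw [h]
  conv_lhs => rw [← ver_add_hor (m := m) (n := n) φ x w, inner_add_right]
  rw [(Submodule.mem_orthogonal' _ _).1 (hor_mem (m := m) (n := n) φ x v) _ (ver_mem (m := m) (n := n) φ x w), zero_add]

theorem exists_hor (w : TangentSpace (𝓡 n) (φ x)) :
    ∃ v ∈ (vertical (m := m) (n := n) φ x)ᗮ, diff (m := m) (n := n) φ x v = w := by
  obtain ⟨v, rfl⟩ := hφ.surjective x w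
  exact ⟨_, hor_mem (m := m) (n := n) φ x v, diff_hor (m := m) (n := n) φ x v⟩

/-- The horizontal projection in charts. -/
def _root_.BiharmonicSubmersion.horLoc (φ : M → N) (c : M) (d : N)
    (u : EuclideanSpace ℝ (Fin m)) :
    EuclideanSpace ℝ (Fin m) →L[ℝ] EuclideanSpace ℝ (Fin m) :=
  sharp (gloc c) u ∘L (gloc d (locMap m n c d φ u)).bilinearComp
    (fderiv ℝ (locMap m n c d φ) u) (fderiv ℝ (locMap m n c d φ) u)

theorem toE_hor (hx : x ∈ (ch m c).source) (hd : φ x ∈ (ch n d).source)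
    (v : TangentSpace (𝓡 m) x) :
    toE c x (hor (m := m) (n := n) φ x v) = horLoc (n := n) φ c d (ch m c x) (toE c x v) := by
  have hu := (ch m c).map_source hx
  refine (isMetricOn_gloc c).eq_of_forall hu fun z ↦ ?_
  rw [← toE_ofE hx z, gloc_toE hx, hφ.inner_hor, horLoc, ContinuousLinearMap.comp_apply,
    (isMetricOn_gloc c).apply_sharp hu, ContinuousLinearMap.bilinearComp_apply, locMap_apply hx,
    ← toE_diff (hφ.mdifferentiableAt x) hx hd, ← toE_diff (hφ.mdifferentiableAt x) hx hd,
    gloc_toE hd]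

theorem contDiffAt_horLoc (hx : x ∈ (ch m c).source) (hd : φ x ∈ (ch n d).source) :
    ContDiffAt ℝ ∞ (horLoc (n := n) φ c d) (ch m c x) := by
  have hF := contDiffAt_locMap hφ.smooth.contMDiffAt hx hd
  have hdF := hF.fderiv_right (m := ∞) (by simp)
  have hs := (isMetricOn_gloc c).contDiffAt_sharp ((ch m c).map_source hx)
  have hg := (isMetricOn_gloc d).contDiffAt ((ch n d).map_source hd)
  rw [← locMap_apply hx] at hg
  have hg' := hg.comp _ hF
  have h2 : ContDiffAt ℝ ∞ (fun u ↦ (gloc d (locMap m n c d φ u)).bilinearComp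
      (fderiv ℝ (locMap m n c d φ) u) (fderiv ℝ (locMap m n c d φ) u)) (ch m c x) := by
    -- The pulled-back form is rewritten with compositions and flips, which are continuous linear
    -- operations, so that its smooth dependence on u is visible.
    have h3 : (fun u ↦ (gloc d (locMap m n c d φ u)).bilinearComp
      (fderiv ℝ (locMap m n c d φ) u) (fderiv ℝ (locMap m n c d φ) u)) = fun u ↦
        (((gloc d (locMap m n c d φ u)) ∘L (fderiv ℝ (locMap m n c d φ) u)).flip ∘L
          (fderiv ℝ (locMap m n c d φ) u)).flip := by
      ext u a b
      rfl
    rw [h3]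
    let fl (E₁ E₂ : Type) [NormedAddCommGroup E₁] [NormedSpace ℝ E₁] [NormedAddCommGroup E₂]
        [NormedSpace ℝ E₂] : (E₁ →L[ℝ] E₂ →L[ℝ] ℝ) →L[ℝ] E₂ →L[ℝ] E₁ →L[ℝ] ℝ :=
      (ContinuousLinearMap.flipₗᵢ ℝ E₁ E₂ ℝ : _ →L[ℝ] _)
    refine (fl _ _).contDiff.contDiffAt.comp (ch m c x) ?_
    exact ContDiffAt.clm_comp ((fl _ _).contDiff.contDiffAt.comp (ch m c x) (hg'.clm_comp hdF)) hdF
  exact hs.clm_comp h2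

theorem smoothFieldAt_hor (hY : SmoothFieldAt Y x) :
    SmoothFieldAt (fun y ↦ hor (m := m) (n := n) φ y (Y y)) x := by
  have hx := mem_ch_source (m := m) x
  have hd := mem_ch_source (m := n) (φ x)
  rw [smoothFieldAt_iff hx]
  have h0 := hφ.smooth.continuous.continuousAt.eventually ((ch n (φ x)).open_source.mem_nhds hd)
  have h : loc x (fun y ↦ hor (m := m) (n := n) φ y (Y y)) =ᶠ[𝓝 (ch m x x)]
      fun u ↦ horLoc (n := n) φ x (φ x) u (loc x Y u) := by
    filter_upwards [eventually_nhds_chart hx h0] with u ⟨h1, h2, h3⟩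
    rw [loc, hφ.toE_hor h2 h1, h3]
    rfl
  exact ((hφ.contDiffAt_horLoc hx hd).clm_apply (contDiffAt_loc hx hY)).congr_of_eventuallyEq h

theorem smoothFieldAt_ver (hY : SmoothFieldAt Y x) :
    SmoothFieldAt (fun y ↦ ver (m := m) (n := n) φ y (Y y)) x := by
  have hx := mem_ch_source (m := m) x
  have h1 := contDiffAt_loc hx (hφ.smoothFieldAt_hor hY)
  have h2 := contDiffAt_loc hx hY
  rw [smoothFieldAt_iff hx]
  refine (h2.sub h1).congr_of_eventuallyEq (Eventually.of_forall fun u ↦ ?_)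
  change loc x _ u = loc x _ u - loc x _ u
  rw [loc, loc, loc, ← map_sub]
  congr 1
  exact eq_sub_of_add_eq (ver_add_hor (m := m) (n := n) φ _ _)

/-- The second fundamental form vanishes on horizontal vectors. -/
theorem sff_eq_zero {v w : TangentSpace (𝓡 m) x} (hv : v ∈ (vertical (m := m) (n := n) φ x)ᗮ)
    (hw : w ∈ (vertical (m := m) (n := n) φ x)ᗮ) : secondFundamentalForm (n := n) φ x v w = 0 := by
  have hx := mem_ch_source (m := m) x
  have hd := mem_ch_source (m := n) (φ x)
  have h0 := hφ.smooth.continuous.continuousAt.eventually ((ch n (φ x)).open_source.mem_nhds hd)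
  -- The test vector y is a horizontal lift of B(v, w) itself, so the vanishing of ⟨B(v, w), dφ y⟩
  -- is that of |B(v, w)|².
  obtain ⟨y, hy, hyw⟩ := hφ.exists_hor (secondFundamentalForm (n := n) φ x v w)
  have hiso : ∀ᶠ q in 𝓝 (ch m x x), ∀ v y,
      gloc (φ x) (locMap m n x (φ x) φ q) (fderiv ℝ (locMap m n x (φ x) φ) q v)
        (fderiv ℝ (locMap m n x (φ x) φ) q (horLoc (n := n) φ x (φ x) q y)) =
      gloc x q v (horLoc (n := n) φ x (φ x) q y) := by
    filter_upwards [eventually_nhds_chart hx h0] with q ⟨h1, h2, h3⟩ v y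
    set z := (ch m x).symm q
    rw [← h3, ← toE_ofE h2 v, ← toE_ofE h2 y, ← hφ.toE_hor h2 h1, gloc_toE h2,
      ← toE_diff (hφ.mdifferentiableAt z) h2 h1, ← toE_diff (hφ.mdifferentiableAt z) h2 h1,
      locMap_apply h2, gloc_toE h1, diff_hor, real_inner_comm, ← hφ.inner_hor,
      real_inner_comm]
  have hp {z : TangentSpace (𝓡 m) x} (hz : z ∈ (vertical (m := m) (n := n) φ x)ᗮ) :
      horLoc (n := n) φ x (φ x) (ch m x x) (toE x x z) = toE x x z := by
    rw [← hφ.toE_hor hx hd, hor_eq_self hz]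
  have hFu : locMap m n x (φ x) φ (ch m x x) ∈ (ch n (φ x)).target := by
    rw [locMap_apply hx]
    exact (ch n _).map_source hd
  have h := sff_horizontal_eq_zero (isMetricOn_gloc x) (isMetricOn_gloc (φ x))
    ((ch m x).map_source hx) hFu (contDiffAt_locMap hφ.smooth.contMDiffAt hx hd)
    ((hφ.contDiffAt_horLoc hx hd).differentiableAt (by simp)) hiso (hp hw) (hp hy) (hp hv)
  have h' := toE_secondFundamentalForm hφ.smooth hx hd v w
  rw [chr, chr] at h'
  rw [← h', ← toE_diff (hφ.mdifferentiableAt x) hx hd, hyw, locMap_apply hx, gloc_toE hd] at h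
  exact inner_self_eq_zero.1 h

/-- The section dφ(Y) is zero near x, and so is its covariant derivative; only -dφ(∇_v Y) is left of
the definition. -/
theorem sff_vertical (hY : SmoothFieldAt Y x)
    (hv : ∀ᶠ y in 𝓝 x, Y y ∈ vertical (m := m) (n := n) φ y) (v : TangentSpace (𝓡 m) x) :
    secondFundamentalForm (n := n) φ x v (Y x) = - diff (m := m) (n := n) φ x (nabla Y x v) := by
  have hx := mem_ch_source (m := m) x
  have hd := mem_ch_source (m := n) (φ x)
  rw [← sff_eq hφ.smooth hY, sub_eq_neg_self]
  apply toE_injective hd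
  rw [toE_nablaAlong hφ.smooth.contMDiffAt (smoothAlongAt_diff hφ.smooth hY) hx hd, map_zero]
  have h : locA x (φ x) φ (fun y ↦ diff (m := m) (n := n) φ y (Y y)) =ᶠ[𝓝 (ch m x x)] fun _ ↦ 0 := by
    filter_upwards [eventually_symm hx hv] with u hu
    rw [locA, diff_eq_zero hu, map_zero]
  rw [covD_congr EventuallyEq.rfl h, covD_apply]
  simp

/-- Apply dφ to the expansion of a horizontal lift of w: the vertical terms die, and the
coefficients are preserved by the isometry on horizontal vectors. -/
theorem sum_inner_diff {ι κ : Type*} [Fintype ι] [Fintype κ] {e : ι → TangentSpace (𝓡 m) x}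
    {f : κ → TangentSpace (𝓡 m) x} (h : IsParseval (Sum.elim e f))
    (he : ∀ i, e i ∈ (vertical (m := m) (n := n) φ x)ᗮ) (hf : ∀ s, f s ∈ vertical (m := m) (n := n) φ x) :
    IsParseval fun i ↦ diff (m := m) (n := n) φ x (e i) := by
  intro w
  obtain ⟨v, hv, rfl⟩ := hφ.exists_hor w
  have := congrArg (diff (m := m) (n := n) φ x) (h v)
  simp only [Fintype.sum_sum_type, Sum.elim_inl, Sum.elim_inr, map_add, map_sum, map_smul] at this
  simp only [diff_eq_zero (hf _), smul_zero, Finset.sum_const_zero, add_zero] at this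
  conv_rhs => rw [← this]
  exact Finset.sum_congr rfl fun i _ ↦ by rw [hφ.isometric x _ (he i) _ hv]

theorem exists_adapted (x : M) :
    ∃ e : Fin (Module.finrank ℝ ((vertical (m := m) (n := n) φ x)ᗮ : Submodule ℝ _)) →
        TangentSpace (𝓡 m) x,
      (∀ i, e i ∈ (vertical (m := m) (n := n) φ x)ᗮ) ∧
      IsParseval (Sum.elim e
        fun s ↦ (stdOrthonormalBasis ℝ (vertical (m := m) (n := n) φ x) s :
          TangentSpace (𝓡 m) x)) := by
  refine ⟨fun i ↦ (stdOrthonormalBasis ℝ ((vertical (m := m) (n := n) φ x)ᗮ :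
    Submodule ℝ _) i : TangentSpace (𝓡 m) x), fun i ↦ Subtype.coe_prop _, fun w ↦ ?_⟩
  have key (K : Submodule ℝ (TangentSpace (𝓡 m) x)) :
      ∑ k, (inner ℝ (stdOrthonormalBasis ℝ K k : TangentSpace (𝓡 m) x) w : ℝ) •
        (stdOrthonormalBasis ℝ K k : TangentSpace (𝓡 m) x) = K.starProjection w := by
    rw [(stdOrthonormalBasis ℝ K).starProjection_eq_sum_rankOne]
    simp
  rw [Fintype.sum_sum_type]
  simp only [Sum.elim_inl, Sum.elim_inr]
  rw [key, key, add_comm]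
  exact ver_add_hor (m := m) (n := n) φ x w

theorem finrank_vertical (x : M) :
    Module.finrank ℝ (vertical (m := m) (n := n) φ x) + n = m := by
  have h1 := (diff (m := m) (n := n) φ x).toLinearMap.finrank_range_add_finrank_ker
  rw [LinearMap.range_eq_top.2 (hφ.surjective x), finrank_top] at h1
  have h2 : Module.finrank ℝ (TangentSpace (𝓡 m) x) = m := finrank_euclideanSpace_fin
  have h3 : Module.finrank ℝ (TangentSpace (𝓡 n) (φ x)) = n := finrank_euclideanSpace_fin
  rw [h2, h3] at h1
  rw [add_comm]
  exact h1

/-- The tension field is determined by the vertical directions. -/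
theorem tension_eq_sum_vertical {ι κ : Type*} [Fintype ι] [Fintype κ]
    {e : ι → TangentSpace (𝓡 m) x}
    {f : κ → TangentSpace (𝓡 m) x} (h : IsParseval (Sum.elim e f))
    (he : ∀ i, e i ∈ (vertical (m := m) (n := n) φ x)ᗮ) :
    tension (m := m) (n := n) φ x = ∑ s, secondFundamentalForm (n := n) φ x (f s) (f s) := by
  rw [tension_eq_sum hφ.smooth h, Fintype.sum_sum_type]
  simp only [Sum.elim_inl, Sum.elim_inr, hφ.sff_eq_zero (he _) (he _), Finset.sum_const_zero,
    zero_add]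

/-- The differential maps the mean curvature of the fibers to a multiple of the tension field. -/
theorem diff_meanCurvature (x : M) :
    diff (m := m) (n := n) φ x (meanCurvature (m := m) (n := n) φ x) =
      -((m : ℝ) - n)⁻¹ • tension (m := m) (n := n) φ x := by
  obtain ⟨e, he, hp⟩ := hφ.exists_adapted x
  rw [hφ.tension_eq_sum_vertical hp he, meanCurvature, map_smul, neg_smul, ← smul_neg,
    map_sum, ← Finset.sum_neg_distrib]
  congr 1
  refine Finset.sum_congr rfl fun s _ ↦ ?_
  set f : TangentSpace (𝓡 m) x := (stdOrthonormalBasis ℝ (vertical (m := m) (n := n) φ x) s).1 with hf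
  have hfm : f ∈ vertical (m := m) (n := n) φ x :=
    (stdOrthonormalBasis ℝ (vertical (m := m) (n := n) φ x) s).2
  have h1 := hφ.sff_vertical (Y := fun y ↦ ver (m := m) (n := n) φ y (ext f y))
    (hφ.smoothFieldAt_ver (eventually_smoothFieldAt_ext f).self_of_nhds)
    (Eventually.of_forall fun y ↦ ver_mem (m := m) (n := n) φ y _) f
  simp only [ext_self, ver_eq_self hfm] at h1
  rw [h1, neg_neg]
  exact diff_hor (m := m) (n := n) φ x _

theorem meanCurvature_mem (x : M) :
    meanCurvature (m := m) (n := n) φ x ∈ (vertical (m := m) (n := n) φ x)ᗮ :=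
  Submodule.smul_mem _ _ (Submodule.sum_mem _ fun _ _ ↦ hor_mem (m := m) (n := n) φ x _)

/-- For m ≠ n the preceding formula is inverted. For m = n, where (m - n)⁻¹ is 0 by convention,
there are no vertical directions and the tension field vanishes. -/
theorem tension_eq (x : M) :
    tension (m := m) (n := n) φ x =
      -((m : ℝ) - n) • diff (m := m) (n := n) φ x (meanCurvature (m := m) (n := n) φ x) := by
  rw [hφ.diff_meanCurvature]
  have hr := hφ.finrank_vertical x
  rcases eq_or_ne m n with h | h
  · obtain ⟨e, he, hp⟩ := hφ.exists_adapted x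
    have h0 : Module.finrank ℝ (vertical (m := m) (n := n) φ x) = 0 := by omega
    have : IsEmpty (Fin (Module.finrank ℝ (vertical (m := m) (n := n) φ x))) := by
      rw [h0]; infer_instance
    have h2 := hφ.tension_eq_sum_vertical hp he
    rw [Finset.univ_eq_empty, Finset.sum_empty] at h2
    rw [h2, smul_zero, smul_zero]
  · have : (m : ℝ) - n ≠ 0 := sub_ne_zero.2 (by exact_mod_cast h)
    rw [smul_smul, neg_mul_neg, mul_inv_cancel₀ this, one_smul]

end IsRiemannianSubmersion

end Submersion

/-! ### Smooth dependence of second derivatives and traces, in coordinates -/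

section LocalSmooth

variable {E E' : Type*} [NormedAddCommGroup E] [NormedSpace ℝ E]
  [NormedAddCommGroup E'] [NormedSpace ℝ E']

theorem contDiffAt_covHom {ΓM : E → E →L[ℝ] E →L[ℝ] E} {Γ : E' → E' →L[ℝ] E' →L[ℝ] E'}
    {F : E → E'} {S : E → E →L[ℝ] E'} {u : E} (hΓM : ContDiffAt ℝ ∞ ΓM u)
    (hΓ : ContDiffAt ℝ ∞ Γ (F u)) (hF : ContDiffAt ℝ ∞ F u) (hS : ContDiffAt ℝ ∞ S u) :
    ContDiffAt ℝ ∞ (covHom ΓM Γ F S) u := by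
  have h1 := hS.fderiv_right (m := ∞) (by simp)
  have h2 := hF.fderiv_right (m := ∞) (by simp)
  have h3 := (ContinuousLinearMap.compL ℝ E E' E').flip.contDiff.contDiffAt.comp u hS
  have h4 := (ContinuousLinearMap.compL ℝ E E E').contDiff.contDiffAt.comp u hS
  exact (h1.add (h3.clm_comp ((hΓ.comp u hF).clm_comp h2))).sub (h4.clm_comp hΓM)

theorem contDiffAt_trL [FiniteDimensional ℝ E] {ι : Type*} [Fintype ι] (b : Module.Basis ι ℝ E)
    {g : E → E →L[ℝ] E →L[ℝ] ℝ} {U : Set E} (hg : IsMetricOn g U) {u : E} (hu : u ∈ U)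
    {B : E → E →L[ℝ] E →L[ℝ] E'} (hB : ContDiffAt ℝ ∞ B u) :
    ContDiffAt ℝ ∞ (fun q ↦ trL b g q fun v w ↦ B q v w) u := by
  refine ContDiffAt.sum fun j _ ↦ ?_
  exact (hB.clm_apply ((hg.contDiffAt_sharp hu).clm_apply contDiffAt_const)).clm_apply
    contDiffAt_const

end LocalSmooth

/-! ### Descent of the tension field, the bitension field and the frame expression -/

section Tension

variable {m n : ℕ}
  {M : Type*} [TopologicalSpace M] [ChartedSpace (EuclideanSpace ℝ (Fin m)) M]
  [IsManifold (𝓡 m) ∞ M] [RiemannianBundle (fun x : M ↦ TangentSpace (𝓡 m) x)]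
  [IsContMDiffRiemannianBundle (𝓡 m) ∞ (EuclideanSpace ℝ (Fin m))
      (fun x : M ↦ TangentSpace (𝓡 m) x)]
  {N : Type*} [TopologicalSpace N] [ChartedSpace (EuclideanSpace ℝ (Fin n)) N]
  [IsManifold (𝓡 n) ∞ N] [RiemannianBundle (fun x : N ↦ TangentSpace (𝓡 n) x)]
  [IsContMDiffRiemannianBundle (𝓡 n) ∞ (EuclideanSpace ℝ (Fin n))
      (fun x : N ↦ TangentSpace (𝓡 n) x)]
  {c x : M} {d : N} {φ : M → N} {σ : Along n φ} {Y : VField m M}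

/-- The standard basis. -/
def stdB (m : ℕ) : Module.Basis (Fin m) ℝ (EuclideanSpace ℝ (Fin m)) :=
  (EuclideanSpace.basisFun (Fin m) ℝ).toBasis

theorem IsParseval.toE {ι : Type*} [Fintype ι] {e : ι → TangentSpace (𝓡 m) x} (he : IsParseval e)
    (hx : x ∈ (ch m c).source) (w : EuclideanSpace ℝ (Fin m)) :
    ∑ k, gloc c (ch m c x) (toE c x (e k)) w • toE c x (e k) = w := by
  have := congrArg (BiharmonicSubmersion.toE c x) (he (ofE c x w))
  rw [toE_ofE hx, map_sum] at this
  conv_rhs => rw [← this]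
  refine Finset.sum_congr rfl fun k _ ↦ ?_
  rw [map_smul, ← gloc_toE hx, toE_ofE hx]

theorem toE_tension (hφ : ContMDiff (𝓡 m) (𝓡 n) ∞ φ) (hx : x ∈ (ch m c).source)
    (hd : φ x ∈ (ch n d).source) :
    toE d (φ x) (tension (m := m) (n := n) φ x) = trL (stdB m) (gloc c) (ch m c x) fun v w ↦
      covHom (chr m c) (chr n d) (locMap m n c d φ) (fderiv ℝ (locMap m n c d φ)) (ch m c x)
        v w := by
  rw [trL_eq_sum (stdB m) (isMetricOn_gloc c) ((ch m c).map_source hx)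
    ((isParseval_onb x).toE hx), tension, map_sum]
  exact Finset.sum_congr rfl fun k _ ↦ toE_secondFundamentalForm hφ hx hd _ _

theorem smoothAlongAt_tension (hφ : ContMDiff (𝓡 m) (𝓡 n) ∞ φ) (x : M) :
    SmoothAlongAt m φ (tension (m := m) (n := n) φ) x := by
  have hx := mem_ch_source (m := m) x
  have hd := mem_ch_source (m := n) (φ x)
  rw [smoothAlongAt_iff hφ.contMDiffAt hx hd]
  have h0 := hφ.continuous.continuousAt.eventually ((ch n (φ x)).open_source.mem_nhds hd)
  have hF := contDiffAt_locMap hφ.contMDiffAt hx hd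
  have hΓ : ContDiffAt ℝ ∞ (chr n (φ x)) (locMap m n x (φ x) φ (ch m x x)) := by
    rw [locMap_apply hx]
    exact contDiffAt_chr ((ch n (φ x)).map_source hd)
  refine (contDiffAt_trL (stdB m) (isMetricOn_gloc x) ((ch m x).map_source hx)
    (contDiffAt_covHom (contDiffAt_chr ((ch m x).map_source hx)) hΓ hF
      (hF.fderiv_right (m := ∞) (by simp)))).congr_of_eventuallyEq ?_
  filter_upwards [eventually_nhds_chart hx h0] with u ⟨h1, h2, h3⟩
  rw [locA, toE_tension hφ h2 h1, h3]

theorem smoothOn_iff {X : VField m M} {s : Set M} (hs : IsOpen s) :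
    SmoothOn X s ↔ ∀ y ∈ s, SmoothFieldAt X y :=
  ⟨fun h y hy ↦ (h y hy).contMDiffAt (hs.mem_nhds hy), fun h y hy ↦ (h y hy).contMDiffWithinAt⟩

namespace IsRiemannianSubmersion

variable (hφ : IsRiemannianSubmersion (m := m) (n := n) φ)
include hφ

theorem exists_section (x : M) :
    ∃ s : N → M, s (φ x) = x ∧ ContMDiffAt (𝓡 n) (𝓡 m) ∞ s (φ x) ∧
      ∀ᶠ q in 𝓝 (φ x), φ (s q) = q := by
  have hx := mem_ch_source (m := m) x
  have hd := mem_ch_source (m := n) (φ x)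
  have hF := contDiffAt_locMap hφ.smooth.contMDiffAt hx hd
  have hs : Function.Surjective (fderiv ℝ (locMap m n x (φ x) φ) (ch m x x)) := by
    intro w
    obtain ⟨v, hv⟩ := hφ.surjective x (ofE (φ x) (φ x) w)
    exact ⟨toE x x v, by rw [← toE_diff (hφ.mdifferentiableAt x) hx hd, hv, toE_ofE hd]⟩
  obtain ⟨s, h1, h2, h3⟩ := exists_local_section hF hs
  rw [locMap_apply hx] at h1 h2 h3
  have hx' : (ch m x).symm (s (ch n (φ x) (φ x))) = x := by rw [h1, (ch m x).left_inv hx]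
  have hsm : ContMDiffAt (𝓡 n) (𝓡 m) ∞ (fun q ↦ (ch m x).symm (s (ch n (φ x) q))) (φ x) := by
    have e1 := h2.contMDiffAt.comp (φ x) (contMDiffAt_ch hd)
    have e2 : ContMDiffAt 𝓘(ℝ, EuclideanSpace ℝ (Fin m)) (𝓡 m) ∞ (ch m x).symm
        (s (ch n (φ x) (φ x))) := by
      rw [h1]; exact contMDiffAt_ch_symm ((ch m x).map_source hx)
    exact e2.comp (φ x) e1
  refine ⟨fun q ↦ (ch m x).symm (s (ch n (φ x) q)), hx', hsm, ?_⟩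
  have h4 := ((ch n (φ x)).continuousAt hd).eventually h3
  -- The chart of N is injective only on its source, so the equality of coordinates gives φ(s(q)) =
  -- q only once φ(s(q)) is known to stay there.
  have h5 : ∀ᶠ q in 𝓝 (φ x), φ ((ch m x).symm (s (ch n (φ x) q))) ∈ (ch n (φ x)).source := by
    refine (hφ.smooth.continuous.continuousAt.comp hsm.continuousAt).eventually
      ((ch n (φ x)).open_source.mem_nhds ?_)
    rw [Function.comp_apply, hx']
    exact hd
  filter_upwards [h4, h5, (ch n (φ x)).open_source.mem_nhds hd] with q hq hq' hq''
  exact (ch n (φ x)).injOn hq' hq'' hq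

theorem isOpen_range : IsOpen (range φ) := by
  rw [isOpen_iff_mem_nhds]
  rintro _ ⟨x, rfl⟩
  obtain ⟨s, -, -, hs⟩ := hφ.exists_section x
  filter_upwards [hs] with q hq using ⟨s q, hq⟩

/-- Near φ x one has T = (T ∘ φ) ∘ s for a smooth local section s. -/
theorem smoothFieldAt_of_comp {T : VField n N}
    (hσ : SmoothAlongAt m φ (fun y ↦ T (φ y)) x) : SmoothFieldAt T (φ x) := by
  obtain ⟨s, h1, h2, h3⟩ := hφ.exists_section x
  have hσ' : ContMDiffAt (𝓡 m) (𝓡 n).tangent ∞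
      (fun y ↦ (⟨φ y, T (φ y)⟩ : TangentBundle (𝓡 n) N)) (s (φ x)) := by rw [h1]; exact hσ
  refine (hσ'.comp (φ x) h2).congr_of_eventuallyEq ?_
  filter_upwards [h3] with q hq
  change (fun z ↦ (⟨z, T z⟩ : TangentBundle (𝓡 n) N)) q =
    (fun z ↦ (⟨z, T z⟩ : TangentBundle (𝓡 n) N)) (φ (s q))
  rw [hq]

theorem smoothFieldAt_of_tension {T : VField n N}
    (hT : ∀ x, tension (m := m) (n := n) φ x = T (φ x)) (x : M) : SmoothFieldAt T (φ x) := by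
  have h := smoothAlongAt_tension hφ.smooth x
  rw [show tension (m := m) (n := n) φ = fun y ↦ T (φ y) from funext hT] at h
  exact hφ.smoothFieldAt_of_comp h

theorem eventually_smoothFieldAt_of_tension {T : VField n N}
    (hT : ∀ x, tension (m := m) (n := n) φ x = T (φ x)) (x : M) :
    ∀ᶠ q in 𝓝 (φ x), SmoothFieldAt T q := by
  filter_upwards [hφ.isOpen_range.mem_nhds (mem_range_self x)]
  rintro _ ⟨y, rfl⟩
  exact hφ.smoothFieldAt_of_tension hT y

theorem smoothOn_of_tension {T : VField n N}
    (hT : ∀ x, tension (m := m) (n := n) φ x = T (φ x)) : SmoothOn T (range φ) := by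
  rw [smoothOn_iff hφ.isOpen_range]
  rintro _ ⟨y, rfl⟩
  exact hφ.smoothFieldAt_of_tension hT y

/-- The mean curvature field is basic iff the tension field is constant along the fibers. -/
theorem isBasic_iff : IsBasic (m := m) (n := n) φ (meanCurvature (m := m) (n := n) φ) ↔
    IsConstantAlongFibers (n := n) φ (tension (m := m) (n := n) φ) := by
  constructor
  · rintro ⟨-, X, -, hX⟩
    exact ⟨fun q ↦ -((m : ℝ) - n) • X q, fun x ↦ by rw [hφ.tension_eq, hX]⟩
  · rintro ⟨T, hT⟩
    -- Constancy along the fibers assumes no regularity of T; the smoothness demanded of a basic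
    -- field follows from that of the tension field.
    refine ⟨hφ.meanCurvature_mem, fun q ↦ -((m : ℝ) - n)⁻¹ • T q, ?_, fun x ↦ ?_⟩
    · have h := hφ.smoothOn_of_tension hT
      rw [smoothOn_iff hφ.isOpen_range] at h ⊢
      exact fun y hy ↦ (h y hy).smul _
    · rw [hφ.diff_meanCurvature, hT]

/-- Trace the Hessian of T ∘ φ over a basis adapted to the fibers. The first term only sees
horizontal vectors, whose images form an orthonormal basis of the tangent space of N; the second
sums to ∇T applied to the tension field. Skewness of the curvature in its first pair absorbs the
minus sign of the curvature trace. -/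
theorem bitension_eq {T : VField n N}
    (hT : ∀ x, tension (m := m) (n := n) φ x = T (φ x)) (x : M) :
    bitension (m := m) (n := n) φ x =
      traceHessian T (φ x) + nabla T (φ x) (T (φ x)) + ricci (φ x) (T (φ x)) := by
  have hs := hφ.eventually_smoothFieldAt_of_tension hT x
  obtain ⟨e, he, hp⟩ := hφ.exists_adapted x
  have hv (s) : ((stdOrthonormalBasis ℝ (vertical (m := m) (n := n) φ x) s :
      vertical (m := m) (n := n) φ x) : TangentSpace (𝓡 m) x) ∈ vertical (m := m) (n := n) φ x :=
    Subtype.coe_prop _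
  have hq := hφ.sum_inner_diff hp he hv
  have hTf : tension (m := m) (n := n) φ = fun y ↦ T (φ y) := funext hT
  obtain ⟨BT, hBT⟩ := exists_bilin_hessField hs
  obtain ⟨BR, hBR⟩ := exists_bilin_curvature (T (φ x))
  -- traces over the tangent space of `M` of forms pulled back by `dφ`
  have key (B : TangentSpace (𝓡 n) (φ x) →ₗ[ℝ] TangentSpace (𝓡 n) (φ x) →ₗ[ℝ]
      TangentSpace (𝓡 n) (φ x)) :
      ∑ k, B (diff (m := m) (n := n) φ x (onb x k)) (diff (m := m) (n := n) φ x (onb x k)) =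
        ∑ k, B (onb (φ x) k) (onb (φ x) k) := by
    have h1 := (isParseval_onb x).sum_eq hp
      (B.compl₁₂ (diff (m := m) (n := n) φ x).toLinearMap (diff (m := m) (n := n) φ x).toLinearMap)
    rw [Fintype.sum_sum_type] at h1
    simp only [Sum.elim_inl, Sum.elim_inr, LinearMap.compl₁₂_apply,
      ContinuousLinearMap.coe_coe, diff_eq_zero (hv _), map_zero, Finset.sum_const_zero,
      add_zero] at h1
    rw [h1]
    exact hq.sum_eq (isParseval_onb (φ x)) B
  have h1 : traceHessianAlong (m := m) φ (tension (m := m) (n := n) φ) x =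
      traceHessian T (φ x) + nabla T (φ x) (T (φ x)) := by
    rw [hTf]
    change ∑ k, (nablaAlong (m := m) φ (nablaAlongField φ (ext (onb x k)) fun y ↦ T (φ y)) x
      (onb x k) - nablaAlong φ (fun y ↦ T (φ y)) x (nabla (ext (onb x k)) x (onb x k))) = _
    have h2 (k) : nablaAlong (m := m) φ (nablaAlongField φ (ext (onb x k)) fun y ↦ T (φ y)) x
      (onb x k) - nablaAlong φ (fun y ↦ T (φ y)) x (nabla (ext (onb x k)) x (onb x k)) = _ :=
        hessAlong_comp hφ.smooth hs (onb x k) (onb x k)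
    rw [Finset.sum_congr rfl fun k _ ↦ h2 k, Finset.sum_add_distrib]
    simp only [hBT]
    rw [key, traceHessian_eq_sum hs (isParseval_onb (φ x))]
    simp only [hBT]
    congr 1
    -- By linearity of v ↦ ∇_v T, the sum of the ∇_{B(e_k, e_k)} T is ∇_{τ(φ)} T, and τ(φ) = T at φ
    -- x.
    let L : TangentSpace (𝓡 n) (φ x) →ₗ[ℝ] TangentSpace (𝓡 n) (φ x) :=
      { toFun := nabla T (φ x)
        map_add' := nabla_add_apply hs.self_of_nhds
        map_smul' := nabla_smul_apply hs.self_of_nhds }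
    change ∑ k, L _ = L _
    rw [← map_sum, ← hT]
    rfl
  rw [bitension, h1, sub_eq_add_neg, ← Finset.sum_neg_distrib]
  congr 1
  rw [ricci_eq_sum (isParseval_onb (φ x))]
  simp only [hBR]
  rw [← key]
  refine Finset.sum_congr rfl fun k _ ↦ ?_
  rw [← hBR, hT, curvature_antisymm, neg_neg]

theorem isParseval_of_isAdaptedFrame {U : Set M} {e : Fin n → VField m M}
    {f : Fin (m - n) → VField m M} (h : IsAdaptedFrame φ U e f) (hx : x ∈ U) :
    IsParseval (Sum.elim (fun i ↦ e i x) (fun s ↦ f s x)) := by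
  have ho := h.orthonormal x hx
  -- This makes the natural number m - n exact, so the frame has m members and spans.
  have hn : n ≤ m := by have := hφ.finrank_vertical x; omega
  have h2 : Module.finrank ℝ (TangentSpace (𝓡 m) x) = m := finrank_euclideanSpace_fin
  have hc : Fintype.card (Fin n ⊕ Fin (m - n)) = Module.finrank ℝ (TangentSpace (𝓡 m) x) := by
    rw [h2, Fintype.card_sum, Fintype.card_fin, Fintype.card_fin]
    omega
  have hsp := ho.linearIndependent.span_eq_top_of_card_eq_finrank' hc
  have := (OrthonormalBasis.mk ho hsp.ge).isParseval
  rwa [OrthonormalBasis.coe_mk] at this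

/-- Both sides are horizontal, and dφ sends both to the same multiple of the tension field, computed
in two adapted bases. -/
theorem meanCurvature_eq {U : Set M} {e : Fin n → VField m M}
    {f : Fin (m - n) → VField m M} (h : IsAdaptedFrame φ U e f) (hx : x ∈ U) :
    meanCurvature (m := m) (n := n) φ x =
      ((m : ℝ) - n)⁻¹ • ∑ s, hor (n := n) φ x (nabla (f s) x (f s x)) := by
  refine eq_of_horizontal (n := n) (φ := φ) (hφ.meanCurvature_mem x)
    (Submodule.smul_mem _ _ (Submodule.sum_mem _ fun _ _ ↦ hor_mem φ x _)) ?_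
  rw [hφ.diff_meanCurvature, hφ.tension_eq_sum_vertical (hφ.isParseval_of_isAdaptedFrame h hx)
    fun i ↦ h.mem_hor i x hx, map_smul, neg_smul, ← smul_neg, map_sum, ← Finset.sum_neg_distrib]
  congr 1
  refine Finset.sum_congr rfl fun s _ ↦ ?_
  rw [diff_hor, hφ.sff_vertical ((smoothOn_iff h.isOpen).1 (h.smooth_ver s) x hx), neg_neg]
  filter_upwards [h.isOpen.mem_nhds hx] with y hy using h.mem_ver s y hy

/-- Horizontal lifts of smooth fields are smooth. -/
theorem smoothFieldAt_of_lift {X : VField n N} (hX : SmoothFieldAt X (φ x))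
    (hY : ∀ y, Y y ∈ (vertical (m := m) (n := n) φ y)ᗮ)
    (hXY : ∀ y, diff (m := m) (n := n) φ y (Y y) = X (φ y)) : SmoothFieldAt Y x := by
  have hx := mem_ch_source (m := m) x
  have hd := mem_ch_source (m := n) (φ x)
  rw [smoothFieldAt_iff hx]
  have h0 := hφ.smooth.continuous.continuousAt.eventually ((ch n (φ x)).open_source.mem_nhds hd)
  -- The horizontal lift is dφ*X, the vector dual to ⟨X, dφ(·)⟩; in this form it is smooth.
  have h : loc x Y =ᶠ[𝓝 (ch m x x)] fun u ↦ sharp (gloc x) u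
      ((gloc (φ x) (locMap m n x (φ x) φ u) (loc (φ x) X (locMap m n x (φ x) φ u))) ∘L
        fderiv ℝ (locMap m n x (φ x) φ) u) := by
    filter_upwards [eventually_nhds_chart hx h0] with u ⟨h1, h2, h3⟩
    set z := (ch m x).symm u
    have hu := (ch m x).map_source h2
    change toE x z (Y z) = _
    rw [← h3]
    refine (isMetricOn_gloc x).eq_of_forall hu fun w ↦ ?_
    rw [(isMetricOn_gloc x).apply_sharp hu, ContinuousLinearMap.comp_apply, ← toE_ofE h2 w,
      gloc_toE h2, ← toE_diff (hφ.mdifferentiableAt z) h2 h1, locMap_apply h2, loc_apply h1,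
      gloc_toE h1, ← hXY, ← hφ.inner_hor, hor_eq_self (hY z)]
  have hF := contDiffAt_locMap hφ.smooth.contMDiffAt hx hd
  have hg := (isMetricOn_gloc (φ x)).contDiffAt ((ch n (φ x)).map_source hd)
  have hX' := contDiffAt_loc hd hX
  rw [← locMap_apply hx] at hg hX'
  refine ContDiffAt.congr_of_eventuallyEq ?_ h
  exact ((isMetricOn_gloc x).contDiffAt_sharp ((ch m x).map_source hx)).clm_apply
    (((hg.comp _ hF).clm_apply (hX'.comp _ hF)).clm_comp (hF.fderiv_right (m := ∞) (by simp)))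

theorem diff_nabla (hY : SmoothFieldAt Y x) (v : TangentSpace (𝓡 m) x)
    (h : secondFundamentalForm (n := n) φ x v (Y x) = 0) :
    diff (m := m) (n := n) φ x (nabla Y x v) =
      nablaAlong φ (fun y ↦ diff (m := m) (n := n) φ y (Y y)) x v := by
  rw [← sff_eq hφ.smooth hY] at h
  exact (sub_eq_zero.1 h).symm

/-- As B vanishes on horizontal pairs, dφ(∇_v Z) is the derivative of dφ(Z) for horizontal v and Z,
and horizontal projections disappear under dφ. So each summand is the Hessian of X ∘ φ on (e_i,
e_i), which is that of X on the images because B(e_i, e_i) = 0; these images are an orthonormal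
basis. -/
theorem frameExpression_eq {U : Set M} {e : Fin n → VField m M}
    {f : Fin (m - n) → VField m M} (h : IsAdaptedFrame φ U e f) (hx : x ∈ U)
    {X : VField n N} (hX : ∀ y, SmoothFieldAt X (φ y))
    (hY : ∀ y, Y y ∈ (vertical (m := m) (n := n) φ y)ᗮ)
    (hXY : ∀ y, diff (m := m) (n := n) φ y (Y y) = X (φ y)) :
    frameExpression φ e Y x = traceHessian X (φ x) - ((m : ℝ) - n) • nabla X (φ x) (X (φ x))
      + ricci (φ x) (X (φ x)) := by
  have hXe : ∀ᶠ q in 𝓝 (φ x), SmoothFieldAt X q := by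
    filter_upwards [hφ.isOpen_range.mem_nhds (mem_range_self x)]
    rintro _ ⟨y, rfl⟩
    exact hX y
  have hYs (y : M) : SmoothFieldAt Y y := hφ.smoothFieldAt_of_lift (hX y) hY hXY
  have hdY : (fun y ↦ diff (m := m) (n := n) φ y (Y y)) = fun y ↦ X (φ y) := funext hXY
  have hes (i : Fin n) : ∀ y ∈ U, SmoothFieldAt (e i) y :=
    (smoothOn_iff h.isOpen).1 (h.smooth_hor i)
  have hU := h.isOpen.mem_nhds hx
  have hsm : ∀ᶠ y in 𝓝 x, SmoothAlongAt m φ (fun y ↦ X (φ y)) y :=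
    Eventually.of_forall fun y ↦ SmoothFieldAt.comp hφ.smooth.contMDiffAt (hX y)
  have hdn (y : M) (v : TangentSpace (𝓡 m) y) (hv : v ∈ (vertical (m := m) (n := n) φ y)ᗮ) :
      diff (m := m) (n := n) φ y (nabla Y y v) = nablaAlong φ (fun y ↦ X (φ y)) y v := by
    rw [hφ.diff_nabla (hYs y) v (hφ.sff_eq_zero hv (hY y)), hdY]
  have h1 (i : Fin n) : diff (m := m) (n := n) φ x
      (nabla (fun y ↦ hor (m := m) (n := n) φ y (nabla Y y (e i y))) x (e i x)) =
      nablaAlong φ (nablaAlongField φ (e i) fun y ↦ X (φ y)) x (e i x) := by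
    refine (hφ.diff_nabla (hφ.smoothFieldAt_hor (Y := nablaField (e i) Y)
      (SmoothFieldAt.nablaField (hes i x hx) (Eventually.of_forall hYs))) _
      (hφ.sff_eq_zero (h.mem_hor i x hx) (hor_mem φ x _))).trans ?_
    apply nablaAlong_congr
    filter_upwards [hU] with y hy
    rw [diff_hor]
    exact hdn y _ (h.mem_hor i y hy)
  have h2 (i : Fin n) : diff (m := m) (n := n) φ x
      (nabla Y x (hor (m := m) (n := n) φ x (nabla (e i) x (e i x)))) =
      nablaAlong φ (fun y ↦ X (φ y)) x (nabla (e i) x (e i x)) := by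
    rw [hdn x _ (hor_mem φ x _), nablaAlong_comp hφ.smooth (hX x), diff_hor,
      nablaAlong_comp hφ.smooth (hX x)]
  have h3 (i : Fin n) : diff (m := m) (n := n) φ x
      (nabla (fun y ↦ hor (m := m) (n := n) φ y (nabla Y y (e i y))) x (e i x)
        - nabla Y x (hor (m := m) (n := n) φ x (nabla (e i) x (e i x)))) =
      hessField X (φ x) (diff (m := m) (n := n) φ x (e i x))
        (diff (m := m) (n := n) φ x (e i x)) := by
    rw [map_sub, h1, h2, hessAlong_eq hφ.smooth (hes i x hx) hsm, hessAlong_comp hφ.smooth hXe,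
      hφ.sff_eq_zero (h.mem_hor i x hx) (h.mem_hor i x hx)]
    have := nabla_smul_apply (hX x) 0 0
    rw [zero_smul, zero_smul] at this
    rw [this, add_zero]
  have hq := hφ.sum_inner_diff (hφ.isParseval_of_isAdaptedFrame h hx)
    (fun i ↦ h.mem_hor i x hx) (fun s ↦ h.mem_ver s x hx)
  rw [frameExpression, map_sub, map_sum, Finset.sum_congr rfl fun i _ ↦ h3 i,
    ← traceHessian_eq_sum hXe hq, map_smul, hdn x _ (hY x), nablaAlong_comp hφ.smooth (hX x), hXY]

/-- The frame expression in terms of the tension field. -/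
theorem frameExpression_meanCurvature {U : Set M} {e : Fin n → VField m M}
    {f : Fin (m - n) → VField m M} (h : IsAdaptedFrame φ U e f) (hx : x ∈ U)
    {T : VField n N} (hT : ∀ x, tension (m := m) (n := n) φ x = T (φ x)) :
    frameExpression φ e (meanCurvature (m := m) (n := n) φ) x =
      -((m : ℝ) - n)⁻¹ • bitension (m := m) (n := n) φ x := by
  set a : ℝ := -((m : ℝ) - n)⁻¹ with ha
  have hs := hφ.eventually_smoothFieldAt_of_tension hT x
  rw [hφ.frameExpression_eq h hx (X := fun q ↦ a • T q)
    (fun y ↦ (hφ.smoothFieldAt_of_tension hT y).smul a) hφ.meanCurvature_mem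
    fun y ↦ by rw [hφ.diff_meanCurvature, hT], hφ.bitension_eq hT, traceHessian_smul hs,
    nabla_smul hs.self_of_nhds, nabla_smul_apply hs.self_of_nhds, ricci_smul, smul_add, smul_add,
    smul_smul, smul_smul, sub_eq_add_neg, ← neg_smul]
  congr 3
  rw [ha]
  -- The scalar identity -(m - n)a² = a, which converts the quadratic term. For m = n it holds
  -- because a = 0.
  by_cases h0 : (m : ℝ) - n = 0
  · simp [h0]
  · field_simp

/-- For m = n the tension field vanishes, so T may be replaced by 0 • T and every term scales to
zero. This is needed because the factor -(m - n)⁻¹ of the frame expression is then 0 and carries no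
information. -/
theorem bitension_eq_zero_of_eq {T : VField n N} (hmn : (m : ℝ) - n = 0)
    (hT : ∀ x, tension (m := m) (n := n) φ x = T (φ x)) (x : M) :
    bitension (m := m) (n := n) φ x = 0 := by
  have hs := hφ.eventually_smoothFieldAt_of_tension hT x
  rw [hφ.bitension_eq (T := fun q ↦ (0 : ℝ) • T q) (fun x ↦ by
    rw [hφ.tension_eq, hmn, neg_zero, zero_smul, zero_smul]), traceHessian_smul hs,
    nabla_smul hs.self_of_nhds, ricci_smul, zero_smul, zero_smul, zero_smul, add_zero, add_zero]

theorem frameExpression_eq_zero_iff {U : Set M} {e : Fin n → VField m M}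
    {f : Fin (m - n) → VField m M} (h : IsAdaptedFrame φ U e f) (hx : x ∈ U)
    {T : VField n N} (hT : ∀ x, tension (m := m) (n := n) φ x = T (φ x)) :
    frameExpression φ e (meanCurvature (m := m) (n := n) φ) x = 0 ↔
      bitension (m := m) (n := n) φ x = 0 := by
  rw [hφ.frameExpression_meanCurvature h hx hT]
  by_cases h0 : (m : ℝ) - n = 0
  · simp [hφ.bitension_eq_zero_of_eq h0 hT]
  · rw [smul_eq_zero_iff_right (neg_ne_zero.2 (inv_ne_zero h0))]

end IsRiemannianSubmersion

end Tension

/-! ### The density under a linear change of variables -/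

section DensityChange

variable {E : Type*} [NormedAddCommGroup E] [NormedSpace ℝ E] {ι : Type*} [Fintype ι]
  [DecidableEq ι]

/-- The Gram matrix changes from G to AᵀGA, so its determinant is multiplied by det(A)². -/
theorem dens_comp (b : Module.Basis ι ℝ E) {g g' : E → E →L[ℝ] E →L[ℝ] ℝ} {u v : E} (A : E →L[ℝ] E)
    (h : ∀ x y, g' v x y = g u (A x) (A y)) : dens b g' v = |A.det| * dens b g u := by
  have e1 (g : E → E →L[ℝ] E →L[ℝ] ℝ) (u : E) :
      gram b g u = LinearMap.toMatrix₂ b b (ContinuousLinearMap.toLinearMap₁₂ (g u)) := by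
    ext i j
    simp [gram, LinearMap.toMatrix₂_apply]
  have e2 : ContinuousLinearMap.toLinearMap₁₂ (g' v) =
      (ContinuousLinearMap.toLinearMap₁₂ (g u)).compl₁₂ (A : E →ₗ[ℝ] E) (A : E →ₗ[ℝ] E) := by
    ext x y
    simpa using h x y
  have e3 : (gram b g' v).det = A.det ^ 2 * (gram b g u).det := by
    rw [e1, e2, LinearMap.toMatrix₂_compl₁₂ b b, ← e1, Matrix.det_mul, Matrix.det_mul,
      Matrix.det_transpose, LinearMap.det_toMatrix, ContinuousLinearMap.det]
    ring
  rw [dens, dens, e3, Real.sqrt_mul (sq_nonneg _), Real.sqrt_sq_eq_abs]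

end DensityChange

/-! ### The Riemannian volume in a chart -/

section Volume

variable {m : ℕ}
  {M : Type*} [TopologicalSpace M] [ChartedSpace (EuclideanSpace ℝ (Fin m)) M]
  [IsManifold (𝓡 m) ∞ M] [RiemannianBundle (fun x : M ↦ TangentSpace (𝓡 m) x)]
  [IsContMDiffRiemannianBundle (𝓡 m) ∞ (EuclideanSpace ℝ (Fin m))
      (fun x : M ↦ TangentSpace (𝓡 m) x)]

/-- The density of the volume in a chart. -/
def densAt (m : ℕ) {M : Type*} [TopologicalSpace M] [ChartedSpace (EuclideanSpace ℝ (Fin m)) M]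
    [IsManifold (𝓡 m) ∞ M] [RiemannianBundle (fun x : M ↦ TangentSpace (𝓡 m) x)] (c : M) :
    EuclideanSpace ℝ (Fin m) → ℝ :=
  dens (stdB m) (gloc c)

theorem volumeDensity_eq (c : M) {u : EuclideanSpace ℝ (Fin m)} (hu : u ∈ (ch m c).target) :
    volumeDensity c u = densAt m c u := by
  rw [volumeDensity, densAt, dens, gram]
  congr 2
  ext i j
  simp only [Matrix.of_apply]
  rw [mfderiv_ch_symm hu, mfderiv_ch_symm hu, gloc_apply]
  simp [stdB]

theorem contDiffAt_densAt {c : M} {u : EuclideanSpace ℝ (Fin m)} (hu : u ∈ (ch m c).target) :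
    ContDiffAt ℝ ∞ (densAt m c) u := contDiffAt_dens _ (isMetricOn_gloc c) hu

theorem densAt_pos {c : M} {u : EuclideanSpace ℝ (Fin m)} (hu : u ∈ (ch m c).target) :
    0 < densAt m c u := Real.sqrt_pos.2 (det_gram_pos _ (isMetricOn_gloc c) hu)

/-- Transformation of the density under a change of charts. -/
theorem densAt_change {c d x : M} (hc : x ∈ (ch m c).source) (hd : x ∈ (ch m d).source) :
    densAt m d (ch m d x) =
      |(fderiv ℝ (locMap m m d c (id : M → M)) (ch m d x)).det| * densAt m c (ch m c x) := by
  refine dens_comp _ _ fun v w ↦ ?_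
  have h (v : EuclideanSpace ℝ (Fin m)) :
      fderiv ℝ (locMap m m d c (id : M → M)) (ch m d x) v = toE c x (ofE d x v) := by
    have := toE_diff (m := m) (n := m) (φ := (id : M → M)) (mdifferentiableAt_id) hd hc
      (ofE d x v)
    rw [toE_ofE hd, diff, mfderiv_id] at this
    exact this.symm
  rw [h, h, gloc_eq_inner hd, gloc_toE hc]

variable [T2Space M] [SigmaCompactSpace M] [MeasurableSpace M] [BorelSpace M]

theorem chartPartition_subordinate (c : M) :
    tsupport (chartPartition (m := m) M c) ⊆ (ch m c).source :=
  Classical.choose_spec (SmoothPartitionOfUnity.exists_isSubordinate_chartAt_source (𝓡 m) M) c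

theorem aemeasurable_ch_symm (c : M) :
    AEMeasurable (ch m c).symm (volume.restrict (ch m c).target) :=
  (ch m c).continuousOn_symm.aemeasurable (ch m c).open_target.measurableSet

/-- Change of variables on the overlap of the charts at c and d: the Jacobian is exactly the ratio
of the densities. Beyond the overlap nothing is lost, since f vanishes off the chart at d and the
partition function at c vanishes off the chart at c. -/
theorem lintegral_piece {d : M} (c : M) {f : M → ENNReal} (hf : Measurable f)
    (hs : ∀ x ∉ (ch m d).source, f x = 0) :
    ∫⁻ x, f x ∂(((volume.restrict (ch m c).target).withDensity fun u ↦
      ENNReal.ofReal (chartPartition (m := m) M c ((ch m c).symm u) * volumeDensity c u)).map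
        (ch m c).symm) =
    ∫⁻ u in (ch m d).target, ENNReal.ofReal (chartPartition (m := m) M c ((ch m d).symm u)) *
      (f ((ch m d).symm u) * ENNReal.ofReal (densAt m d u)) := by
  set ρ := chartPartition (m := m) M c
  set A := (ch m d).target ∩ (ch m d).symm ⁻¹' (ch m c).source with hA
  have hAo : IsOpen A := (ch m d).isOpen_inter_preimage_symm (ch m c).open_source
  set B := (ch m c).target ∩ (ch m c).symm ⁻¹' (ch m d).source with hB
  have hBo : IsOpen B := (ch m c).isOpen_inter_preimage_symm (ch m d).open_source
  set T := locMap m m d c (id : M → M)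
  have hT : ∀ u ∈ A, T u = ch m c ((ch m d).symm u) := fun u _ ↦ rfl
  have hTd : ∀ u ∈ A, HasFDerivWithinAt T (fderiv ℝ T u) A u := fun u hu ↦ by
    have h1 := contDiffAt_locMap (m := m) (n := m) (φ := (id : M → M)) (x := (ch m d).symm u)
      contMDiffAt_id ((ch m d).map_target hu.1) hu.2
    rw [(ch m d).right_inv hu.1] at h1
    exact (h1.differentiableAt (by simp)).hasFDerivAt.hasFDerivWithinAt
  have hTi : InjOn T A := fun u hu v hv h ↦ by
    rw [hT u hu, hT v hv] at h
    exact (ch m d).symm.injOn hu.1 hv.1 ((ch m c).injOn hu.2 hv.2 h)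
  have hTB : T '' A = B := by
    ext w
    constructor
    · rintro ⟨u, hu, rfl⟩
      rw [hT u hu]
      refine ⟨(ch m c).map_source hu.2, ?_⟩
      rw [mem_preimage, (ch m c).left_inv hu.2]
      exact (ch m d).map_target hu.1
    · rintro ⟨h1, h2⟩
      have h3 : (ch m d).symm (ch m d ((ch m c).symm w)) = (ch m c).symm w :=
        (ch m d).left_inv h2
      have hu : ch m d ((ch m c).symm w) ∈ A := by
        refine ⟨(ch m d).map_source h2, ?_⟩
        rw [mem_preimage, h3]
        exact (ch m c).map_target h1
      exact ⟨_, hu, by rw [hT _ hu, h3, (ch m c).right_inv h1]⟩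
  have hρc : Continuous fun x ↦ ρ x := ρ.contMDiff.continuous
  have hac : (volume.restrict (ch m c).target).withDensity (fun u ↦
      ENNReal.ofReal (ρ ((ch m c).symm u) * volumeDensity c u)) ≪
      volume.restrict (ch m c).target := withDensity_absolutelyContinuous _ _
  have hdc : AEMeasurable (fun u ↦ ENNReal.ofReal (ρ ((ch m c).symm u) * volumeDensity c u))
      (volume.restrict (ch m c).target) := by
    have h1 : ContinuousOn (fun u ↦ ENNReal.ofReal (ρ ((ch m c).symm u) * volumeDensity c u))
        (ch m c).target := by
      refine ENNReal.continuous_ofReal.comp_continuousOn ((hρc.comp_continuousOn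
        (ch m c).continuousOn_symm).mul ?_)
      refine ContinuousOn.congr (f := densAt m c) (fun u hu ↦
        (contDiffAt_densAt hu).continuousAt.continuousWithinAt) fun u hu ↦ volumeDensity_eq c hu
    exact h1.aemeasurable (ch m c).open_target.measurableSet
  have hfc : AEMeasurable (fun u ↦ f ((ch m c).symm u)) (volume.restrict (ch m c).target) :=
    hf.comp_aemeasurable (aemeasurable_ch_symm c)
  rw [lintegral_map' hf.aemeasurable ((aemeasurable_ch_symm c).mono_ac hac),
    lintegral_withDensity_eq_lintegral_mul₀ hdc hfc]
  have h1 : ∫⁻ u in (ch m c).target, ((fun u ↦ ENNReal.ofReal (ρ ((ch m c).symm u) *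
      volumeDensity c u)) * fun u ↦ f ((ch m c).symm u)) u =
      ∫⁻ u in B, ENNReal.ofReal (ρ ((ch m c).symm u) * densAt m c u) * f ((ch m c).symm u) := by
    rw [← lintegral_indicator (ch m c).open_target.measurableSet,
      ← lintegral_indicator hBo.measurableSet]
    congr 1
    ext u
    by_cases hu : u ∈ (ch m c).target
    · rw [indicator_of_mem hu]
      by_cases hu' : (ch m c).symm u ∈ (ch m d).source
      · have hB' : u ∈ B := ⟨hu, hu'⟩
        rw [indicator_of_mem hB']
        simp [volumeDensity_eq c hu]
      · rw [indicator_of_notMem fun h : u ∈ B ↦ hu' h.2]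
        simp [hs _ hu']
    · rw [indicator_of_notMem hu, indicator_of_notMem fun h : u ∈ B ↦ hu h.1]
  rw [h1, ← hTB, lintegral_image_eq_lintegral_abs_det_fderiv_mul volume hAo.measurableSet hTd hTi,
    ← lintegral_indicator (ch m d).open_target.measurableSet,
    ← lintegral_indicator hAo.measurableSet]
  congr 1
  ext u
  by_cases hu : u ∈ (ch m d).target
  · rw [indicator_of_mem hu]
    by_cases hu' : (ch m d).symm u ∈ (ch m c).source
    · have hA' : u ∈ A := ⟨hu, hu'⟩
      have h2 : (ch m c).symm (T u) = (ch m d).symm u := by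
        rw [hT u hA', (ch m c).left_inv hu']
      have h3 := densAt_change hu' ((ch m d).map_target hu)
      rw [(ch m d).right_inv hu] at h3
      rw [indicator_of_mem hA', h2, h3, ENNReal.ofReal_mul ((chartPartition (m := m) M).nonneg c _), ENNReal.ofReal_mul (abs_nonneg _), hT u hA']
      ring
    · rw [indicator_of_notMem fun h : u ∈ A ↦ hu' h.2]
      have : ρ ((ch m d).symm u) = 0 := by
        by_contra h
        exact hu' (chartPartition_subordinate c (subset_tsupport _ h))
      rw [this]
      simp
  · rw [indicator_of_notMem hu, indicator_of_notMem fun h : u ∈ A ↦ hu h.1]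

/-- The Riemannian volume in a chart. -/
theorem lintegral_volume {d : M} {f : M → ENNReal} (hf : Measurable f)
    (hs : ∀ x ∉ (ch m d).source, f x = 0) :
    ∫⁻ x, f x ∂(riemannianVolume m M) =
      ∫⁻ u in (ch m d).target, f ((ch m d).symm u) * ENNReal.ofReal (densAt m d u) := by
  have h1 : ∫⁻ x, f x ∂(riemannianVolume m M) = ∑' c : M,
      ∫⁻ u in (ch m d).target, ENNReal.ofReal (chartPartition (m := m) M c ((ch m d).symm u)) *
        (f ((ch m d).symm u) * ENNReal.ofReal (densAt m d u)) := by
    rw [riemannianVolume, lintegral_sum_measure]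
    exact tsum_congr fun c ↦ lintegral_piece c hf hs
  -- The volume is a sum over all points c of M, an index set that may be uncountable. By local
  -- finiteness on a σ-compact space only countably many partition functions are nonzero, which
  -- permits exchanging the sum with the integral.
  set S : Set M := {c | (Function.support (chartPartition (m := m) M c)).Nonempty} with hS
  have hz (c : M) (hc : c ∉ S) (x : M) : chartPartition (m := m) M c x = 0 := by
    by_contra h
    exact hc ⟨x, h⟩
  have : Countable S := Set.countable_univ_iff.1 (LocallyFinite.countable_univ
    (f := fun c : S ↦ Function.support (chartPartition (m := m) M c))
    ((chartPartition (m := m) M).locallyFinite.comp_injective Subtype.val_injective) fun c ↦ c.2)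
  have hdm : AEMeasurable (fun u ↦ ENNReal.ofReal (densAt m d u))
      (volume.restrict (ch m d).target) := by
    refine ContinuousOn.aemeasurable (fun u hu ↦ ?_) (ch m d).open_target.measurableSet
    exact (ENNReal.continuous_ofReal.continuousAt.comp
      (contDiffAt_densAt hu).continuousAt).continuousWithinAt
  have hfm : AEMeasurable (fun u ↦ f ((ch m d).symm u)) (volume.restrict (ch m d).target) :=
    hf.comp_aemeasurable (aemeasurable_ch_symm d)
  rw [h1, ← tsum_subtype_eq_of_support_subset (s := S), ← lintegral_tsum]
  · refine lintegral_congr fun u ↦ ?_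
    rw [ENNReal.tsum_mul_right]
    have h2 : ∑' c : S, ENNReal.ofReal (chartPartition (m := m) M c ((ch m d).symm u)) = 1 := by
      rw [tsum_subtype_eq_of_support_subset (s := S)
        (f := fun c ↦ ENNReal.ofReal (chartPartition (m := m) M c ((ch m d).symm u)))]
      · set x := (ch m d).symm u
        have h3 := (chartPartition (m := m) M).sum_finsupport x (mem_univ x)
        rw [tsum_eq_sum (s := (chartPartition (m := m) M).finsupport x), ←
          ENNReal.ofReal_sum_of_nonneg, h3, ENNReal.ofReal_one]
        · exact fun c _ ↦ (chartPartition (m := m) M).nonneg c x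
        · intro c hc
          rw [SmoothPartitionOfUnity.mem_finsupport, Function.notMem_support] at hc
          rw [hc, ENNReal.ofReal_zero]
      · intro c hc
        by_contra h
        exact hc (by simp [hz c h])
    rw [h2, one_mul]
  · intro c
    refine AEMeasurable.mul ?_ (hfm.mul hdm)
    exact (ENNReal.continuous_ofReal.comp
      (chartPartition (m := m) M c).contMDiff.continuous).measurable.comp_aemeasurable
      (aemeasurable_ch_symm d)
  · intro c hc
    by_contra h
    exact hc (by simp [hz c h])

theorem aemeasurable_densAt (d : M) : AEMeasurable (fun u ↦ ENNReal.ofReal (densAt m d u))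
    (volume.restrict (ch m d).target) := by
  refine ContinuousOn.aemeasurable (fun u hu ↦ ?_) (ch m d).open_target.measurableSet
  exact (ENNReal.continuous_ofReal.continuousAt.comp
    (contDiffAt_densAt hu).continuousAt).continuousWithinAt

theorem volume_apply {d : M} {A : Set M} (hA : MeasurableSet A) (hs : A ⊆ (ch m d).source) :
    riemannianVolume m M A = ∫⁻ u in (ch m d).target,
      A.indicator 1 ((ch m d).symm u) * ENNReal.ofReal (densAt m d u) := by
  rw [← lintegral_volume (measurable_one.indicator hA)
    fun x hx ↦ indicator_of_notMem (fun h ↦ hx (hs h)) _, lintegral_indicator_one hA]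

theorem restrict_volume (d : M) :
    (riemannianVolume m M).restrict (ch m d).source =
      ((volume.restrict (ch m d).target).withDensity fun u ↦
        ENNReal.ofReal (densAt m d u)).map (ch m d).symm := by
  have hac : (volume.restrict (ch m d).target).withDensity
      (fun u ↦ ENNReal.ofReal (densAt m d u)) ≪ volume.restrict (ch m d).target :=
    withDensity_absolutelyContinuous _ _
  have hm := aemeasurable_ch_symm (m := m) d
  ext A hA
  have h1 : Measurable (A.indicator (1 : M → ENNReal)) := measurable_one.indicator hA
  have h2 : AEMeasurable (fun u ↦ A.indicator (1 : M → ENNReal) ((ch m d).symm u))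
    (volume.restrict (ch m d).target) := h1.comp_aemeasurable hm
  rw [Measure.restrict_apply hA, volume_apply (d := d)
    (hA.inter (ch m d).open_source.measurableSet) inter_subset_right,
    ← lintegral_indicator_one hA, lintegral_map' h1.aemeasurable (hm.mono_ac hac),
    lintegral_withDensity_eq_lintegral_mul₀ (aemeasurable_densAt d) h2]
  refine setLIntegral_congr_fun (ch m d).open_target.measurableSet fun u hu ↦ ?_
  have h2 := (ch m d).map_target hu
  simp only [Pi.mul_apply]
  rw [mul_comm]
  by_cases h : (ch m d).symm u ∈ A
  · have h3 : (ch m d).symm u ∈ A ∩ (ch m d).source := ⟨h, h2⟩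
    rw [indicator_of_mem h, indicator_of_mem h3]
  · rw [indicator_of_notMem h, indicator_of_notMem fun h' ↦ h h'.1]

/-- The density is continuous, hence integrable on a compact neighborhood inside the chart. -/
theorem isLocallyFiniteMeasure_volume : IsLocallyFiniteMeasure (riemannianVolume m M) where
  finiteAtNhds x := by
    have hx := mem_ch_source (m := m) x
    obtain ⟨K, hKc, hxK, hK⟩ := exists_compact_subset (ch m x).open_target
      ((ch m x).map_source hx)
    set W := (ch m x).source ∩ ch m x ⁻¹' interior K
    have hW : IsOpen W := (ch m x).isOpen_inter_preimage isOpen_interior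
    refine ⟨W, hW.mem_nhds ⟨hx, hxK⟩, ?_⟩
    rw [volume_apply hW.measurableSet inter_subset_left]
    have hc : ContinuousOn (densAt m x) K := fun u hu ↦
      (contDiffAt_densAt (hK hu)).continuousAt.continuousWithinAt
    have hi : IntegrableOn (densAt m x) K volume := hc.integrableOn_compact hKc
    refine lt_of_le_of_lt ?_ hi.lintegral_lt_top
    rw [← lintegral_indicator (ch m x).open_target.measurableSet,
      ← lintegral_indicator hKc.measurableSet]
    refine lintegral_mono fun u ↦ ?_
    by_cases hu : u ∈ (ch m x).target
    · rw [indicator_of_mem hu]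
      by_cases h : (ch m x).symm u ∈ W
      · have h2 := h.2
        rw [mem_preimage, (ch m x).right_inv hu] at h2
        rw [indicator_of_mem h, indicator_of_mem (interior_subset h2), Pi.one_apply, one_mul]
      · rw [indicator_of_notMem h, zero_mul]
        exact zero_le
    · rw [indicator_of_notMem hu]
      exact zero_le

/-- The density is positive, so a nonempty open set of zero volume would have a nonempty open image
of zero Lebesgue measure in some chart. -/
theorem isOpenPosMeasure_volume : (riemannianVolume m M).IsOpenPosMeasure where
  open_pos U hU hne h := by
    obtain ⟨x, hxU⟩ := hne
    have hx := mem_ch_source (m := m) x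
    set W := U ∩ (ch m x).source
    have hW : IsOpen W := hU.inter (ch m x).open_source
    have h1 : AEMeasurable (fun u ↦ W.indicator (1 : M → ENNReal) ((ch m x).symm u))
        (volume.restrict (ch m x).target) :=
      (measurable_one.indicator hW.measurableSet).comp_aemeasurable (aemeasurable_ch_symm x)
    have h1' : AEMeasurable (fun u ↦ W.indicator (1 : M → ENNReal) ((ch m x).symm u) *
      ENNReal.ofReal (densAt m x u)) (volume.restrict (ch m x).target) :=
      h1.mul (aemeasurable_densAt x)
    have h0 : riemannianVolume m M W = 0 := measure_mono_null inter_subset_left h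
    rw [volume_apply hW.measurableSet inter_subset_right, lintegral_eq_zero_iff'
      h1', EventuallyEq,
      ae_restrict_iff' (ch m x).open_target.measurableSet] at h0
    have hO := (ch m x).isOpen_inter_preimage_symm hW
    have hO0 : (volume : Measure (EuclideanSpace ℝ (Fin m)))
        ((ch m x).target ∩ (ch m x).symm ⁻¹' W) = 0 := by
      refine measure_mono_null (fun u hu ↦ ?_) (ae_iff.1 h0)
      have hu2 : (ch m x).symm u ∈ W := hu.2
      rw [mem_ofPred_eq, Classical.not_imp]
      refine ⟨hu.1, ?_⟩
      rw [indicator_of_mem hu2, Pi.one_apply, one_mul, Pi.zero_apply, ENNReal.ofReal_eq_zero,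
        not_le]
      exact densAt_pos hu.1
    refine hO.measure_ne_zero volume ⟨ch m x x, (ch m x).map_source hx, ?_⟩ hO0
    rw [mem_preimage, (ch m x).left_inv hx]
    exact ⟨hxU, hx⟩

theorem integral_volume {d : M} {f : M → ℝ} (hf : Continuous f)
    (hs : ∀ x ∉ (ch m d).source, f x = 0) :
    ∫ x, f x ∂(riemannianVolume m M) =
      ∫ u in (ch m d).target, densAt m d u * f ((ch m d).symm u) := by
  have hac : (volume.restrict (ch m d).target).withDensity
      (fun u ↦ ENNReal.ofReal (densAt m d u)) ≪ volume.restrict (ch m d).target :=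
    withDensity_absolutelyContinuous _ _
  have hm := aemeasurable_ch_symm (m := m) d
  rw [← setIntegral_eq_integral_of_forall_compl_eq_zero hs, restrict_volume,
    integral_map (hm.mono_ac hac) hf.aestronglyMeasurable,
    integral_withDensity_eq_integral_toReal_smul₀ (aemeasurable_densAt d)
      (Eventually.of_forall fun _ ↦ ENNReal.ofReal_lt_top)]
  refine setIntegral_congr_fun (ch m d).open_target.measurableSet fun u hu ↦ ?_
  simp only [smul_eq_mul]
  rw [ENNReal.toReal_ofReal (densAt_pos hu).le]

end Volume

/-! ### The divergence theorem -/

section Divergence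

variable {m : ℕ}
  {M : Type*} [TopologicalSpace M] [ChartedSpace (EuclideanSpace ℝ (Fin m)) M]
  [IsManifold (𝓡 m) ∞ M] [RiemannianBundle (fun x : M ↦ TangentSpace (𝓡 m) x)]
  [IsContMDiffRiemannianBundle (𝓡 m) ∞ (EuclideanSpace ℝ (Fin m))
      (fun x : M ↦ TangentSpace (𝓡 m) x)]
  {X : VField m M} {c x : M}

/-- The divergence of a vector field. -/
def divg (X : VField m M) (x : M) : ℝ := ∑ k, inner ℝ (onb x k) (nabla X x (onb x k))

theorem divg_eq (hx : x ∈ (ch m c).source) (hX : SmoothFieldAt X x) :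
    divg X x = LinearMap.trace ℝ (EuclideanSpace ℝ (Fin m))
      (covD (chr m c) id (loc c X) (ch m c x)).toLinearMap := by
  rw [trace_eq_sum ((isParseval_onb x).toE hx)]
  refine Finset.sum_congr rfl fun k _ ↦ ?_
  rw [← toE_nabla hx hX, gloc_toE hx]

theorem divg_eq_zero (h : ∀ᶠ y in 𝓝 x, X y = 0) : divg X x = 0 := by
  have hl : loc x X =ᶠ[𝓝 (ch m x x)] fun _ ↦ 0 := by
    filter_upwards [eventually_symm (mem_ch_source x) h] with u hu
    rw [loc, hu, map_zero]
  have hX : SmoothFieldAt X x := by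
    rw [smoothFieldAt_iff (mem_ch_source x)]
    exact contDiffAt_const.congr_of_eventuallyEq hl
  have : covD (chr m x) id (fun _ ↦ (0 : EuclideanSpace ℝ (Fin m))) (ch m x x) = 0 := by
    ext1 v
    simp [covD_id_apply]
  rw [divg_eq (mem_ch_source x) hX, covD_congr EventuallyEq.rfl hl, this]
  exact map_zero _

theorem continuous_trace : Continuous fun A : EuclideanSpace ℝ (Fin m) →L[ℝ]
    EuclideanSpace ℝ (Fin m) ↦ LinearMap.trace ℝ (EuclideanSpace ℝ (Fin m)) A.toLinearMap :=
  LinearMap.continuous_of_finiteDimensional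
    (LinearMap.trace ℝ (EuclideanSpace ℝ (Fin m)) ∘ₗ ContinuousLinearMap.coeLM ℝ)

theorem continuous_divg (hX : ∀ x, SmoothFieldAt X x) : Continuous (divg X) := by
  rw [continuous_iff_continuousAt]
  intro x
  have hx := mem_ch_source (m := m) x
  have h1 : divg X =ᶠ[𝓝 x] fun y ↦ LinearMap.trace ℝ (EuclideanSpace ℝ (Fin m))
      (covD (chr m x) id (loc x X) (ch m x y)).toLinearMap := by
    filter_upwards [(ch m x).open_source.mem_nhds hx] with y hy using divg_eq hy (hX y)
  refine ContinuousAt.congr ?_ h1.symm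
  have h2 := contDiffAt_covD (F := id) (contDiffAt_chr ((ch m x).map_source hx)) contDiffAt_id
    (contDiffAt_loc hx (hX x))
  exact continuous_trace.continuousAt.comp (h2.continuousAt.comp ((ch m x).continuousAt hx))

theorem SmoothFieldAt.fun_smul {f : M → ℝ} (hf : ContMDiffAt (𝓡 m) 𝓘(ℝ, ℝ) ∞ f x)
    (hX : SmoothFieldAt X x) : SmoothFieldAt (fun y ↦ f y • X y) x := by
  have hx := mem_ch_source (m := m) x
  rw [smoothFieldAt_iff hx] at hX ⊢
  rw [contMDiffAt_iff_comp_symm le_rfl hx] at hf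
  refine (hf.smul hX).congr_of_eventuallyEq (Eventually.of_forall fun u ↦ ?_)
  simp [loc]

theorem divg_sum {ι : Type*} (s : Finset ι) {X : ι → VField m M}
    (hX : ∀ i ∈ s, SmoothFieldAt (X i) x) :
    divg (fun y ↦ ∑ i ∈ s, X i y) x = ∑ i ∈ s, divg (X i) x := by
  have hx := mem_ch_source (m := m) x
  have hl : loc x (fun y ↦ ∑ i ∈ s, X i y) = fun u ↦ ∑ i ∈ s, loc x (X i) u := by
    ext1 u
    simp [loc]
  have hs (i) (hi : i ∈ s) := contDiffAt_loc hx (hX i hi)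
  have hS : SmoothFieldAt (fun y ↦ ∑ i ∈ s, X i y) x := by
    rw [smoothFieldAt_iff hx, hl]
    exact ContDiffAt.sum hs
  have hc : covD (chr m x) id (fun u ↦ ∑ i ∈ s, loc x (X i) u) (ch m x x) =
      ∑ i ∈ s, covD (chr m x) id (loc x (X i)) (ch m x x) := by
    ext1 v
    rw [covD_id_apply, fderiv_fun_sum fun i hi ↦ (hs i hi).differentiableAt (by simp), map_sum,
      sum_apply, sum_apply, ← Finset.sum_add_distrib]
    exact Finset.sum_congr rfl fun i _ ↦ (covD_id_apply _ _ _ _).symm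
  rw [divg_eq hx hS, hl, hc, Finset.sum_congr rfl fun i hi ↦ divg_eq hx (hX i hi)]
  exact map_sum (LinearMap.trace ℝ (EuclideanSpace ℝ (Fin m)) ∘ₗ ContinuousLinearMap.coeLM ℝ) _ _

variable [T2Space M] [SigmaCompactSpace M] [MeasurableSpace M] [BorelSpace M]

/-- In the chart the integrand is the Euclidean divergence of the field multiplied by the density,
so the flat divergence theorem applies. -/
theorem integral_divg_of_chart (hX : ∀ x, SmoothFieldAt X x) {K : Set M} (hK : IsCompact K)
    (hs : ∀ x ∉ K, X x = 0) (hKc : K ⊆ (ch m c).source) :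
    ∫ x, divg X x ∂(riemannianVolume m M) = 0 := by
  have hz : ∀ x ∉ K, divg X x = 0 := fun x hx ↦ divg_eq_zero <| by
    filter_upwards [hK.isClosed.isOpen_compl.mem_nhds hx] with y hy using hs y hy
  rw [integral_volume (continuous_divg hX) fun x hx ↦ hz x fun h ↦ hx (hKc h)]
  -- Extension by zero outside the chart. It is C¹ because the field already vanishes off a compact
  -- subset of the target.
  set Y : EuclideanSpace ℝ (Fin m) → EuclideanSpace ℝ (Fin m) :=
    (ch m c).target.indicator fun u ↦ densAt m c u • loc c X u with hY
  set K' := ch m c '' K with hK'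
  have hK'c : IsCompact K' := hK.image_of_continuousOn ((ch m c).continuousOn.mono hKc)
  have hY0 : ∀ u ∉ K', Y u = 0 := fun u hu ↦ by
    by_cases h : u ∈ (ch m c).target
    · rw [hY, indicator_of_mem h, loc, hs _ fun h' ↦ hu ⟨_, h', (ch m c).right_inv h⟩, map_zero,
        smul_zero]
    · exact indicator_of_notMem h _
  have hYe {u} (hu : u ∉ K') : Y =ᶠ[𝓝 u] fun _ ↦ 0 := by
    filter_upwards [hK'c.isClosed.isOpen_compl.mem_nhds hu] with v hv using hY0 v hv
  have hYt {u} (hu : u ∈ (ch m c).target) : Y =ᶠ[𝓝 u] fun u ↦ densAt m c u • loc c X u := by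
    filter_upwards [(ch m c).open_target.mem_nhds hu] with v hv using indicator_of_mem hv _
  have hls {u} (hu : u ∈ (ch m c).target) : ContDiffAt ℝ ∞ (loc c X) u := by
    have := contDiffAt_loc ((ch m c).map_target hu) (hX ((ch m c).symm u))
    rwa [(ch m c).right_inv hu] at this
  have hYd : ContDiff ℝ 1 Y := by
    rw [contDiff_iff_contDiffAt]
    intro u
    by_cases hu : u ∈ K'
    · have hu' : u ∈ (ch m c).target := by
        obtain ⟨x, hx, rfl⟩ := hu
        exact (ch m c).map_source (hKc hx)
      exact (((contDiffAt_densAt hu').smul (hls hu')).of_le (by simp)).congr_of_eventuallyEq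
        (hYt hu')
    · exact contDiffAt_const.congr_of_eventuallyEq (hYe hu)
  have hYc : HasCompactSupport Y := HasCompactSupport.intro hK'c hY0
  have hc : ∀ u ∉ (ch m c).target, LinearMap.trace ℝ (EuclideanSpace ℝ (Fin m))
      (fderiv ℝ Y u).toLinearMap = 0 := by
    intro u hu
    have : u ∉ K' := by
      rintro ⟨x, hx, rfl⟩
      exact hu ((ch m c).map_source (hKc hx))
    rw [(hYe this).fderiv_eq]
    simp
  rw [← integral_trace_fderiv_eq_zero (volume : Measure (EuclideanSpace ℝ (Fin m))) hYd hYc,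
    ← setIntegral_eq_integral_of_forall_compl_eq_zero hc]
  refine setIntegral_congr_fun (ch m c).open_target.measurableSet fun u hu ↦ ?_
  have hu' := (ch m c).map_target hu
  have h1 := dens_mul_trace_covD (stdB m) (isMetricOn_gloc c) hu
    ((hls hu).differentiableAt (by simp))
  change densAt m c u * divg X ((ch m c).symm u) =
    LinearMap.trace ℝ (EuclideanSpace ℝ (Fin m)) (fderiv ℝ Y u).toLinearMap
  rw [(hYt hu).fderiv_eq, divg_eq hu' (hX _), (ch m c).right_inv hu]
  exact h1

/-- The divergence theorem. -/
theorem integral_divg_eq_zero (hX : ∀ x, SmoothFieldAt X x) {K : Set M} (hK : IsCompact K)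
    (hs : ∀ x ∉ K, X x = 0) :
    Integrable (divg X) (riemannianVolume m M) ∧
      ∫ x, divg X x ∂(riemannianVolume m M) = 0 := by
  have := isLocallyFiniteMeasure_volume (m := m) (M := M)
  have hint {X : VField m M} (hX : ∀ x, SmoothFieldAt X x) (hs : ∀ x ∉ K, X x = 0) :
      Integrable (divg X) (riemannianVolume m M) := by
    refine (continuous_divg hX).integrable_of_hasCompactSupport
      (HasCompactSupport.intro hK fun x hx ↦ divg_eq_zero ?_)
    filter_upwards [hK.isClosed.isOpen_compl.mem_nhds hx] with y hy using hs y hy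
  refine ⟨hint hX hs, ?_⟩
  set ρ := chartPartition (m := m) M
  -- Only finitely many partition functions meet K, so X is a finite sum of fields with compact
  -- support in a single chart.
  have hfin := ρ.locallyFinite.finite_nonempty_inter_compact hK
  set s := hfin.toFinset
  set Xc : M → VField m M := fun c y ↦ ρ c y • X y with hXc
  have hXs (c x : M) : SmoothFieldAt (Xc c) x := (hX x).fun_smul (ρ c).contMDiff.contMDiffAt
  have hX' : X = fun y ↦ ∑ c ∈ s, Xc c y := by
    ext1 y
    by_cases hy : y ∈ K
    · rw [hXc, ← Finset.sum_smul, ρ.sum_finsupport' y (mem_univ y), one_smul]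
      intro c hc
      rw [SmoothPartitionOfUnity.mem_finsupport] at hc
      exact hfin.mem_toFinset.2 ⟨y, hc, hy⟩
    · simp [hXc, hs y hy]
  have h0 (c x : M) (hx : x ∉ K) : Xc c x = 0 := by rw [hXc]; simp [hs x hx]
  rw [hX', integral_congr_ae (Eventually.of_forall fun x ↦ divg_sum s fun c _ ↦ hXs c x),
    integral_finsetSum s fun c _ ↦ hint (hXs c) (h0 c)]
  refine Finset.sum_eq_zero fun c _ ↦ ?_
  refine integral_divg_of_chart (hXs c) (hK.inter_right (isClosed_tsupport (ρ c))) (fun x hx ↦ ?_)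
    (inter_subset_right.trans (chartPartition_subordinate c))
  by_cases hxK : x ∈ K
  · have : ρ c x = 0 := by
      by_contra h
      exact hx ⟨hxK, subset_tsupport _ h⟩
    simp [hXc, this]
  · exact h0 c x hxK

end Divergence

/-! ### Green's identity in coordinates -/

section LocalAdjoint

variable {E E' : Type*} [NormedAddCommGroup E] [NormedSpace ℝ E] [FiniteDimensional ℝ E]
  [NormedAddCommGroup E'] [NormedSpace ℝ E'] [FiniteDimensional ℝ E']
  {g : E → E →L[ℝ] E →L[ℝ] ℝ} {h : E' → E' →L[ℝ] E' →L[ℝ] ℝ} {U : Set E} {U' : Set E'}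
  {F V τ : E → E'} {u : E}

/-- The form `v ↦ ⟨∇_v V, τ⟩ - ⟨V, ∇_v τ⟩`. -/
def adjForm (h : E' → E' →L[ℝ] E' →L[ℝ] ℝ) (F V τ : E → E') (q : E) : E →L[ℝ] ℝ :=
  h (F q) (τ q) ∘L covD (christoffel h) F V q - h (F q) (V q) ∘L covD (christoffel h) F τ q

theorem contDiffAt_adjForm (hh : IsMetricOn h U') (hFu : F u ∈ U') (hF : ContDiffAt ℝ ∞ F u)
    (hV : ContDiffAt ℝ ∞ V u) (hτ : ContDiffAt ℝ ∞ τ u) :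
    ContDiffAt ℝ ∞ (adjForm h F V τ) u := by
  have hm := (hh.contDiffAt hFu).comp u hF
  have hΓ := hh.contDiffAt_christoffel hFu
  exact ((hm.clm_apply hτ).clm_comp (contDiffAt_covD hΓ hF hV)).sub
    ((hm.clm_apply hV).clm_comp (contDiffAt_covD hΓ hF hτ))

/-- The divergence of the field dual to `adjForm`. -/
theorem covD_sharp_adjForm (hg : IsMetricOn g U) (hu : u ∈ U) (hh : IsMetricOn h U')
    (hFu : F u ∈ U') (hF : ContDiffAt ℝ ∞ F u)
    (hV : ContDiffAt ℝ ∞ V u) (hτ : ContDiffAt ℝ ∞ τ u) (v : E) :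
    g u v (covD (christoffel g) id (fun q ↦ sharp g q (adjForm h F V τ q)) u v) =
      h (F u) (covHom (christoffel g) (christoffel h) F (covD (christoffel h) F V) u v v) (τ u)
      - h (F u) (V u)
        (covHom (christoffel g) (christoffel h) F (covD (christoffel h) F τ) u v v) := by
  set X : E → E := fun q ↦ sharp g q (adjForm h F V τ q)
  have hΓ := hh.contDiffAt_christoffel hFu
  have hα := contDiffAt_adjForm hh hFu hF hV hτ
  have hX : ContDiffAt ℝ ∞ X u := (hg.contDiffAt_sharp hu).clm_apply hα
  have hSV := contDiffAt_covD hΓ hF hV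
  have hSτ := contDiffAt_covD hΓ hF hτ
  have hFd : DifferentiableAt ℝ F u := hF.differentiableAt (by simp)
  have hVd : DifferentiableAt ℝ V u := hV.differentiableAt (by simp)
  have hτd : DifferentiableAt ℝ τ u := hτ.differentiableAt (by simp)
  have hSVd : DifferentiableAt ℝ (covD (christoffel h) F V) u := hSV.differentiableAt (by simp)
  have hSτd : DifferentiableAt ℝ (covD (christoffel h) F τ) u := hSτ.differentiableAt (by simp)
  have hSVv : DifferentiableAt ℝ (fun q ↦ covD (christoffel h) F V q v) u :=
    hSVd.clm_apply (differentiableAt_const v)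
  have hSτv : DifferentiableAt ℝ (fun q ↦ covD (christoffel h) F τ q v) u :=
    hSτd.clm_apply (differentiableAt_const v)
  have hconst : covD (christoffel g) id (fun _ ↦ v) u v = christoffel g u v v := by
    simp [covD_id_apply]
  have e1 := fderiv_metric_apply hg (F := id) (σ := X) (τ := fun _ ↦ v) hu differentiableAt_id
    (hX.differentiableAt (by simp)) (differentiableAt_const v) v
  -- The pairing of X with the constant field v is differentiated in two ways. The products of first
  -- derivatives ⟨∇τ, ∇V⟩ cancel. So do the corrections involving Γ(v, v), present on both sides as
  -- v is not parallel.
  have e2 : (fun q ↦ g (id q) (X q) v) =ᶠ[𝓝 u] fun q ↦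
      h (F q) (τ q) (covD (christoffel h) F V q v)
        - h (F q) (V q) (covD (christoffel h) F τ q v) := by
    filter_upwards [hg.mem_nhds hu] with q hq using hg.apply_sharp hq _ _
  have hm : DifferentiableAt ℝ (fun q ↦ h (F q)) u :=
    ((hh.contDiffAt hFu).differentiableAt (by simp)).comp u hFd
  have e3 := fderiv_metric_apply hh hFu hFd hτd hSVv v
  have e4 := fderiv_metric_apply hh hFu hFd hVd hSτv v
  have e5 := covD_clm_apply (ΓM := christoffel g) (Γ := christoffel h) (F := F) hSVd
    (differentiableAt_const v) v
  have e6 := covD_clm_apply (ΓM := christoffel g) (Γ := christoffel h) (F := F) hSτd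
    (differentiableAt_const v) v
  rw [hconst, sub_eq_iff_eq_add] at e5 e6
  rw [e2.fderiv_eq, fderiv_fun_sub ((hm.clm_apply hτd).clm_apply hSVv)
    ((hm.clm_apply hVd).clm_apply hSτv), sub_apply, e3, e4, e5, e6, hconst, map_add,
    map_add, id, hg.apply_sharp hu, adjForm, sub_apply] at e1
  simp only [ContinuousLinearMap.comp_apply] at e1
  rw [hg.symm u hu, hh.symm _ hFu _ (τ u)]
  rw [hh.symm _ hFu (covD (christoffel h) F τ u v)] at e1
  linarith

theorem covD_sum {P : Type*} [NormedAddCommGroup P] [NormedSpace ℝ P] {ι : Type*} (s : Finset ι)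
    {Γ : E' → E' →L[ℝ] E' →L[ℝ] E'} {F : P → E'} {σ : ι → P → E'} {p : P}
    (hσ : ∀ i ∈ s, DifferentiableAt ℝ (σ i) p) (a : P) :
    covD Γ F (fun q ↦ ∑ i ∈ s, σ i q) p a = ∑ i ∈ s, covD Γ F (σ i) p a := by
  rw [covD_apply, fderiv_fun_sum hσ, map_sum, sum_apply, ← Finset.sum_add_distrib]
  exact Finset.sum_congr rfl fun i _ ↦ (covD_apply _ _ _ _ _).symm

end LocalAdjoint

/-! ### Green's identity for sections along a map -/

section AdjointField

variable {m n : ℕ}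
  {M : Type*} [TopologicalSpace M] [ChartedSpace (EuclideanSpace ℝ (Fin m)) M]
  [IsManifold (𝓡 m) ∞ M] [RiemannianBundle (fun x : M ↦ TangentSpace (𝓡 m) x)]
  [IsContMDiffRiemannianBundle (𝓡 m) ∞ (EuclideanSpace ℝ (Fin m))
      (fun x : M ↦ TangentSpace (𝓡 m) x)]
  {N : Type*} [TopologicalSpace N] [ChartedSpace (EuclideanSpace ℝ (Fin n)) N]
  [IsManifold (𝓡 n) ∞ N] [RiemannianBundle (fun x : N ↦ TangentSpace (𝓡 n) x)]
  [IsContMDiffRiemannianBundle (𝓡 n) ∞ (EuclideanSpace ℝ (Fin n))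
      (fun x : N ↦ TangentSpace (𝓡 n) x)]
  {c x : M} {d : N} {φ : M → N} {V τ : Along n φ}

/-- The field dual to `v ↦ ⟨∇_v V, τ⟩ - ⟨V, ∇_v τ⟩`. -/
def adjField (φ : M → N) (V τ : Along n φ) : VField m M := fun x ↦
  ∑ k, ((inner ℝ (τ x) (nablaAlong φ V x (onb x k)) : ℝ)
    - inner ℝ (V x) (nablaAlong φ τ x (onb x k))) • onb x k

theorem toE_adjField (hφ : ContMDiff (𝓡 m) (𝓡 n) ∞ φ) (hV : SmoothAlongAt m φ V x)
    (hτ : SmoothAlongAt m φ τ x) (hx : x ∈ (ch m c).source) (hd : φ x ∈ (ch n d).source) :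
    toE c x (adjField φ V τ x) = sharp (gloc c) (ch m c x) (adjForm (gloc d) (locMap m n c d φ)
      (locA c d φ V) (locA c d φ τ) (ch m c x)) := by
  have hu := (ch m c).map_source hx
  set α := adjForm (gloc d) (locMap m n c d φ) (locA c d φ V) (locA c d φ τ) (ch m c x) with hα
  have h1 (k) : (inner ℝ (τ x) (nablaAlong φ V x (onb x k)) : ℝ)
      - inner ℝ (V x) (nablaAlong φ τ x (onb x k)) = α (toE c x (onb x k)) := by
    rw [hα, adjForm, sub_apply, ContinuousLinearMap.comp_apply, ContinuousLinearMap.comp_apply,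
      locMap_apply hx, locA_apply hx, locA_apply hx, ← gloc_toE hd, ← gloc_toE hd,
      toE_nablaAlong hφ.contMDiffAt hV hx hd, toE_nablaAlong hφ.contMDiffAt hτ hx hd]
    rfl
  refine (isMetricOn_gloc c).eq_of_forall hu fun z ↦ ?_
  rw [(isMetricOn_gloc c).apply_sharp hu, adjField, map_sum, map_sum, sum_apply]
  conv_rhs => rw [← (isParseval_onb x).toE hx z, map_sum]
  refine Finset.sum_congr rfl fun k _ ↦ ?_
  rw [h1, map_smul, map_smul, smul_apply, map_smul, smul_eq_mul, smul_eq_mul, mul_comm]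

theorem loc_adjField (hφ : ContMDiff (𝓡 m) (𝓡 n) ∞ φ) (hV : ∀ x, SmoothAlongAt m φ V x)
    (hτ : ∀ x, SmoothAlongAt m φ τ x) (hx : x ∈ (ch m c).source) (hd : φ x ∈ (ch n d).source) :
    loc c (adjField φ V τ) =ᶠ[𝓝 (ch m c x)] fun u ↦ sharp (gloc c) u
      (adjForm (gloc d) (locMap m n c d φ) (locA c d φ V) (locA c d φ τ) u) := by
  have h0 := hφ.continuous.continuousAt.eventually ((ch n d).open_source.mem_nhds hd)
  filter_upwards [eventually_nhds_chart hx h0] with u ⟨h1, h2, h3⟩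
  rw [loc, toE_adjField hφ (hV _) (hτ _) h2 h1, h3]

theorem smoothFieldAt_adjField (hφ : ContMDiff (𝓡 m) (𝓡 n) ∞ φ)
    (hV : ∀ x, SmoothAlongAt m φ V x) (hτ : ∀ x, SmoothAlongAt m φ τ x) (x : M) :
    SmoothFieldAt (adjField (m := m) (n := n) φ V τ) x := by
  have hx := mem_ch_source (m := m) x
  have hd := mem_ch_source (m := n) (φ x)
  rw [smoothFieldAt_iff hx]
  refine ContDiffAt.congr_of_eventuallyEq ?_ (loc_adjField hφ hV hτ hx hd)
  refine ((isMetricOn_gloc x).contDiffAt_sharp ((ch m x).map_source hx)).clm_apply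
    (contDiffAt_adjForm (isMetricOn_gloc (φ x)) ?_ (contDiffAt_locMap hφ.contMDiffAt hx hd)
      (contDiffAt_locA hφ.contMDiffAt hx hd (hV x)) (contDiffAt_locA hφ.contMDiffAt hx hd (hτ x)))
  rw [locMap_apply hx]
  exact (ch n _).map_source hd

/-- Green's identity: the trace of the second covariant derivative is symmetric up to a divergence,
the cross terms ⟨∇V, ∇τ⟩ being symmetric in V and τ. -/
theorem divg_adjField (hφ : ContMDiff (𝓡 m) (𝓡 n) ∞ φ)
    (hV : ∀ x, SmoothAlongAt m φ V x) (hτ : ∀ x, SmoothAlongAt m φ τ x) (x : M) :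
    divg (m := m) (adjField φ V τ) x = inner ℝ (traceHessianAlong (m := m) φ V x) (τ x)
      - inner ℝ (V x) (traceHessianAlong (m := m) φ τ x) := by
  have hx := mem_ch_source (m := m) x
  have hd := mem_ch_source (m := n) (φ x)
  have hu := (ch m x).map_source hx
  have hFu : locMap m n x (φ x) φ (ch m x x) ∈ (ch n (φ x)).target := by
    rw [locMap_apply hx]
    exact (ch n _).map_source hd
  have e (σ : Along n φ) : traceHessianAlong (m := m) φ σ x =
      ∑ k, hessAlong φ σ x (onb x k) (onb x k) := rfl
  rw [divg, e, e, sum_inner, inner_sum, ← Finset.sum_sub_distrib]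
  refine Finset.sum_congr rfl fun k _ ↦ ?_
  have h1 := covD_sharp_adjForm (isMetricOn_gloc x) hu (isMetricOn_gloc (φ x)) hFu
    (contDiffAt_locMap hφ.contMDiffAt hx hd) (contDiffAt_locA hφ.contMDiffAt hx hd (hV x))
    (contDiffAt_locA hφ.contMDiffAt hx hd (hτ x)) (toE x x (onb x k))
  have h2 := toE_hessAlong_apply hφ (Eventually.of_forall hV) hx hd (onb x k) (onb x k)
  have h3 := toE_hessAlong_apply hφ (Eventually.of_forall hτ) hx hd (onb x k) (onb x k)
  rw [chr, chr] at h2 h3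
  rw [← covD_congr EventuallyEq.rfl (loc_adjField hφ hV hτ hx hd), ← h2, ← h3,
    locA_apply hx, locA_apply hx, locMap_apply hx, gloc_toE hd, gloc_toE hd] at h1
  rw [← h1, ← gloc_toE hx, toE_nabla hx (smoothFieldAt_adjField hφ hV hτ x)]
  rfl

theorem adjField_eq_zero (h : ∀ᶠ y in 𝓝 x, V y = 0) (hφ : ContMDiff (𝓡 m) (𝓡 n) ∞ φ)
    (hV : SmoothAlongAt m φ V x) : adjField (m := m) φ V τ x = 0 := by
  have hx := mem_ch_source (m := m) x
  have hd := mem_ch_source (m := n) (φ x)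
  refine Finset.sum_eq_zero fun k _ ↦ ?_
  have h1 : locA x (φ x) φ V =ᶠ[𝓝 (ch m x x)] fun _ ↦ 0 := by
    filter_upwards [eventually_symm hx h] with u hu
    rw [locA, hu, map_zero]
  have h2 : nablaAlong φ V x (onb x k) = 0 := by
    apply toE_injective hd
    rw [toE_nablaAlong hφ.contMDiffAt hV hx hd, covD_congr EventuallyEq.rfl h1, covD_apply]
    simp
  rw [h2, h.self_of_nhds, inner_zero_right, inner_zero_left, sub_zero, zero_smul]

end AdjointField

/-! ### Smooth families of maps and the derivative of |τ|² -/

section Variation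

variable {m n : ℕ}
  {M : Type*} [TopologicalSpace M] [ChartedSpace (EuclideanSpace ℝ (Fin m)) M]
  [IsManifold (𝓡 m) ∞ M] [RiemannianBundle (fun x : M ↦ TangentSpace (𝓡 m) x)]
  [IsContMDiffRiemannianBundle (𝓡 m) ∞ (EuclideanSpace ℝ (Fin m))
      (fun x : M ↦ TangentSpace (𝓡 m) x)]
  {N : Type*} [TopologicalSpace N] [ChartedSpace (EuclideanSpace ℝ (Fin n)) N]
  [IsManifold (𝓡 n) ∞ N] [RiemannianBundle (fun x : N ↦ TangentSpace (𝓡 n) x)]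
  [IsContMDiffRiemannianBundle (𝓡 n) ∞ (EuclideanSpace ℝ (Fin n))
      (fun x : N ↦ TangentSpace (𝓡 n) x)]
  {c x : M} {d : N} {Φ : ℝ → M → N} {t : ℝ}

/-- A smooth family of maps. -/
abbrev IsSmoothFamily (m n : ℕ) {M N : Type*} [TopologicalSpace M]
    [ChartedSpace (EuclideanSpace ℝ (Fin m)) M] [TopologicalSpace N]
    [ChartedSpace (EuclideanSpace ℝ (Fin n)) N] (Φ : ℝ → M → N) : Prop :=
  ContMDiff (𝓘(ℝ, ℝ).prod (𝓡 m)) (𝓡 n) ∞ (fun p : ℝ × M ↦ Φ p.1 p.2)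

/-- A family of maps in charts. -/
def locVar (m n : ℕ) {M N : Type*} [TopologicalSpace M]
    [ChartedSpace (EuclideanSpace ℝ (Fin m)) M] [TopologicalSpace N]
    [ChartedSpace (EuclideanSpace ℝ (Fin n)) N] (c : M) (d : N) (Φ : ℝ → M → N)
    (p : ℝ × EuclideanSpace ℝ (Fin m)) : EuclideanSpace ℝ (Fin n) :=
  ch n d (Φ p.1 ((ch m c).symm p.2))

theorem locVar_apply (hx : x ∈ (ch m c).source) :
    locVar m n c d Φ (t, ch m c x) = ch n d (Φ t x) := by
  rw [locVar, (ch m c).left_inv hx]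

/-- The variation field of a family of maps. -/
def varField (n : ℕ) {M N : Type*} [TopologicalSpace N]
    [ChartedSpace (EuclideanSpace ℝ (Fin n)) N] (Φ : ℝ → M → N) : Along n (Φ 0) := fun x ↦
  mfderiv 𝓘(ℝ, ℝ) (𝓡 n) (fun t ↦ Φ t x) 0 (1 : ℝ)

theorem IsSmoothFamily.contMDiff (hΦ : IsSmoothFamily m n Φ) (t : ℝ) :
    ContMDiff (𝓡 m) (𝓡 n) ∞ (Φ t) :=
  ContMDiff.comp (g := fun p : ℝ × M ↦ Φ p.1 p.2) (f := fun x ↦ (t, x)) hΦ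
    (contMDiff_const.prodMk contMDiff_id)

theorem IsSmoothFamily.contMDiff_left (hΦ : IsSmoothFamily m n Φ) (x : M) :
    ContMDiff 𝓘(ℝ, ℝ) (𝓡 n) ∞ (fun t ↦ Φ t x) :=
  ContMDiff.comp (g := fun p : ℝ × M ↦ Φ p.1 p.2) (f := fun t ↦ (t, x)) hΦ
    (contMDiff_id.prodMk contMDiff_const)

theorem IsSmoothFamily.contDiffAt_locVar (hΦ : IsSmoothFamily m n Φ)
    (hx : x ∈ (ch m c).source) (hd : Φ t x ∈ (ch n d).source) :
    ContDiffAt ℝ ∞ (locVar m n c d Φ) (t, ch m c x) := by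
  rw [← contMDiffAt_iff_contDiffAt]
  have h1 : ContMDiffAt 𝓘(ℝ, ℝ × EuclideanSpace ℝ (Fin m)) (𝓘(ℝ, ℝ).prod (𝓡 m)) ∞
      (fun p : ℝ × EuclideanSpace ℝ (Fin m) ↦ (p.1, (ch m c).symm p.2)) (t, ch m c x) := by
    refine ContMDiffAt.prodMk contDiff_fst.contMDiff.contMDiffAt ?_
    exact ContMDiffAt.comp (t, ch m c x) (contMDiffAt_ch_symm ((ch m c).map_source hx))
      contDiff_snd.contMDiff.contMDiffAt
  have h2 : ContMDiffAt 𝓘(ℝ, ℝ × EuclideanSpace ℝ (Fin m)) (𝓡 n) ∞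
      (fun p : ℝ × EuclideanSpace ℝ (Fin m) ↦ Φ p.1 ((ch m c).symm p.2)) (t, ch m c x) :=
    ContMDiffAt.comp (t, ch m c x) hΦ.contMDiffAt h1
  refine ContMDiffAt.comp (t, ch m c x) (contMDiffAt_ch ?_) h2
  simpa only [(ch m c).left_inv hx] using hd

theorem IsSmoothFamily.toE_varField (hΦ : IsSmoothFamily m n Φ)
    (hx : x ∈ (ch m c).source) (hd : Φ 0 x ∈ (ch n d).source) :
    toE d (Φ 0 x) (varField n Φ x) = fderiv ℝ (locVar m n c d Φ) (0, ch m c x) (1, 0) := by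
  have h1 := (hΦ.contDiffAt_locVar hx hd).differentiableAt (by simp)
  have h2 : MDifferentiableAt 𝓘(ℝ, ℝ) (𝓡 n) (fun t ↦ Φ t x) 0 :=
    (hΦ.contMDiff_left x).mdifferentiableAt (by simp)
  have h3 : MDifferentiableAt (𝓡 n) 𝓘(ℝ, EuclideanSpace ℝ (Fin n)) (ch n d) (Φ 0 x) :=
    (contMDiffAt_ch hd).mdifferentiableAt (by simp)
  have h4 := mfderiv_comp_apply (0 : ℝ) h3 h2 (1 : ℝ)
  rw [mfderiv_ch hd, mfderiv_eq_fderiv] at h4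
  rw [varField, ← h4, ← fderiv_slice_left h1]
  congr 2
  ext1 t
  exact (locVar_apply hx).symm

theorem IsSmoothFamily.locA_varField (hΦ : IsSmoothFamily m n Φ)
    (hx : x ∈ (ch m c).source) (hd : Φ 0 x ∈ (ch n d).source) :
    locA c d (Φ 0) (varField n Φ) =ᶠ[𝓝 (ch m c x)]
      fun u ↦ fderiv ℝ (locVar m n c d Φ) (0, u) (1, 0) := by
  have h0 := (hΦ.contMDiff 0).continuous.continuousAt.eventually
    ((ch n d).open_source.mem_nhds hd)
  filter_upwards [eventually_nhds_chart hx h0] with u ⟨h1, h2, h3⟩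
  rw [locA, hΦ.toE_varField h2 h1, h3]

theorem IsSmoothFamily.smoothAlongAt_varField (hΦ : IsSmoothFamily m n Φ) (x : M) :
    SmoothAlongAt m (Φ 0) (varField n Φ) x := by
  have hx := mem_ch_source (m := m) x
  have hd := mem_ch_source (m := n) (Φ 0 x)
  rw [smoothAlongAt_iff (hΦ.contMDiff 0).contMDiffAt hx hd]
  refine ContDiffAt.congr_of_eventuallyEq ?_ (hΦ.locA_varField hx hd)
  have h1 := (hΦ.contDiffAt_locVar hx hd).fderiv_right (m := ∞) (by simp)
  have h2 : ContDiffAt ℝ ∞ (fun u : EuclideanSpace ℝ (Fin m) ↦ ((0 : ℝ), u)) (ch m x x) :=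
    contDiffAt_const.prodMk contDiffAt_id
  exact (h1.comp (ch m x x) h2).clm_apply contDiffAt_const

/-- The energy density of the tension field of a family of maps. -/
def tensionSq (m n : ℕ)
    {M : Type*} [TopologicalSpace M] [ChartedSpace (EuclideanSpace ℝ (Fin m)) M]
    [IsManifold (𝓡 m) ∞ M] [RiemannianBundle (fun x : M ↦ TangentSpace (𝓡 m) x)]
    {N : Type*} [TopologicalSpace N] [ChartedSpace (EuclideanSpace ℝ (Fin n)) N]
    [IsManifold (𝓡 n) ∞ N] [RiemannianBundle (fun x : N ↦ TangentSpace (𝓡 n) x)]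
    (Φ : ℝ → M → N) (t : ℝ) (x : M) : ℝ :=
  ‖tension (m := m) (n := n) (Φ t) x‖ ^ 2

/-- The tension field of a family in charts. -/
def tensionVar (m n : ℕ)
    {M : Type*} [TopologicalSpace M] [ChartedSpace (EuclideanSpace ℝ (Fin m)) M]
    [IsManifold (𝓡 m) ∞ M] [RiemannianBundle (fun x : M ↦ TangentSpace (𝓡 m) x)]
    {N : Type*} [TopologicalSpace N] [ChartedSpace (EuclideanSpace ℝ (Fin n)) N]
    [IsManifold (𝓡 n) ∞ N] [RiemannianBundle (fun x : N ↦ TangentSpace (𝓡 n) x)]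
    (c : M) (d : N) (Φ : ℝ → M → N) (p : ℝ × EuclideanSpace ℝ (Fin m)) :
    EuclideanSpace ℝ (Fin n) :=
  trL (stdB m) (gloc c) p.2 fun v w ↦ sffSlice (chr m c) (chr n d) (locVar m n c d Φ) v w p

theorem IsSmoothFamily.toE_tension (hΦ : IsSmoothFamily m n Φ)
    (hx : x ∈ (ch m c).source) (hd : Φ t x ∈ (ch n d).source) :
    toE d (Φ t x) (tension (m := m) (n := n) (Φ t) x) =
      tensionVar m n c d Φ (t, ch m c x) := by
  rw [BiharmonicSubmersion.toE_tension (hΦ.contMDiff t) hx hd, tensionVar]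
  congr 1
  ext1 v
  ext1 w
  exact covHom_slice (F := locVar m n c d Φ)
    ((hΦ.contDiffAt_locVar hx hd).of_le two_le_infty) v w

theorem IsSmoothFamily.contDiffAt_tensionVar (hΦ : IsSmoothFamily m n Φ)
    (hx : x ∈ (ch m c).source) (hd : Φ t x ∈ (ch n d).source) :
    ContDiffAt ℝ ∞ (tensionVar m n c d Φ) (t, ch m c x) := by
  have hu := (ch m c).map_source hx
  have hΓ : ContDiffAt ℝ ∞ (chr n d) (locVar m n c d Φ (t, ch m c x)) := by
    rw [locVar_apply hx]
    exact contDiffAt_chr ((ch n d).map_source hd)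
  unfold tensionVar trL
  refine ContDiffAt.sum fun j _ ↦ ?_
  exact contDiffAt_sffSlice (contDiffAt_chr hu) hΓ (hΦ.contDiffAt_locVar hx hd)
    (v := fun q ↦ sharp (gloc c) q (LinearMap.toContinuousLinearMap ((stdB m).coord j)))
    (w := fun _ ↦ stdB m j)
    (((isMetricOn_gloc c).contDiffAt_sharp hu).clm_apply contDiffAt_const) contDiffAt_const

/-- The density `tensionSq` in charts. -/
def tensionSqLoc (m n : ℕ)
    {M : Type*} [TopologicalSpace M] [ChartedSpace (EuclideanSpace ℝ (Fin m)) M]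
    [IsManifold (𝓡 m) ∞ M] [RiemannianBundle (fun x : M ↦ TangentSpace (𝓡 m) x)]
    {N : Type*} [TopologicalSpace N] [ChartedSpace (EuclideanSpace ℝ (Fin n)) N]
    [IsManifold (𝓡 n) ∞ N] [RiemannianBundle (fun x : N ↦ TangentSpace (𝓡 n) x)]
    (c : M) (d : N) (Φ : ℝ → M → N) (p : ℝ × EuclideanSpace ℝ (Fin m)) : ℝ :=
  gloc d (locVar m n c d Φ p) (tensionVar m n c d Φ p) (tensionVar m n c d Φ p)

theorem IsSmoothFamily.contDiffAt_tensionSqLoc (hΦ : IsSmoothFamily m n Φ)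
    (hx : x ∈ (ch m c).source) (hd : Φ t x ∈ (ch n d).source) :
    ContDiffAt ℝ ∞ (tensionSqLoc m n c d Φ) (t, ch m c x) := by
  have h1 := (isMetricOn_gloc d).contDiffAt ((ch n d).map_source hd)
  rw [← locVar_apply (c := c) hx] at h1
  have h2 := hΦ.contDiffAt_tensionVar hx hd
  exact ((h1.comp _ (hΦ.contDiffAt_locVar hx hd)).clm_apply h2).clm_apply h2

theorem IsSmoothFamily.tensionSq_eq (hΦ : IsSmoothFamily m n Φ)
    (hx : x ∈ (ch m c).source) (hd : Φ t x ∈ (ch n d).source) :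
    tensionSq m n Φ t x = tensionSqLoc m n c d Φ (t, ch m c x) := by
  rw [tensionSqLoc, ← hΦ.toE_tension hx hd, locVar_apply hx, gloc_toE hd,
    real_inner_self_eq_norm_sq, tensionSq]

/-- The points near a given one lie in the domains of the charts there. -/
theorem IsSmoothFamily.eventually_source (hΦ : IsSmoothFamily m n Φ)
    (hx : x ∈ (ch m c).source) (hd : Φ t x ∈ (ch n d).source) :
    ∀ᶠ p in 𝓝 (t, x), p.2 ∈ (ch m c).source ∧ Φ p.1 p.2 ∈ (ch n d).source :=
  (continuousAt_snd.eventually ((ch m c).open_source.mem_nhds hx)).and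
    ((hΦ.continuous.continuousAt (x := (t, x))).eventually ((ch n d).open_source.mem_nhds hd))

theorem continuousAt_prod_ch (hx : x ∈ (ch m c).source) :
    ContinuousAt (fun p : ℝ × M ↦ (p.1, ch m c p.2)) (t, x) :=
  continuousAt_fst.prodMk (((ch m c).continuousAt hx).comp continuousAt_snd)

theorem IsSmoothFamily.continuous_tensionSq (hΦ : IsSmoothFamily m n Φ) :
    Continuous fun p : ℝ × M ↦ tensionSq m n Φ p.1 p.2 := by
  rw [continuous_iff_continuousAt]
  rintro ⟨t, x⟩
  have hx := mem_ch_source (m := m) x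
  have hd := mem_ch_source (m := n) (Φ t x)
  refine ContinuousAt.congr (f := fun p : ℝ × M ↦ tensionSqLoc m n x (Φ t x) Φ
    (p.1, ch m x p.2)) ?_ ?_
  · exact ContinuousAt.comp (g := tensionSqLoc m n x (Φ t x) Φ)
      (hΦ.contDiffAt_tensionSqLoc hx hd).continuousAt (continuousAt_prod_ch hx)
  · filter_upwards [hΦ.eventually_source hx hd] with p hp
    exact (hΦ.tensionSq_eq hp.1 hp.2).symm

theorem IsSmoothFamily.hasDerivAt_tensionSq (hΦ : IsSmoothFamily m n Φ)
    (hx : x ∈ (ch m c).source) (hd : Φ t x ∈ (ch n d).source) :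
    HasDerivAt (fun s ↦ tensionSq m n Φ s x)
      (fderiv ℝ (tensionSqLoc m n c d Φ) (t, ch m c x) (1, 0)) t := by
  have h1 := (hΦ.contDiffAt_tensionSqLoc hx hd).differentiableAt (by simp)
  have h2 : HasDerivAt (fun s : ℝ ↦ (s, ch m c x)) ((1 : ℝ), (0 : EuclideanSpace ℝ (Fin m))) t :=
    (hasDerivAt_id t).prodMk (hasDerivAt_const t _)
  refine (h1.hasFDerivAt.comp_hasDerivAt t h2).congr_of_eventuallyEq ?_
  have h3 : ∀ᶠ s in 𝓝 t, Φ s x ∈ (ch n d).source :=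
    (hΦ.contMDiff_left x).continuous.continuousAt.eventually ((ch n d).open_source.mem_nhds hd)
  filter_upwards [h3] with s hs using hΦ.tensionSq_eq hx hs

/-- The time derivative of `tensionSq`. -/
def tensionSqDeriv (m n : ℕ)
    {M : Type*} [TopologicalSpace M] [ChartedSpace (EuclideanSpace ℝ (Fin m)) M]
    [IsManifold (𝓡 m) ∞ M] [RiemannianBundle (fun x : M ↦ TangentSpace (𝓡 m) x)]
    {N : Type*} [TopologicalSpace N] [ChartedSpace (EuclideanSpace ℝ (Fin n)) N]
    [IsManifold (𝓡 n) ∞ N] [RiemannianBundle (fun x : N ↦ TangentSpace (𝓡 n) x)]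
    (Φ : ℝ → M → N) (t : ℝ) (x : M) : ℝ :=
  deriv (fun s ↦ tensionSq m n Φ s x) t

theorem IsSmoothFamily.continuous_tensionSqDeriv (hΦ : IsSmoothFamily m n Φ) :
    Continuous fun p : ℝ × M ↦ tensionSqDeriv m n Φ p.1 p.2 := by
  rw [continuous_iff_continuousAt]
  rintro ⟨t, x⟩
  have hx := mem_ch_source (m := m) x
  have hd := mem_ch_source (m := n) (Φ t x)
  refine ContinuousAt.congr (f := fun p : ℝ × M ↦ fderiv ℝ (tensionSqLoc m n x (Φ t x) Φ)
    (p.1, ch m x p.2) (1, 0)) ?_ ?_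
  · have h1 := ((hΦ.contDiffAt_tensionSqLoc hx hd).fderiv_right (m := ∞) (by simp)).continuousAt
    exact (ContinuousAt.comp (f := fun p : ℝ × M ↦ (p.1, ch m x p.2)) (x := (t, x))
      (g := fderiv ℝ (tensionSqLoc m n x (Φ t x) Φ)) h1
      (continuousAt_prod_ch hx)).clm_apply continuousAt_const
  · filter_upwards [hΦ.eventually_source hx hd] with p hp
    exact (hΦ.hasDerivAt_tensionSq hp.1 hp.2).deriv.symm

/-- The first variation of the tension field. -/
theorem IsSmoothFamily.tensionSqDeriv_eq (hΦ : IsSmoothFamily m n Φ) (x : M) :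
    tensionSqDeriv m n Φ 0 x = 2 * inner ℝ
      (traceHessianAlong (m := m) (Φ 0) (varField n Φ) x
        + ∑ k, curvature (Φ 0 x) (varField n Φ x) (diff (m := m) (n := n) (Φ 0) x (onb x k))
          (diff (m := m) (n := n) (Φ 0) x (onb x k)))
      (tension (m := m) (n := n) (Φ 0) x) := by
  have hx := mem_ch_source (m := m) x
  have hd := mem_ch_source (m := n) (Φ 0 x)
  set d := Φ 0 x with hd'
  have hu := (ch m x).map_source hx
  set u := ch m x x with hu'
  set F := locVar m n x d Φ with hF'
  have hF : ContDiffAt ℝ ∞ F (0, u) := hΦ.contDiffAt_locVar hx hd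
  have hFt : ∀ᶠ s in 𝓝 (0 : ℝ), Φ s x ∈ (ch n d).source :=
    (hΦ.contMDiff_left x).continuous.continuousAt.eventually ((ch n d).open_source.mem_nhds hd)
  set E : Fin (Module.finrank ℝ (TangentSpace (𝓡 m) x)) → EuclideanSpace ℝ (Fin m) :=
    fun k ↦ toE x x (onb x k) with hE
  set S : Fin (Module.finrank ℝ (TangentSpace (𝓡 m) x)) → ℝ → EuclideanSpace ℝ (Fin n) :=
    fun k s ↦ covHom (chr m x) (chr n d) (fun q ↦ F (s, q)) (fderiv ℝ fun q ↦ F (s, q)) u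
      (E k) (E k) with hS
  -- The orthonormal basis at x and the chart of N are kept fixed in s, so the covariant derivative
  -- in s acts on the second fundamental forms alone; the chart at Φ 0 x still contains Φ s x for
  -- small s.
  have hsm : ∀ᶠ s in 𝓝 (0 : ℝ), toE d (Φ s x) (tension (m := m) (n := n) (Φ s) x)
      = ∑ k, S k s := by
    filter_upwards [hFt] with s hs
    rw [BiharmonicSubmersion.toE_tension (hΦ.contMDiff s) hx hs,
      trL_eq_sum (stdB m) (isMetricOn_gloc x) hu ((isParseval_onb x).toE hx)]
    rfl
  have hFu : F (0, u) = ch n d d := locVar_apply hx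
  have hFu' : F (0, u) ∈ (ch n d).target := by rw [hFu]; exact (ch n d).map_source hd
  have hΓ : ContDiffAt ℝ ∞ (chr n d) (F (0, u)) := contDiffAt_chr hFu'
  have hSd (k) : DifferentiableAt ℝ (S k) 0 := by
    have h1 : S k =ᶠ[𝓝 0] fun s ↦ sffSlice (chr m x) (chr n d) F (E k) (E k) (s, u) := by
      filter_upwards [hFt] with s hs
      exact covHom_slice ((hΦ.contDiffAt_locVar hx hs).of_le two_le_infty) _ _
    refine DifferentiableAt.congr_of_eventuallyEq ?_ h1
    have h2 := contDiffAt_sffSlice (v := fun _ ↦ E k) (w := fun _ ↦ E k) (p := ((0 : ℝ), u))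
      (contDiffAt_chr hu) hΓ hF contDiffAt_const contDiffAt_const
    have h3 : ContDiffAt ℝ ∞ (fun s : ℝ ↦ (s, u)) 0 := contDiffAt_id.prodMk contDiffAt_const
    exact (h2.comp (0 : ℝ) h3).differentiableAt (by simp)
  have hFs : DifferentiableAt ℝ (fun s ↦ F (s, u)) 0 :=
    (hF.comp (0 : ℝ) (contDiffAt_id.prodMk contDiffAt_const)).differentiableAt (by simp)
  have hsum : DifferentiableAt ℝ (fun s ↦ ∑ k, S k s) 0 :=
    DifferentiableAt.fun_sum fun k _ ↦ hSd k
  have h1 : (fun s ↦ tensionSq m n Φ s x) =ᶠ[𝓝 0]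
      fun s ↦ gloc d (F (s, u)) (∑ k, S k s) (∑ k, S k s) := by
    filter_upwards [hFt, hsm] with s hs hs'
    rw [← hs', hF', locVar_apply hx, gloc_toE hs, real_inner_self_eq_norm_sq, tensionSq]
  have h2 := fderiv_metric_apply (F := fun s ↦ F (s, u)) (p := (0 : ℝ)) (isMetricOn_gloc d) hFu' hFs
    hsum hsum 1
  have hsymm : ∀ᶠ q in 𝓝 (F (0, u)), ∀ v w, chr n d q v w = chr n d q w v := by
    filter_upwards [(ch n d).open_target.mem_nhds hFu'] with q hq using chr_symm hq
  have h3 (k) : covD (chr n d) (fun s ↦ F (s, u)) (S k) 0 1 =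
      toE d (Φ 0 x) (hessAlong (Φ 0) (varField n Φ) x (onb x k) (onb x k)
        + curvature (Φ 0 x) (varField n Φ x) (diff (m := m) (n := n) (Φ 0) x (onb x k))
          (diff (m := m) (n := n) (Φ 0) x (onb x k))) := by
    have hcl : covD (chr n d) (fun q ↦ F (0, q)) (fun q ↦ fderiv ℝ F (0, q) (1, 0)) =ᶠ[𝓝 u]
        covD (chr n d) (locMap m n x d (Φ 0)) (locA x d (Φ 0) (varField n Φ)) := by
      filter_upwards [(hΦ.locA_varField hx hd).eventually_nhds] with q hq
      exact covD_congr EventuallyEq.rfl (EventuallyEq.symm hq)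
    have hdf : toE d (Φ 0 x) (diff (m := m) (n := n) (Φ 0) x (onb x k)) =
        fderiv ℝ F (0, u) (0, E k) := by
      rw [toE_diff ((hΦ.contMDiff 0).mdifferentiableAt (by simp)) hx hd,
        ← fderiv_slice_right (hF.differentiableAt (by simp))]
      rfl
    rw [hS]
    simp only
    rw [covD_sff_variation hΓ hsymm hF, map_add,
      toE_hessAlong_apply (hΦ.contMDiff 0) (Eventually.of_forall hΦ.smoothAlongAt_varField) hx hd,
      toE_curvature hd, hdf, hΦ.toE_varField hx hd, covHom_congr EventuallyEq.rfl hcl, hFu]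
    rfl
  have h4 : covD (chr n d) (fun s ↦ F (s, u)) (fun s ↦ ∑ k, S k s) 0 1 =
      toE d (Φ 0 x) (traceHessianAlong (m := m) (Φ 0) (varField n Φ) x
        + ∑ k, curvature (Φ 0 x) (varField n Φ x) (diff (m := m) (n := n) (Φ 0) x (onb x k))
          (diff (m := m) (n := n) (Φ 0) x (onb x k))) := by
    rw [covD_sum _ fun k _ ↦ hSd k, Finset.sum_congr rfl fun k _ ↦ h3 k, ← map_sum,
      Finset.sum_add_distrib]
    rfl
  rw [tensionSqDeriv, h1.deriv_eq, ← fderiv_apply_one_eq_deriv, h2]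
  change gloc d _ (covD (chr n d) _ _ 0 1) _ + gloc d _ _ (covD (chr n d) _ _ 0 1) = _
  rw [h4, ← hsm.self_of_nhds, hFu, gloc_toE hd, gloc_toE hd, two_mul]
  congr 1
  exact real_inner_comm _ _

end Variation

/-! ### The first variation of the bienergy -/

section FirstVariation

variable {m n : ℕ}
  {M : Type*} [TopologicalSpace M] [ChartedSpace (EuclideanSpace ℝ (Fin m)) M]
  [IsManifold (𝓡 m) ∞ M] [RiemannianBundle (fun x : M ↦ TangentSpace (𝓡 m) x)]
  [IsContMDiffRiemannianBundle (𝓡 m) ∞ (EuclideanSpace ℝ (Fin m))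
      (fun x : M ↦ TangentSpace (𝓡 m) x)]
  {N : Type*} [TopologicalSpace N] [ChartedSpace (EuclideanSpace ℝ (Fin n)) N]
  [IsManifold (𝓡 n) ∞ N] [RiemannianBundle (fun x : N ↦ TangentSpace (𝓡 n) x)]
  [IsContMDiffRiemannianBundle (𝓡 n) ∞ (EuclideanSpace ℝ (Fin n))
      (fun x : N ↦ TangentSpace (𝓡 n) x)]
  {x : M} {d : N} {Φ : ℝ → M → N} {φ : M → N}

/-- The pair symmetry of the curvature; it moves the curvature term from the variation field to the
tension field. -/
theorem inner_curvature_symm (x : M) (a b c : TangentSpace (𝓡 m) x) :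
    (inner ℝ (curvature x b a a) c : ℝ) = inner ℝ (curvature x c a a) b := by
  have hx := mem_ch_source (m := m) x
  rw [← gloc_toE hx, ← gloc_toE hx, toE_curvature hx, toE_curvature hx]
  exact (isMetricOn_gloc x).curvL_jacobi_symm ((ch m x).map_source hx) _ _ _

/-- Symmetry of the linearised tension operator, pointwise up to a divergence: Green's identity for
the Hessian part and the pair symmetry for the curvature part. -/
theorem IsSmoothFamily.half_tensionSqDeriv (hΦ : IsSmoothFamily m n Φ) (x : M) :
    (1 / 2 : ℝ) * tensionSqDeriv m n Φ 0 x =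
      divg (m := m) (adjField (Φ 0) (varField n Φ) (tension (m := m) (n := n) (Φ 0))) x
        + inner ℝ (varField n Φ x) (bitension (m := m) (n := n) (Φ 0) x) := by
  rw [hΦ.tensionSqDeriv_eq, divg_adjField (hΦ.contMDiff 0) hΦ.smoothAlongAt_varField
    (smoothAlongAt_tension (hΦ.contMDiff 0)), bitension, inner_add_left, inner_sub_right,
    sum_inner, inner_sum]
  have h (k) : (inner ℝ (curvature (Φ 0 x) (varField n Φ x)
      (diff (m := m) (n := n) (Φ 0) x (onb x k)) (diff (m := m) (n := n) (Φ 0) x (onb x k)))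
      (tension (m := m) (n := n) (Φ 0) x) : ℝ) =
      - inner ℝ (varField n Φ x) (curvature (Φ 0 x) (diff (m := m) (n := n) (Φ 0) x (onb x k))
        (tension (m := m) (n := n) (Φ 0) x) (diff (m := m) (n := n) (Φ 0) x (onb x k))) := by
    rw [inner_curvature_symm, curvature_antisymm, inner_neg_left, real_inner_comm]
  rw [Finset.sum_congr rfl fun k _ ↦ h k, Finset.sum_neg_distrib]
  ring

theorem IsSmoothFamily.varField_eq_zero (hΦ : IsSmoothFamily m n Φ) (h : ∀ t, Φ t x = Φ 0 x) :
    varField n Φ x = 0 := by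
  have hx := mem_ch_source (m := m) x
  have hd := mem_ch_source (m := n) (Φ 0 x)
  apply toE_injective hd
  rw [hΦ.toE_varField hx hd,
    ← fderiv_slice_left ((hΦ.contDiffAt_locVar hx hd).differentiableAt (by simp))]
  have : (fun t ↦ locVar m n x (Φ 0 x) Φ (t, ch m x x)) = fun _ ↦ ch n (Φ 0 x) (Φ 0 x) := by
    ext1 t
    rw [locVar_apply hx, h t]
  rw [this, map_zero]
  simp

variable [T2Space M] [SigmaCompactSpace M] [MeasurableSpace M] [BorelSpace M]

/-- The function is the difference of two continuous ones by the preceding identity, so no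
regularity of the bitension field has to be established. -/
theorem IsSmoothFamily.continuous_inner_bitension (hΦ : IsSmoothFamily m n Φ) :
    Continuous fun x ↦
      (inner ℝ (varField n Φ x) (bitension (m := m) (n := n) (Φ 0) x) : ℝ) := by
  have h1 : Continuous fun x ↦ (1 / 2 : ℝ) * tensionSqDeriv m n Φ 0 x :=
    continuous_const.mul (hΦ.continuous_tensionSqDeriv.comp (g := fun p : ℝ × M ↦
      tensionSqDeriv m n Φ p.1 p.2) (f := fun x ↦ (0, x)) (by fun_prop))
  have h2 := continuous_divg (smoothFieldAt_adjField (hΦ.contMDiff 0) hΦ.smoothAlongAt_varField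
    (smoothAlongAt_tension (hΦ.contMDiff 0)))
  exact (h1.sub h2).congr fun x ↦ sub_eq_iff_eq_add'.2 (hΦ.half_tensionSqDeriv x)

/-- The first variation formula for the bienergy. -/
theorem IsSmoothFamily.hasDerivAt_bienergy (hΦ : IsSmoothFamily m n Φ) {Ω : Set M}
    (hΩ : IsCompact Ω) (h : ∀ t, ∀ x ∉ Ω, Φ t x = Φ 0 x) :
    HasDerivAt (fun t ↦ bienergy m n (Φ t) Ω)
      (∫ x in Ω, (inner ℝ (varField n Φ x) (bitension (m := m) (n := n) (Φ 0) x) : ℝ)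
        ∂(riemannianVolume m M)) 0 := by
  have := isLocallyFiniteMeasure_volume (m := m) (M := M)
  have hfin : IsFiniteMeasure ((riemannianVolume m M).restrict Ω) :=
    ⟨by rw [Measure.restrict_apply_univ]; exact hΩ.measure_lt_top⟩
  have hc (t : ℝ) : Continuous fun x ↦ tensionSq m n Φ t x :=
    hΦ.continuous_tensionSq.comp (g := fun p : ℝ × M ↦ tensionSq m n Φ p.1 p.2)
      (f := fun x ↦ (t, x)) (by fun_prop)
  have hc' : Continuous fun x ↦ tensionSqDeriv m n Φ 0 x :=
    hΦ.continuous_tensionSqDeriv.comp (g := fun p : ℝ × M ↦ tensionSqDeriv m n Φ p.1 p.2)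
      (f := fun x ↦ (0, x)) (by fun_prop)
  -- The derivative is jointly continuous, hence bounded on the compact set [-1, 1] × Ω; the
  -- constant bound dominates because Ω has finite volume.
  obtain ⟨C, hC⟩ := ((isCompact_Icc (a := (-1 : ℝ)) (b := 1)).prod hΩ).exists_bound_of_continuousOn
    hΦ.continuous_tensionSqDeriv.continuousOn
  have h1 := (hasDerivAt_integral_of_dominated_loc_of_deriv_le
    (μ := (riemannianVolume m M).restrict Ω) (F := fun t x ↦ tensionSq m n Φ t x)
    (F' := fun t x ↦ tensionSqDeriv m n Φ t x) (bound := fun _ ↦ C) (x₀ := (0 : ℝ))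
    (s := Icc (-1) 1) (Icc_mem_nhds (by norm_num) (by norm_num))
    (Eventually.of_forall fun t ↦ (hc t).aestronglyMeasurable)
    ((hc 0).continuousOn.integrableOn_compact hΩ) hc'.aestronglyMeasurable
    ((ae_restrict_iff' hΩ.measurableSet).2 (Eventually.of_forall fun x hx t ht ↦ hC (t, x) ⟨ht, hx⟩))
    (integrable_const C)
    (Eventually.of_forall fun x t _ ↦ (hΦ.hasDerivAt_tensionSq (mem_ch_source x)
      (mem_ch_source _)).differentiableAt.hasDerivAt)).2
  have h2 := h1.const_mul (1 / 2 : ℝ)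
  -- The variation is constant off Ω, so its field and the adjoint field vanish there. Hence the
  -- divergence integrates to zero over Ω itself, with no boundary term.
  have hV (x) (hx : x ∉ Ω) : varField n Φ x = 0 := hΦ.varField_eq_zero fun t ↦ h t x hx
  have hev (x) (hx : x ∉ Ω) : ∀ᶠ y in 𝓝 x, varField n Φ y = 0 := by
    filter_upwards [hΩ.isClosed.isOpen_compl.mem_nhds hx] with y hy using hV y hy
  have hXs := smoothFieldAt_adjField (hΦ.contMDiff 0) hΦ.smoothAlongAt_varField
    (smoothAlongAt_tension (hΦ.contMDiff 0))
  have hX0 (x) (hx : x ∉ Ω) : adjField (m := m) (Φ 0) (varField n Φ)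
      (tension (m := m) (n := n) (Φ 0)) x = 0 :=
    adjField_eq_zero (hev x hx) (hΦ.contMDiff 0) (hΦ.smoothAlongAt_varField x)
  obtain ⟨h3, h4⟩ := integral_divg_eq_zero hXs hΩ hX0
  have h5 : ∫ x in Ω, divg (m := m) (adjField (Φ 0) (varField n Φ)
      (tension (m := m) (n := n) (Φ 0))) x ∂(riemannianVolume m M) = 0 := by
    rw [setIntegral_eq_integral_of_forall_compl_eq_zero fun x hx ↦ divg_eq_zero ?_, h4]
    filter_upwards [hΩ.isClosed.isOpen_compl.mem_nhds hx] with y hy using hX0 y hy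
  have h6 : (1 / 2 : ℝ) * ∫ x in Ω, tensionSqDeriv m n Φ 0 x ∂(riemannianVolume m M) =
      ∫ x in Ω, (inner ℝ (varField n Φ x) (bitension (m := m) (n := n) (Φ 0) x) : ℝ)
        ∂(riemannianVolume m M) := by
    rw [← integral_const_mul, integral_congr_ae (Eventually.of_forall hΦ.half_tensionSqDeriv),
      integral_add h3.integrableOn
        (hΦ.continuous_inner_bitension.continuousOn.integrableOn_compact hΩ), h5, zero_add]
  rw [h6] at h2
  exact h2

theorem isBiharmonic_of_bitension_eq_zero (hφ : ContMDiff (𝓡 m) (𝓡 n) ∞ φ)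
    (h : ∀ x, bitension (m := m) (n := n) φ x = 0) : IsBiharmonic m n φ := by
  refine ⟨hφ, fun Ω hΩ Φ hΦ h0 hs ↦ ?_⟩
  subst h0
  have h1 := IsSmoothFamily.hasDerivAt_bienergy hΦ hΩ hs
  simpa only [h, inner_zero_right, integral_zero] using h1

end FirstVariation

/-! ### Chart variations and the Euler-Lagrange equation -/

section FundamentalLemma

variable {m n : ℕ}
  {M : Type*} [TopologicalSpace M] [ChartedSpace (EuclideanSpace ℝ (Fin m)) M]
  [IsManifold (𝓡 m) ∞ M]
  {N : Type*} [TopologicalSpace N] [ChartedSpace (EuclideanSpace ℝ (Fin n)) N]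
  [IsManifold (𝓡 n) ∞ N]
  {x : M} {d : N} {φ : M → N} {ρ : M → ℝ} {w : EuclideanSpace ℝ (Fin n)} {ε : ℝ}

open Classical in
/-- The variation of `φ` which moves in the constant direction `w` in the chart at `d`, at a speed
proportional to `ρ`. -/
def chartVariation (n : ℕ) {M N : Type*} [TopologicalSpace N]
    [ChartedSpace (EuclideanSpace ℝ (Fin n)) N] (d : N) (φ : M → N) (ρ : M → ℝ)
    (w : EuclideanSpace ℝ (Fin n)) (t : ℝ) (x : M) : N :=
  if φ x ∈ (ch n d).source then (ch n d).symm (ch n d (φ x) + (Real.sin t * ρ x) • w) else φ x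

theorem chartVariation_of_eq_zero (t : ℝ) (hx : ρ x = 0) : chartVariation n d φ ρ w t x = φ x := by
  unfold chartVariation
  split_ifs with h
  · rw [hx, mul_zero, zero_smul, add_zero, (ch n d).left_inv h]
  · rfl

theorem chartVariation_zero : chartVariation n d φ ρ w 0 = φ := by
  ext1 x
  unfold chartVariation
  split_ifs with h
  · rw [Real.sin_zero, zero_mul, zero_smul, add_zero, (ch n d).left_inv h]
  · rfl

/-- The points mapped by `φ` to the chart ball of radius `ε / 2` centered at `d`. -/
def chartBallPreimage (n : ℕ) {M N : Type*} [TopologicalSpace N]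
    [ChartedSpace (EuclideanSpace ℝ (Fin n)) N] (d : N) (φ : M → N) (ε : ℝ) : Set M :=
  φ ⁻¹' ((ch n d).source ∩ ch n d ⁻¹' Metric.ball (ch n d d) (ε / 2))

theorem isOpen_chartBallPreimage (hφ : Continuous φ) : IsOpen (chartBallPreimage n d φ ε) :=
  ((ch n d).isOpen_inter_preimage Metric.isOpen_ball).preimage hφ

/-- Since |sin t| ≤ 1, the displacement stays below ε / 2 for every real t, so the variation never
leaves the chart; sin has derivative 1 at 0, so the variation field is still that of a linear
motion. -/
theorem chartVariation_mem_target (hε : Metric.ball (ch n d d) ε ⊆ (ch n d).target)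
    (hw : ‖w‖ < ε / 2) (hρ : ∀ x, |ρ x| ≤ 1) (hx : x ∈ chartBallPreimage n d φ ε) (t : ℝ) :
    ch n d (φ x) + (Real.sin t * ρ x) • w ∈ (ch n d).target := by
  have h1 : dist (ch n d (φ x)) (ch n d d) < ε / 2 := hx.2
  have h2 : ‖(Real.sin t * ρ x) • w‖ ≤ ‖w‖ := by
    rw [norm_smul, norm_mul]
    exact mul_le_of_le_one_left (norm_nonneg _)
      (mul_le_one₀ (Real.abs_sin_le_one t) (abs_nonneg _) (hρ x))
  apply hε
  rw [Metric.mem_ball, dist_eq_norm, add_sub_right_comm]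
  rw [dist_eq_norm] at h1
  linarith [norm_add_le (ch n d (φ x) - ch n d d) ((Real.sin t * ρ x) • w)]

/-- Two open sets cover M: the preimage of the chart ball, where the formula is smooth, and the
complement of the support of ρ, where the family is constantly φ. -/
theorem isSmoothFamily_chartVariation (hφ : ContMDiff (𝓡 m) (𝓡 n) ∞ φ)
    (hε : Metric.ball (ch n d d) ε ⊆ (ch n d).target) (hw : ‖w‖ < ε / 2)
    (hρs : ContMDiff (𝓡 m) 𝓘(ℝ, ℝ) ∞ ρ) (hρ : ∀ x, |ρ x| ≤ 1)
    (hO : tsupport ρ ⊆ chartBallPreimage n d φ ε) :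
    IsSmoothFamily m n (chartVariation n d φ ρ w) := by
  rintro ⟨t, x⟩
  have hφ2 : ContMDiffAt (𝓘(ℝ, ℝ).prod (𝓡 m)) (𝓡 n) ∞ (fun p : ℝ × M ↦ φ p.2) (t, x) :=
    ContMDiffAt.comp (g := φ) (f := Prod.snd) (t, x) hφ.contMDiffAt contMDiffAt_snd
  by_cases hx : x ∈ chartBallPreimage n d φ ε
  · have h1 : ContMDiffAt (𝓘(ℝ, ℝ).prod (𝓡 m)) 𝓘(ℝ, EuclideanSpace ℝ (Fin n)) ∞
        (fun p : ℝ × M ↦ ch n d (φ p.2)) (t, x) :=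
      ContMDiffAt.comp (g := ch n d) (f := fun p : ℝ × M ↦ φ p.2) (t, x) (contMDiffAt_ch hx.1) hφ2
    have h2 : ContMDiffAt (𝓘(ℝ, ℝ).prod (𝓡 m)) 𝓘(ℝ, ℝ) ∞
        (fun p : ℝ × M ↦ Real.sin p.1 * ρ p.2) (t, x) :=
      ContMDiffAt.mul
        (ContMDiffAt.comp (g := Real.sin) (f := Prod.fst) (t, x)
          Real.contDiff_sin.contMDiff.contMDiffAt contMDiffAt_fst)
        (ContMDiffAt.comp (g := ρ) (f := Prod.snd) (t, x) hρs.contMDiffAt contMDiffAt_snd)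
    have h3 : ContMDiffAt (𝓘(ℝ, ℝ).prod (𝓡 m)) (𝓡 n) ∞ (fun p : ℝ × M ↦
        (ch n d).symm (ch n d (φ p.2) + (Real.sin p.1 * ρ p.2) • w)) (t, x) :=
      ContMDiffAt.comp (g := (ch n d).symm)
        (f := fun p : ℝ × M ↦ ch n d (φ p.2) + (Real.sin p.1 * ρ p.2) • w) (t, x)
        (contMDiffAt_ch_symm (chartVariation_mem_target hε hw hρ hx t))
        (h1.add (h2.smul contMDiffAt_const))
    refine h3.congr_of_eventuallyEq ?_
    filter_upwards [continuousAt_snd.eventually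
      ((isOpen_chartBallPreimage hφ.continuous).mem_nhds hx)] with p hp
    exact if_pos hp.1
  · refine hφ2.congr_of_eventuallyEq ?_
    filter_upwards [continuousAt_snd.eventually ((isClosed_tsupport ρ).isOpen_compl.mem_nhds
      fun h ↦ hx (hO h))] with p hp
    exact chartVariation_of_eq_zero _ (image_eq_zero_of_notMem_tsupport hp)

variable [RiemannianBundle (fun x : M ↦ TangentSpace (𝓡 m) x)]
  [IsContMDiffRiemannianBundle (𝓡 m) ∞ (EuclideanSpace ℝ (Fin m))
      (fun x : M ↦ TangentSpace (𝓡 m) x)]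
  [RiemannianBundle (fun x : N ↦ TangentSpace (𝓡 n) x)]
  [IsContMDiffRiemannianBundle (𝓡 n) ∞ (EuclideanSpace ℝ (Fin n))
      (fun x : N ↦ TangentSpace (𝓡 n) x)]

/-- The inner product of the bitension field with the constant vector `w` in the chart at `d`. -/
def bitensionPairing (m n : ℕ)
    {M : Type*} [TopologicalSpace M] [ChartedSpace (EuclideanSpace ℝ (Fin m)) M]
    [IsManifold (𝓡 m) ∞ M] [RiemannianBundle (fun x : M ↦ TangentSpace (𝓡 m) x)]
    {N : Type*} [TopologicalSpace N] [ChartedSpace (EuclideanSpace ℝ (Fin n)) N]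
    [IsManifold (𝓡 n) ∞ N] [RiemannianBundle (fun x : N ↦ TangentSpace (𝓡 n) x)]
    (d : N) (w : EuclideanSpace ℝ (Fin n)) (φ : M → N) (x : M) : ℝ :=
  gloc d (ch n d (φ x)) w (toE d (φ x) (bitension (m := m) (n := n) φ x))

theorem inner_varField_chartVariation (hφ : ContMDiff (𝓡 m) (𝓡 n) ∞ φ)
    (hε : Metric.ball (ch n d d) ε ⊆ (ch n d).target) (hw : ‖w‖ < ε / 2)
    (hρs : ContMDiff (𝓡 m) 𝓘(ℝ, ℝ) ∞ ρ) (hρ : ∀ x, |ρ x| ≤ 1)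
    (hO : tsupport ρ ⊆ chartBallPreimage n d φ ε) (x : M) :
    (inner ℝ (varField n (chartVariation n d φ ρ w) x)
      (bitension (m := m) (n := n) (chartVariation n d φ ρ w 0) x) : ℝ) =
      ρ x * bitensionPairing m n d w φ x := by
  have hΦ := isSmoothFamily_chartVariation hφ hε hw hρs hρ hO
  have h0 : chartVariation n d φ ρ w 0 = φ := chartVariation_zero
  by_cases hx : x ∈ chartBallPreimage n d φ ε
  · have hc := mem_ch_source (m := m) x
    have hd : chartVariation n d φ ρ w 0 x ∈ (ch n d).source := by rw [h0]; exact hx.1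
    have h1 : toE d _ (varField n (chartVariation n d φ ρ w) x) = ρ x • w := by
      rw [hΦ.toE_varField hc hd,
        ← fderiv_slice_left ((hΦ.contDiffAt_locVar hc hd).differentiableAt (by simp))]
      have h2 : (fun t ↦ locVar m n x d (chartVariation n d φ ρ w) (t, ch m x x)) =
          fun t ↦ ch n d (φ x) + (Real.sin t * ρ x) • w := by
        ext1 t
        rw [locVar_apply hc, chartVariation, if_pos hx.1,
          (ch n d).right_inv (chartVariation_mem_target hε hw hρ hx t)]
      rw [h2, fderiv_apply_one_eq_deriv]
      have h3 := (((Real.hasDerivAt_sin 0).mul_const (ρ x)).smul_const w).const_add (ch n d (φ x))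
      rw [h3.deriv, Real.cos_zero, one_mul]
    have h4 : bitensionPairing m n d w φ x =
        bitensionPairing m n d w (chartVariation n d φ ρ w 0) x := by rw [h0]
    rw [h4, ← gloc_toE hd, h1, map_smul]
    rfl
  · have hρx : ρ x = 0 := image_eq_zero_of_notMem_tsupport fun h ↦ hx (hO h)
    rw [hΦ.varField_eq_zero fun t ↦ by rw [chartVariation_of_eq_zero t hρx,
      chartVariation_of_eq_zero 0 hρx], inner_zero_left, hρx, zero_mul]

variable [T2Space M] [SigmaCompactSpace M] [MeasurableSpace M] [BorelSpace M]

/-- If the bitension field is nonzero at x, moving φ in that direction with a bump function as speed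
gives a variation along which the derivative of the bienergy is positive. -/
theorem IsBiharmonic.bitension_eq_zero (hφ : IsBiharmonic m n φ) (x : M) :
    bitension (m := m) (n := n) φ x = 0 := by
  by_contra hne
  have := isLocallyFiniteMeasure_volume (m := m) (M := M)
  have := isOpenPosMeasure_volume (m := m) (M := M)
  set d := φ x with hd
  have hdx := mem_ch_source (m := n) d
  obtain ⟨ε, hε0, hε⟩ := Metric.isOpen_iff.1 (ch n d).open_target _ ((ch n d).map_source hdx)
  -- The direction is scaled down to fit the chart ball; its pairing with the bitension at x stays
  -- positive.
  obtain ⟨s, hs0, hs⟩ : ∃ s : ℝ, 0 < s ∧ ‖s • toE d d (bitension (m := m) (n := n) φ x)‖ < ε / 2 := by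
    have h1 : Tendsto (fun s : ℝ ↦ ‖s • toE d d (bitension (m := m) (n := n) φ x)‖) (𝓝[>] 0)
        (𝓝 0) := by
      have : Continuous fun s : ℝ ↦ ‖s • toE d d (bitension (m := m) (n := n) φ x)‖ := by fun_prop
      simpa using (this.tendsto 0).mono_left nhdsWithin_le_nhds
    obtain ⟨s, h2, h3⟩ := ((h1.eventually (gt_mem_nhds (half_pos hε0))).and
      self_mem_nhdsWithin).exists
    exact ⟨s, h3, h2⟩
  set w := s • toE d d (bitension (m := m) (n := n) φ x) with hw
  have hO := (isOpen_chartBallPreimage (n := n) (d := d) (ε := ε) hφ.1.continuous)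
  have hxO : x ∈ chartBallPreimage n d φ ε := ⟨hdx, Metric.mem_ball_self (half_pos hε0)⟩
  have hpos : 0 < bitensionPairing m n d w φ x := by
    rw [bitensionPairing, hw, map_smul, smul_apply, gloc_toE hdx, smul_eq_mul]
    exact mul_pos hs0 (real_inner_self_pos.2 hne)
  have hρ1 (ρ : SmoothBumpFunction (𝓡 m) x) (y : M) : |ρ y| ≤ 1 := by
    rw [abs_of_nonneg ρ.nonneg]
    exact ρ.le_one
  have hcont (ρ : SmoothBumpFunction (𝓡 m) x) (hρ : tsupport ρ ⊆ chartBallPreimage n d φ ε) :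
      Continuous fun y ↦ ρ y * bitensionPairing m n d w φ y :=
    (isSmoothFamily_chartVariation hφ.1 hε hs ρ.contMDiff (hρ1 ρ) hρ).continuous_inner_bitension.congr
      (inner_varField_chartVariation hφ.1 hε hs ρ.contMDiff (hρ1 ρ) hρ)
  -- Continuity of the pairing is known only after multiplication by a bump function. The first bump
  -- yields a neighborhood on which the pairing is positive; the second, supported in it, defines
  -- the variation.
  obtain ⟨ρ₁, -, hρ₁⟩ := (SmoothBumpFunction.nhds_basis_tsupport (I := 𝓡 m) x).mem_iff.1
    (hO.mem_nhds hxO)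
  have hP : {y | 0 < ρ₁ y * bitensionPairing m n d w φ y} ∈ 𝓝 x :=
    (isOpen_lt continuous_const (hcont ρ₁ hρ₁)).mem_nhds
      (by rw [Set.mem_ofPred_eq, ρ₁.eq_one, one_mul]; exact hpos)
  obtain ⟨ρ, -, hρ⟩ := (SmoothBumpFunction.nhds_basis_tsupport (I := 𝓡 m) x).mem_iff.1
    (inter_mem (hO.mem_nhds hxO) hP)
  have hρO := hρ.trans inter_subset_left
  have hΦ := isSmoothFamily_chartVariation hφ.1 hε hs ρ.contMDiff (hρ1 ρ) hρO
  have h0 : chartVariation n d φ ρ w 0 = φ := chartVariation_zero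
  have hoff (t : ℝ) (y : M) (hy : y ∉ tsupport ρ) : chartVariation n d φ ρ w t y = φ y :=
    chartVariation_of_eq_zero t (image_eq_zero_of_notMem_tsupport hy)
  have h1 := hΦ.hasDerivAt_bienergy ρ.hasCompactSupport.isCompact fun t y hy ↦ by
    rw [hoff t y hy, hoff 0 y hy]
  have h2 := h1.unique (hφ.2 _ ρ.hasCompactSupport.isCompact _ hΦ h0 hoff)
  rw [setIntegral_eq_integral_of_forall_compl_eq_zero fun y hy ↦ by
    rw [inner_varField_chartVariation hφ.1 hε hs ρ.contMDiff (hρ1 ρ) hρO,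
      image_eq_zero_of_notMem_tsupport hy, zero_mul],
    integral_congr_ae (Eventually.of_forall
      (inner_varField_chartVariation hφ.1 hε hs ρ.contMDiff (hρ1 ρ) hρO))] at h2
  refine h2.not_gt ((hcont ρ hρO).integral_pos_of_hasCompactSupport_nonneg_nonzero
    ρ.hasCompactSupport.mul_right (fun y ↦ ?_) (x := x) ?_)
  · by_cases hy : y ∈ tsupport ρ
    · have h3 : 0 < ρ₁ y * bitensionPairing m n d w φ y := (hρ hy).2
      exact mul_nonneg ρ.nonneg (pos_of_mul_pos_right h3 ρ₁.nonneg).le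
    · change 0 ≤ ρ y * _
      rw [image_eq_zero_of_notMem_tsupport hy, zero_mul]
  · rw [ρ.eq_one, one_mul]
    exact hpos.ne'

theorem isBiharmonic_iff (hφ : ContMDiff (𝓡 m) (𝓡 n) ∞ φ) :
    IsBiharmonic m n φ ↔ ∀ x, bitension (m := m) (n := n) φ x = 0 :=
  ⟨fun h ↦ h.bitension_eq_zero, isBiharmonic_of_bitension_eq_zero hφ⟩

end FundamentalLemma

end BiharmonicSubmersion

end

theorem mainTheorem2 {m n : ℕ}
    {M : Type*} [TopologicalSpace M] [T2Space M] [SigmaCompactSpace M]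
    [MeasurableSpace M] [BorelSpace M]
    [ChartedSpace (EuclideanSpace ℝ (Fin m)) M] [IsManifold (𝓡 m) ∞ M]
    [RiemannianBundle (fun x : M ↦ TangentSpace (𝓡 m) x)]
    [IsContMDiffRiemannianBundle (𝓡 m) ∞ (EuclideanSpace ℝ (Fin m))
      (fun x : M ↦ TangentSpace (𝓡 m) x)]
    {N : Type*} [TopologicalSpace N] [T2Space N] [SigmaCompactSpace N]
    [ChartedSpace (EuclideanSpace ℝ (Fin n)) N] [IsManifold (𝓡 n) ∞ N]
    [RiemannianBundle (fun x : N ↦ TangentSpace (𝓡 n) x)]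
    [IsContMDiffRiemannianBundle (𝓡 n) ∞ (EuclideanSpace ℝ (Fin n))
      (fun x : N ↦ TangentSpace (𝓡 n) x)]
    (φ : M → N) (hφ : BiharmonicSubmersion.IsRiemannianSubmersion (m := m) (n := n) φ) :
    -- the mean curvature field is basic iff the tension field is constant along the fibers
    (BiharmonicSubmersion.IsBasic (m := m) (n := n) φ
        (BiharmonicSubmersion.meanCurvature (m := m) (n := n) φ) ↔
      BiharmonicSubmersion.IsConstantAlongFibers (n := n) φ
        (BiharmonicSubmersion.tension (m := m) (n := n) φ)) ∧
    (BiharmonicSubmersion.IsBasic (m := m) (n := n) φ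
        (BiharmonicSubmersion.meanCurvature (m := m) (n := n) φ) →
      -- the condition in a family of adapted frames covering `M`
      (∀ (U : M → Set M) (e : M → Fin n → BiharmonicSubmersion.VField m M)
          (f : M → Fin (m - n) → BiharmonicSubmersion.VField m M),
        (∀ p, p ∈ U p ∧ BiharmonicSubmersion.IsAdaptedFrame φ (U p) (e p) (f p)) →
        (∀ p, ∀ x ∈ U p, BiharmonicSubmersion.meanCurvature (m := m) (n := n) φ x =
          ((m : ℝ) - n)⁻¹ • ∑ s, BiharmonicSubmersion.hor (n := n) φ x
            (BiharmonicSubmersion.nabla (f p s) x (f p s x))) ∧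
        (BiharmonicSubmersion.IsBiharmonic m n φ ↔
          ∀ p, ∀ x ∈ U p, BiharmonicSubmersion.frameExpression φ (e p)
            (BiharmonicSubmersion.meanCurvature (m := m) (n := n) φ) x = 0)) ∧
      -- the tension field is a smooth vector field `T` on `φ(M)`, and the condition on `T`
      (∃ T : BiharmonicSubmersion.VField n N, BiharmonicSubmersion.SmoothOn T (Set.range φ) ∧
        ∀ x, BiharmonicSubmersion.tension (m := m) (n := n) φ x = T (φ x)) ∧
      (∀ T : BiharmonicSubmersion.VField n N,
        (∀ x, BiharmonicSubmersion.tension (m := m) (n := n) φ x = T (φ x)) →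
        (∀ x, BiharmonicSubmersion.bitension (m := m) (n := n) φ x =
          BiharmonicSubmersion.traceHessian T (φ x)
            + BiharmonicSubmersion.nabla T (φ x) (T (φ x))
            + BiharmonicSubmersion.ricci (φ x) (T (φ x))) ∧
        (BiharmonicSubmersion.IsBiharmonic m n φ ↔
          ∀ q ∈ Set.range φ, BiharmonicSubmersion.traceHessian T q
            + BiharmonicSubmersion.nabla T q (T q)
            + BiharmonicSubmersion.ricci q (T q) = 0))) := by
  refine ⟨hφ.isBasic_iff, fun hb ↦ ?_⟩
  obtain ⟨T, hT⟩ := hφ.isBasic_iff.1 hb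
  have hbi := BiharmonicSubmersion.isBiharmonic_iff hφ.smooth
  refine ⟨fun U e f h ↦ ⟨fun p x hx ↦ hφ.meanCurvature_eq (h p).2 hx, hbi.trans ⟨?_, ?_⟩⟩,
    ⟨T, hφ.smoothOn_of_tension hT, hT⟩, fun T hT ↦ ⟨hφ.bitension_eq hT, hbi.trans ⟨?_, ?_⟩⟩⟩
  · exact fun h0 p x hx ↦ (hφ.frameExpression_eq_zero_iff (h p).2 hx hT).2 (h0 x)
  -- The frames cover M, and a single frame around x suffices since its expression at x is governed
  -- by the bitension there.
  · exact fun h0 x ↦ (hφ.frameExpression_eq_zero_iff (h x).2 (h x).1 hT).1 (h0 x x (h x).1)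
  · rintro h0 q ⟨x, rfl⟩
    rw [← hφ.bitension_eq hT, h0]
  · exact fun h0 x ↦ (hφ.bitension_eq hT x).trans (h0 _ ⟨x, rfl⟩)
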